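/- Let $n\ge 3$. For $1\le j\le n-1$ let $\gamma_j(y_1,\dots,y_n)=(y_1,\dots,\widehat{y_j},\dots,y_n,\sum_{i\ne j}y_i)$, and let $T_\Gamma=\{\gamma_{n-1}^A\gamma_j : A\in\mathbf Z_{\ge 0},\ 1\le j\le n-2\}$. Let $\mathcal H$ be the set of $y\in\mathbf R^n$ with $0\le y_1\le\dots\le y_n$ and $\sum_{j=1}^{n-1}y_j=y_n$, and let $\Delta=(\mathcal H\setminus\{0\})/\mathbf R_+$, identified with $\{w\in\mathcal H : w_n=1\}$, on which $T_\Gamma$ acts projectively. For real $s>1$ let $$\mathcal L_s[f](w)=\sum_{\gamma\in T_\Gamma}\Big(\frac{w_n}{(\gamma.w)_n}\Big)^{s}f(\gamma.w).$$ For every $s>1$ there is exactly one real number $\lambda_s$ such that $\mathcal L_s^*\nu=\lambda_s\nu$ for some Borel probability measure $\nu$ on $\Delta$, where $\mathcal L_s^*$ is the dual of $\mathcal L_s$ on $C^0(\Delta)$. It is positive, and it is the leading eigenvalue of $\mathcal L_s$ on $C^1(\Delta)$: it is an eigenvalue, and every other (complex) eigenvalue has modulus strictly less than $\lambda_s$.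 Moreover: 1. $s\mapsto\lambda_s$ is real analytic and strictly decreasing on $(1,\infty)$. 2. $\lambda_s<1$ for all sufficiently large $s$. 3. There is at most one $\beta_0\in(1,\infty)$ with $\lambda_{\beta_0}=1$; and if there is no such $\beta_0$, then $\lambda_s<1$ for all $s\in(1,\infty)$. -/

import Mathlib

open MeasureTheory

namespace MarkoffHurwitz

/-! Throughout `n = m + 3`, so that `n` runs over all integers `n ≥ 3`. The coordinates
`y_1, …, y_n` of a tuple `y : Fin (m + 3) → ℝ` are `y 0, …, y (Fin.last (m + 2))`. -/

/-- The linear map `γ_j (y_1, …, y_n) = (y_1, …, ŷ_j, …, y_n, ∑_{i ≠ j} y_i)`, where the hat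
denotes omission. -/
def gamma {m : ℕ} (j : Fin (m + 3)) (y : Fin (m + 3) → ℝ) : Fin (m + 3) → ℝ :=
  Fin.snoc (α := fun _ => ℝ) (fun i : Fin (m + 2) => y (j.succAbove i))
    (∑ i : Fin (m + 2), y (j.succAbove i))

/-- The element `γ_{n-1}^A γ_j` (`A ≥ 0`, `1 ≤ j ≤ n - 2`) of the countable generating set
`T_Γ`; the pair `(j, A)` ranges over `Fin (m + 1) × ℕ`. -/
def branch {m : ℕ} (p : Fin (m + 1) × ℕ) (y : Fin (m + 3) → ℝ) : Fin (m + 3) → ℝ :=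
  (gamma (Fin.last (m + 1)).castSucc)^[p.2] (gamma p.1.castSucc.castSucc y)

/-- The nonnegative ordered hyperplane `ℋ`: `0 ≤ y_1 ≤ … ≤ y_n` and
`y_1 + ⋯ + y_{n-1} = y_n`. -/
def hyperplane (m : ℕ) : Set (Fin (m + 3) → ℝ) :=
  {y | (∀ i, 0 ≤ y i) ∧ Monotone y ∧
    ∑ i : Fin (m + 2), y i.castSucc = y (Fin.last (m + 2))}

/-- `Δ = ℋ / ℝ₊`, each class being represented by its unique point
`w = (w_1, …, w_{n-1}, 1)` with last coordinate `1`. -/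
def Delta (m : ℕ) : Set (Fin (m + 3) → ℝ) :=
  {w | w ∈ hyperplane m ∧ w (Fin.last (m + 2)) = 1}

theorem gamma_mem {m : ℕ} (j : Fin (m + 2)) {y : Fin (m + 3) → ℝ}
    (hy : y ∈ hyperplane m ∧ 0 < y (Fin.last (m + 2))) :
    gamma j.castSucc y ∈ hyperplane m ∧ 0 < gamma j.castSucc y (Fin.last (m + 2)) := by
  obtain ⟨⟨h0, hmono, -⟩, hlast⟩ := hy
  have hpos : 0 < ∑ i : Fin (m + 2), y (j.castSucc.succAbove i) := by
    refine Finset.sum_pos' (fun i _ => h0 _) ⟨Fin.last (m + 1), Finset.mem_univ _, ?_⟩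
    have : j.castSucc.succAbove (Fin.last (m + 1)) = Fin.last (m + 2) := by
      rw [Fin.succAbove_of_le_castSucc _ _ (by
        rw [Fin.castSucc_le_castSucc_iff]; exact Fin.le_last j)]
      simp
    rw [this]
    exact hlast
  refine ⟨⟨?_, ?_, ?_⟩, ?_⟩
  · intro i
    refine Fin.lastCases ?_ (fun i => ?_) i
    · simpa [gamma] using hpos.le
    · simpa [gamma] using h0 _
  · intro a b
    refine Fin.lastCases ?_ (fun b => ?_) b
    · refine Fin.lastCases ?_ (fun a => ?_) a
      · intro _; exact le_rfl
      · intro _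
        simpa [gamma] using
          Finset.single_le_sum (f := fun i => y (j.castSucc.succAbove i))
            (fun i _ => h0 _) (Finset.mem_univ a)
    · refine Fin.lastCases ?_ (fun a => ?_) a
      · intro h
        exact absurd h (not_le.mpr (Fin.castSucc_lt_last b))
      · intro h
        simpa [gamma] using
          hmono ((Fin.strictMono_succAbove _).monotone (Fin.castSucc_le_castSucc_iff.mp h))
  · simp [gamma]
  · simpa [gamma] using hpos

theorem branch_mem {m : ℕ} (p : Fin (m + 1) × ℕ) {w : Fin (m + 3) → ℝ} (hw : w ∈ Delta m) :
    branch p w ∈ hyperplane m ∧ 0 < branch p w (Fin.last (m + 2)) := by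
  have key : ∀ A : ℕ,
      branch (p.1, A) w ∈ hyperplane m ∧ 0 < branch (p.1, A) w (Fin.last (m + 2)) := by
    intro A
    induction A with
    | zero => exact gamma_mem _ ⟨hw.1, by rw [hw.2]; exact one_pos⟩
    | succ A ih =>
      have h : branch (p.1, A + 1) w
          = gamma (Fin.last (m + 1)).castSucc (branch (p.1, A) w) := by
        simp only [branch, Function.iterate_succ_apply']
      rw [h]
      exact gamma_mem _ ih
  exact key p.2

theorem normalize_mem {m : ℕ} {y : Fin (m + 3) → ℝ}
    (hy : y ∈ hyperplane m ∧ 0 < y (Fin.last (m + 2))) :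
    (y (Fin.last (m + 2)))⁻¹ • y ∈ Delta m := by
  obtain ⟨⟨h0, hmono, hsum⟩, hlast⟩ := hy
  have hinv : 0 ≤ (y (Fin.last (m + 2)))⁻¹ := (inv_pos.mpr hlast).le
  refine ⟨⟨fun i => mul_nonneg hinv (h0 i), fun a b h => ?_, ?_⟩, ?_⟩
  · exact mul_le_mul_of_nonneg_left (hmono h) hinv
  · simp only [Pi.smul_apply, smul_eq_mul, ← Finset.mul_sum, hsum]
  · simp only [Pi.smul_apply, smul_eq_mul]
    exact inv_mul_cancel₀ hlast.ne'

/-- The projective action of `γ_{n-1}^A γ_j ∈ T_Γ` on `Δ`. -/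
noncomputable def act {m : ℕ} (p : Fin (m + 1) × ℕ) (w : Delta m) : Delta m :=
  ⟨(branch p w.1 (Fin.last (m + 2)))⁻¹ • branch p w.1, normalize_mem (branch_mem p w.2)⟩

/-- The transfer operator
`ℒ_s[f](w) = ∑_{γ ∈ T_Γ} (w_n / (γ.w)_n)^s f(γ.w)`, for real `s` and real- or complex-valued
`f` on `Δ`. For `s > 1` and bounded `f` the sum converges absolutely. -/
noncomputable def transfer {m : ℕ} {E : Type*} [NormedAddCommGroup E] [NormedSpace ℝ E]
    (s : ℝ) (f : Delta m → E) (w : Delta m) : E :=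
  ∑' p : Fin (m + 1) × ℕ,
    ((w.1 (Fin.last (m + 2)) / branch p w.1 (Fin.last (m + 2))) ^ s) • f (act p w)

/-- `l` is the eigenvalue of a probability eigenmeasure of the dual operator:
`ℒ_s^* ν = l ν` for some Borel probability measure `ν` on `Δ`, where `ℒ_s` acts on the
continuous functions on `Δ`. -/
def HasEigenmeasure (m : ℕ) (s l : ℝ) : Prop :=
  ∃ ν : Measure (Delta m), IsProbabilityMeasure ν ∧
    ∀ f : C(Delta m, ℝ), ∫ w, transfer s f w ∂ν = l * ∫ w, f w ∂ν

/-- `f` is continuously differentiable on the simplex `Δ`. -/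
def IsC1 {m : ℕ} (f : Delta m → ℂ) : Prop :=
  ∃ g : (Fin (m + 3) → ℝ) → ℂ, ContDiffOn ℝ 1 g (Delta m) ∧ ∀ w : Delta m, g w.1 = f w

/-- `μ` is an eigenvalue of `ℒ_s` on the complex space `C¹(Δ)`. -/
def IsC1Eigenvalue (m : ℕ) (s : ℝ) (μ : ℂ) : Prop :=
  ∃ f : Delta m → ℂ, IsC1 f ∧ f ≠ 0 ∧ ∀ w, transfer s f w = μ * f w

/-- `l` is the leading eigenvalue of `ℒ_s` on `C¹(Δ)`: it is an eigenvalue, and every other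
eigenvalue has strictly smaller modulus. -/
def IsLeadingEigenvalue (m : ℕ) (s l : ℝ) : Prop :=
  IsC1Eigenvalue m s (l : ℂ) ∧ ∀ μ : ℂ, IsC1Eigenvalue m s μ → μ ≠ (l : ℂ) → ‖μ‖ < l

end MarkoffHurwitz

/-!
The branches `γ_{n-1}^A γ_j` contract the simplex `Δ`, and the weights of the transfer operator are
`exp (-s * log (height))`, where the height of a branch at `w` is the last coordinate of its value.
In the `ℓ¹`-distance of the first `n - 1` coordinates, a branch contracts by its height
(`dist1_act_le`), the heights are at least `3 / 2`, their logarithms are Lipschitz, uniformly in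
the branch, and they grow linearly in `A`, so that the weights are summable exactly in the range
`s > 1`. These properties are the axioms of a `ContractingSystem`; all but the `C¹` regularity is
proved for an arbitrary such system.

*Positive eigenfunction.* The transfer operator maps the cone of functions with `a`-Lipschitz
logarithm into the cone of a smaller constant, if `a` is large (`Cone.T_apt`), and this makes it a
strict contraction in the order of the cone (`Cone.contract`). Hence the iterates of `1`, normalized
at a base point, converge geometrically to a positive eigenfunction `h`, whose eigenvalue `λ_s` is
positive (`exists_isPerron`). By comparison, `λ_s` is the only eigenvalue with a bounded
eigenfunction that is bounded away from `0` (`eigenvalue_le`).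

*Leading eigenvalue.* Let `f` be a continuous eigenfunction for `μ`. At a maximum of `|f| / h` the
triangle inequality gives `|μ| ≤ λ_s`. In case of equality `f / h` is multiplied by `μ / λ_s` along
each branch, and `|f| / h` is again maximal at the image point; since the iterates of one branch
contract, continuity of `f / h` forces `μ = λ_s` (`IsPerron.norm_lt`).

*Eigenmeasure.* A limit of averages of `λ_s ^ (-k) (ℒ_s ^ k f)` at the base point is a positive
linear functional on the continuous functions, hence a measure, and it is an eigenvector of the dual
operator (`exists_eigenmeasure`). Integrating `h` shows that no other number is the eigenvalue of an
eigenmeasure (`IsPerron.eq_of_eigenmeasure`).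

*Analyticity.* For complex `s` near a real `s₀`, the projective action `f ↦ ℒ_s f / (ℒ_s f)(base)`
is still a contraction near `h`, with respect to the oscillation relative to `h` in the order of the
cone (`proj_contract`). The multipliers of its iteration are holomorphic in `s` and converge
uniformly, and at real `s` the limit belongs to a positive eigenfunction, so it is the eigenvalue up
to the fixed factor `λ_{s₀}` (`IsPerron.exists_holomorphic`, `analyticOnNhd_of_isPerron`).

*Differentiability.* The iterates `ℒ_s ^ N 1` are sums of powers `L ^ (-s)` of linear forms `L`, all
of which satisfy the inequalities `Balanced`. For such forms the first order Taylor expansion of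
`L ^ (-s)` has constants proportional to `L ^ (-s)` itself (`Balanced.expansion`), so the normalized
iterates have uniformly controlled expansions, which pass to the limit `h` (`HasExpansion.isC1`).

*Dependence on the parameter.* As all heights are at least `3 / 2`, comparison of the operators for
two parameters gives `λ_t ≤ (3 / 2) ^ (-(t - s)) λ_s` for `s ≤ t` (`IsPerron.le_exp_mul`). This
yields strict monotonicity and `λ_s < 1` for large `s`, and the alternative about the value `1`
follows from continuity.
-/

/-! ### Contracting systems, transfer operators and invariant cones -/

/-- A family of uniformly contracting maps `map i` of a space of finite diameter, each with a
logarithmic expansion rate `len i`. Only the symmetric gauge `d` is used to measure distances, no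
metric space structure is assumed. The rates are Lipschitz with constant `distortion`, uniformly in
`i`, and `∑ i, exp (-s * len i x)` converges for `s > 1`. The point `base`, used for
normalizations, and the index `index` make the space and the family nonempty. -/
structure ContractingSystem (X I : Type) where
  d : X → X → ℝ
  diam : ℝ
  ratio : ℝ
  distortion : ℝ
  map : I → X → X
  len : I → X → ℝ
  base : X
  index : I
  d_nonneg : ∀ x y, 0 ≤ d x y
  d_comm : ∀ x y, d x y = d y x
  d_le : ∀ x y, d x y ≤ diam
  ratio_nonneg : 0 ≤ ratio
  ratio_lt_one : ratio < 1
  distortion_nonneg : 0 ≤ distortion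
  d_map_le : ∀ i x y, d (map i x) (map i y) ≤ ratio * d x y
  len_sub_le : ∀ i x y, len i x - len i y ≤ distortion * d x y
  len_nonneg : ∀ i x, 0 ≤ len i x
  summable_base : ∀ s : ℝ, 1 < s → Summable fun i => Real.exp (-s * len i base)

namespace ContractingSystem

variable {X I : Type} (S : ContractingSystem X I)

/-- The transfer operator with real parameter. -/
noncomputable def T (s : ℝ) (f : X → ℝ) (x : X) : ℝ :=
  ∑' i, Real.exp (-s * S.len i x) * f (S.map i x)

/-- A function with bounded range. -/
def Bdd {E : Type} [Norm E] (f : X → E) : Prop := ∃ B : ℝ, ∀ x, ‖f x‖ ≤ B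

theorem diam_nonneg : 0 ≤ S.diam := (S.d_nonneg S.base S.base).trans (S.d_le _ _)

theorem exp_len_le {s : ℝ} (hs : 0 ≤ s) (i : I) (x y : X) :
    Real.exp (-s * S.len i x)
      ≤ Real.exp (s * S.distortion * S.d x y) * Real.exp (-s * S.len i y) := by
  rw [← Real.exp_add]
  apply Real.exp_le_exp.mpr
  have h := mul_le_mul_of_nonneg_left (S.len_sub_le i y x) hs
  rw [S.d_comm y x] at h
  linarith

theorem summable_exp {s : ℝ} (hs : 1 < s) (x : X) :
    Summable fun i => Real.exp (-s * S.len i x) :=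
  Summable.of_nonneg_of_le (fun _ => (Real.exp_pos _).le)
    (fun i => S.exp_len_le (zero_le_one.trans hs.le) i x S.base)
    ((S.summable_base s hs).mul_left _)

theorem summable_T {s : ℝ} (hs : 1 < s) {f : X → ℝ} (hf : Bdd f) (x : X) :
    Summable fun i => Real.exp (-s * S.len i x) * f (S.map i x) := by
  obtain ⟨B, hB⟩ := hf
  refine Summable.of_norm_bounded ((S.summable_exp hs x).mul_right B) fun i => ?_
  rw [norm_mul, Real.norm_of_nonneg (Real.exp_pos _).le]
  exact mul_le_mul_of_nonneg_left (hB _) (Real.exp_pos _).le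

namespace Bdd

variable {f g : X → ℝ}

theorem const (c : ℝ) : Bdd (fun _ : X => c) := ⟨‖c‖, fun _ => le_rfl⟩

theorem add (hf : Bdd f) (hg : Bdd g) : Bdd fun x => f x + g x := by
  obtain ⟨A, hA⟩ := hf
  obtain ⟨B, hB⟩ := hg
  exact ⟨A + B, fun x => (norm_add_le _ _).trans (add_le_add (hA x) (hB x))⟩

theorem const_mul (c : ℝ) (hf : Bdd f) : Bdd fun x => c * f x := by
  obtain ⟨A, hA⟩ := hf
  exact ⟨‖c‖ * A, fun x => by
    rw [norm_mul]; exact mul_le_mul_of_nonneg_left (hA x) (norm_nonneg _)⟩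

theorem sub (hf : Bdd f) (hg : Bdd g) : Bdd fun x => f x - g x := by
  simpa [sub_eq_add_neg] using hf.add (hg.const_mul (-1))

end Bdd

theorem T_add {s : ℝ} (hs : 1 < s) {f g : X → ℝ} (hf : Bdd f) (hg : Bdd g) (x : X) :
    S.T s (fun x => f x + g x) x = S.T s f x + S.T s g x := by
  unfold T
  rw [← (S.summable_T hs hf x).tsum_add (S.summable_T hs hg x)]
  simp only [mul_add]

theorem T_const_mul (s c : ℝ) (f : X → ℝ) (x : X) :
    S.T s (fun x => c * f x) x = c * S.T s f x := by
  unfold T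
  rw [← tsum_mul_left]
  exact tsum_congr fun i => by ring

theorem T_sub {s : ℝ} (hs : 1 < s) {f g : X → ℝ} (hf : Bdd f) (hg : Bdd g) (x : X) :
    S.T s (fun x => f x - g x) x = S.T s f x - S.T s g x := by
  unfold T
  rw [← (S.summable_T hs hf x).tsum_sub (S.summable_T hs hg x)]
  simp only [mul_sub]

theorem T_mono {s : ℝ} (hs : 1 < s) {f g : X → ℝ} (hf : Bdd f) (hg : Bdd g)
    (h : ∀ x, f x ≤ g x) (x : X) : S.T s f x ≤ S.T s g x :=
  (S.summable_T hs hf x).tsum_le_tsum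
    (fun _ => mul_le_mul_of_nonneg_left (h _) (Real.exp_pos _).le) (S.summable_T hs hg x)

theorem T_nonneg (s : ℝ) {f : X → ℝ} (h : ∀ x, 0 ≤ f x) (x : X) : 0 ≤ S.T s f x :=
  tsum_nonneg fun _ => mul_nonneg (Real.exp_pos _).le (h _)

theorem T_pos {s : ℝ} (hs : 1 < s) {f : X → ℝ} (hf : Bdd f) (h : ∀ x, 0 < f x) (x : X) :
    0 < S.T s f x :=
  (S.summable_T hs hf x).tsum_pos (fun _ => mul_nonneg (Real.exp_pos _).le (h _).le) S.index
    (mul_pos (Real.exp_pos _) (h _))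

/-- The cone of nonnegative functions whose logarithm is `a`-Lipschitz for the gauge `d`. -/
def Cone (a : ℝ) (f : X → ℝ) : Prop :=
  (∀ x, 0 ≤ f x) ∧ ∀ x y, f x ≤ Real.exp (a * S.d x y) * f y

variable {S}

theorem Cone.mono {a b : ℝ} (hab : a ≤ b) {f : X → ℝ} (hf : S.Cone a f) : S.Cone b f :=
  ⟨hf.1, fun x y => (hf.2 x y).trans (mul_le_mul_of_nonneg_right
    (Real.exp_le_exp.mpr (mul_le_mul_of_nonneg_right hab (S.d_nonneg _ _))) (hf.1 y))⟩

theorem Cone.add {a : ℝ} {f g : X → ℝ} (hf : S.Cone a f) (hg : S.Cone a g) :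
    S.Cone a fun x => f x + g x :=
  ⟨fun x => add_nonneg (hf.1 x) (hg.1 x), fun x y => by
    rw [mul_add]; exact add_le_add (hf.2 x y) (hg.2 x y)⟩

theorem Cone.const_mul {a c : ℝ} (hc : 0 ≤ c) {f : X → ℝ} (hf : S.Cone a f) :
    S.Cone a fun x => c * f x :=
  ⟨fun x => mul_nonneg hc (hf.1 x), fun x y => by
    rw [mul_left_comm]; exact mul_le_mul_of_nonneg_left (hf.2 x y) hc⟩

theorem Cone.const {a c : ℝ} (ha : 0 ≤ a) (hc : 0 ≤ c) : S.Cone a fun _ => c :=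
  ⟨fun _ => hc, fun x y => le_mul_of_one_le_left hc
    (Real.one_le_exp (mul_nonneg ha (S.d_nonneg x y)))⟩

theorem Cone.le_diam {a : ℝ} (ha : 0 ≤ a) {f : X → ℝ} (hf : S.Cone a f) (x y : X) :
    f x ≤ Real.exp (a * S.diam) * f y :=
  (hf.2 x y).trans (mul_le_mul_of_nonneg_right
    (Real.exp_le_exp.mpr (mul_le_mul_of_nonneg_left (S.d_le _ _) ha)) (hf.1 y))

theorem Cone.bdd {a : ℝ} (ha : 0 ≤ a) {f : X → ℝ} (hf : S.Cone a f) : Bdd f :=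
  ⟨Real.exp (a * S.diam) * f S.base, fun x => by
    rw [Real.norm_of_nonneg (hf.1 x)]; exact hf.le_diam ha x _⟩

/-- The contraction of the maps improves the logarithmic Lipschitz constant. -/
theorem Cone.T {a s : ℝ} (hs : 1 < s) (ha : 0 ≤ a) {f : X → ℝ} (hf : S.Cone a f) :
    S.Cone (s * S.distortion + S.ratio * a) (S.T s f) := by
  have hs0 : 0 ≤ s := zero_le_one.trans hs.le
  refine ⟨S.T_nonneg s hf.1, fun x y => ?_⟩
  unfold ContractingSystem.T
  rw [← tsum_mul_left]
  refine (S.summable_T hs (hf.bdd ha) x).tsum_le_tsum (fun i => ?_)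
    ((S.summable_T hs (hf.bdd ha) y).mul_left _)
  calc Real.exp (-s * S.len i x) * f (S.map i x)
      ≤ (Real.exp (s * S.distortion * S.d x y) * Real.exp (-s * S.len i y)) *
          (Real.exp (S.ratio * a * S.d x y) * f (S.map i y)) := by
        refine mul_le_mul (S.exp_len_le hs0 i x y) ((hf.2 _ (S.map i y)).trans ?_) (hf.1 _)
          (by positivity)
        refine mul_le_mul_of_nonneg_right (Real.exp_le_exp.mpr ?_) (hf.1 _)
        have := mul_le_mul_of_nonneg_left (S.d_map_le i x y) ha
        linarith
    _ = _ := by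
        rw [add_mul, Real.exp_add]; ring

variable (S)

/-- The Lipschitz constant of a cone which the transfer operator `T s` maps strictly inside
itself, namely into the cone of constant `S.apt s - 1`. -/
noncomputable def apt (s : ℝ) : ℝ := (s * S.distortion + 1) / (1 - S.ratio)

theorem apt_eq (s : ℝ) : s * S.distortion + S.ratio * S.apt s = S.apt s - 1 := by
  have : 1 - S.ratio ≠ 0 := (sub_pos.mpr S.ratio_lt_one).ne'
  unfold apt
  field_simp
  ring

theorem one_le_apt {s : ℝ} (hs : 0 ≤ s) : 1 ≤ S.apt s := by
  unfold apt
  rw [le_div_iff₀ (sub_pos.mpr S.ratio_lt_one)]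
  nlinarith [S.ratio_nonneg, mul_nonneg hs S.distortion_nonneg]

variable {S}

theorem Cone.T_apt {s : ℝ} (hs : 1 < s) {f : X → ℝ} (hf : S.Cone (S.apt s) f) :
    S.Cone (S.apt s - 1) (S.T s f) := by
  rw [← S.apt_eq]
  exact hf.T hs (zero_le_one.trans (S.one_le_apt (zero_le_one.trans hs.le)))

theorem exp_sub_exp_le {u v : ℝ} : Real.exp u - Real.exp v ≤ (u - v) * Real.exp u := by
  have := Real.add_one_le_exp (v - u)
  have h2 : Real.exp v = Real.exp u * Real.exp (v - u) := by rw [← Real.exp_add]; ring_nf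
  rw [h2]
  nlinarith [Real.exp_pos u]

theorem le_exp_sub_exp {u v : ℝ} (hv : 0 ≤ v) (huv : v ≤ u) :
    u - v ≤ Real.exp u - Real.exp v := by
  have := Real.add_one_le_exp (u - v)
  have h2 : Real.exp u = Real.exp v * Real.exp (u - v) := by rw [← Real.exp_add]; ring_nf
  have h3 := Real.one_le_exp hv
  rw [h2]
  nlinarith

/-- An element of the smaller cone that dominates `κ * G` stays in the larger cone after a small
multiple of `G` is removed. -/
theorem Cone.sub_const_mul {a κ δ : ℝ} (ha : 1 ≤ a) {F G : X → ℝ} (hF : S.Cone (a - 1) F)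
    (hG : S.Cone (a - 1) G) (hδ : 0 ≤ δ) (hFG : ∀ x, κ * G x ≤ F x)
    (hδκ : δ * (2 * a * Real.exp (a * S.diam)) ≤ κ) (hδ1 : δ ≤ κ) :
    S.Cone a fun x => F x - δ * G x := by
  refine ⟨fun x => sub_nonneg.mpr ((mul_le_mul_of_nonneg_right hδ1 (hG.1 x)).trans (hFG x)),
    fun x y => ?_⟩
  have hd := S.d_nonneg x y
  set t := S.d x y with ht
  have hE1 : t ≤ Real.exp (a * t) - Real.exp ((a - 1) * t) := by
    have := le_exp_sub_exp (u := a * t) (v := (a - 1) * t) (by nlinarith) (by nlinarith)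
    linarith
  have hE2 : Real.exp (a * t) - Real.exp (-((a - 1) * t)) ≤ 2 * a * Real.exp (a * S.diam) * t := by
    have h1 := exp_sub_exp_le (u := a * t) (v := -((a - 1) * t))
    have h2 : Real.exp (a * t) ≤ Real.exp (a * S.diam) :=
      Real.exp_le_exp.mpr (mul_le_mul_of_nonneg_left (S.d_le x y) (by linarith))
    have h3 : a * t - -((a - 1) * t) ≤ 2 * a * t := by nlinarith
    have h4 : 0 ≤ 2 * a * t := by positivity
    nlinarith [Real.exp_pos (a * t)]
  have hFx := hF.2 x y
  have hGx : Real.exp (-((a - 1) * t)) * G y ≤ G x := by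
    have h := hG.2 y x
    rw [S.d_comm y x, ← ht] at h
    rw [Real.exp_neg, inv_mul_le_iff₀ (Real.exp_pos _)]
    exact h
  have hGy := hG.1 y
  have hFy := hFG y
  have k1 : t * F y ≤ (Real.exp (a * t) - Real.exp ((a - 1) * t)) * F y :=
    mul_le_mul_of_nonneg_right hE1 (hF.1 y)
  have k2 : (Real.exp (a * t) - Real.exp (-((a - 1) * t))) * (δ * G y)
      ≤ 2 * a * Real.exp (a * S.diam) * t * (δ * G y) :=
    mul_le_mul_of_nonneg_right hE2 (mul_nonneg hδ hGy)
  have k3 : δ * (2 * a * Real.exp (a * S.diam)) * (t * G y) ≤ κ * (t * G y) :=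
    mul_le_mul_of_nonneg_right hδκ (mul_nonneg hd hGy)
  have k4 : t * (κ * G y) ≤ t * F y := mul_le_mul_of_nonneg_left hFy hd
  have k5 := mul_le_mul_of_nonneg_left hGx hδ
  rw [← ht] at hFx
  nlinarith

variable (S)

/-- The contraction rate defect of `T s` in the order of the cone of constant `S.apt s`. -/
noncomputable def gap (s : ℝ) : ℝ :=
  Real.exp (-(2 * (S.apt s - 1) * S.diam)) / 2 / (2 * S.apt s * Real.exp (S.apt s * S.diam))

theorem gap_pos {s : ℝ} (hs : 0 ≤ s) : 0 < S.gap s := by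
  have := S.one_le_apt hs
  unfold gap
  positivity

theorem gap_mul {s : ℝ} (hs : 0 ≤ s) : S.gap s * (2 * S.apt s * Real.exp (S.apt s * S.diam))
    = Real.exp (-(2 * (S.apt s - 1) * S.diam)) / 2 := by
  have := S.one_le_apt hs
  unfold gap
  field_simp

theorem gap_le {s : ℝ} (hs : 0 ≤ s) :
    S.gap s ≤ Real.exp (-(2 * (S.apt s - 1) * S.diam)) / 2 := by
  have h1 := S.one_le_apt hs
  rw [← S.gap_mul hs]
  have h2 : 1 ≤ Real.exp (S.apt s * S.diam) :=
    Real.one_le_exp (mul_nonneg (by linarith) S.diam_nonneg)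
  exact le_mul_of_one_le_right (S.gap_pos hs).le (by nlinarith)

theorem gap_lt_one {s : ℝ} (hs : 0 ≤ s) : S.gap s < 1 := by
  have h1 := S.one_le_apt hs
  have h2 : Real.exp (-(2 * (S.apt s - 1) * S.diam)) ≤ 1 := by
    apply Real.exp_le_one_iff.mpr
    have := mul_nonneg (sub_nonneg.mpr h1) S.diam_nonneg
    linarith
  linarith [S.gap_le hs]

variable {S}

theorem Cone.sub_gap_mul {s r : ℝ} (hs : 0 ≤ s) (hr : 0 ≤ r) {F G : X → ℝ}
    (hF : S.Cone (S.apt s - 1) F) (hG : S.Cone (S.apt s - 1) G)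
    (hFG : r / 2 * G S.base ≤ F S.base) :
    S.Cone (S.apt s) fun x => F x - S.gap s * r * G x := by
  have ha := S.one_le_apt hs
  set E := Real.exp ((S.apt s - 1) * S.diam) with hE
  have hEE : Real.exp (-(2 * (S.apt s - 1) * S.diam)) * (E * E) = 1 := by
    rw [hE, ← Real.exp_add, ← Real.exp_add, Real.exp_eq_one_iff]; ring
  have key : ∀ x, Real.exp (-(2 * (S.apt s - 1) * S.diam)) / 2 * r * G x ≤ F x := fun x => by
    have h1 := hF.le_diam (sub_nonneg.mpr ha) S.base x
    have h2 := hG.le_diam (sub_nonneg.mpr ha) x S.base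
    rw [← hE] at h1 h2
    have hEp : 0 < E := Real.exp_pos _
    have h3 : r / 2 * G x ≤ E * (E * F x) := by
      calc r / 2 * G x ≤ r / 2 * (E * G S.base) := by gcongr
        _ = E * (r / 2 * G S.base) := by ring
        _ ≤ E * (E * F x) := mul_le_mul_of_nonneg_left (hFG.trans h1) hEp.le
    calc Real.exp (-(2 * (S.apt s - 1) * S.diam)) / 2 * r * G x
        = Real.exp (-(2 * (S.apt s - 1) * S.diam)) * (r / 2 * G x) := by ring
      _ ≤ Real.exp (-(2 * (S.apt s - 1) * S.diam)) * (E * (E * F x)) := by gcongr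
      _ = Real.exp (-(2 * (S.apt s - 1) * S.diam)) * (E * E) * F x := by ring
      _ = F x := by rw [hEE, one_mul]
  refine hF.sub_const_mul ha hG (mul_nonneg (S.gap_pos hs).le hr) key ?_ ?_
  · rw [← S.gap_mul hs]; apply le_of_eq; ring
  · exact mul_le_mul_of_nonneg_right (S.gap_le hs) hr

/-- Contraction of the cone order. If `f` lies between `m * g` and `M * g` in the order of the
cone, then `T s f` lies between `m' * T s g` and `M' * T s g` for a shorter interval `[m', M']`. -/
theorem Cone.contract {s m M : ℝ} (hs : 1 < s) (hmM : m ≤ M) {f g : X → ℝ} (hfb : Bdd f)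
    (hg : S.Cone (S.apt s) g) (h1 : S.Cone (S.apt s) fun x => f x - m * g x)
    (h2 : S.Cone (S.apt s) fun x => M * g x - f x) :
    ∃ m' M', m ≤ m' ∧ M' ≤ M ∧ M' - m' = (1 - S.gap s) * (M - m) ∧
      S.Cone (S.apt s) (fun x => S.T s f x - m' * S.T s g x) ∧
      S.Cone (S.apt s) (fun x => M' * S.T s g x - S.T s f x) := by
  have hs0 : 0 ≤ s := zero_le_one.trans hs.le
  have ha := S.one_le_apt hs0
  have hgb := hg.bdd (zero_le_one.trans ha)
  have hG := hg.T_apt hs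
  have hF1 := h1.T_apt hs
  have hF2 := h2.T_apt hs
  have e1 : S.T s (fun x => f x - m * g x) = fun x => S.T s f x - m * S.T s g x := by
    funext x; rw [S.T_sub hs hfb (hgb.const_mul m), S.T_const_mul]
  have e2 : S.T s (fun x => M * g x - f x) = fun x => M * S.T s g x - S.T s f x := by
    funext x; rw [S.T_sub hs (hgb.const_mul M) hfb, S.T_const_mul]
  rw [e1] at hF1
  rw [e2] at hF2
  have hδ := (S.gap_pos hs0).le
  have hr := sub_nonneg.mpr hmM
  have hδr := mul_nonneg hδ hr
  rcases le_total ((M - m) / 2 * S.T s g S.base)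
    (S.T s f S.base - m * S.T s g S.base) with h | h
  · refine ⟨m + S.gap s * (M - m), M, by linarith, le_rfl, by ring, ?_, hF2.mono (by linarith)⟩
    have := hF1.sub_gap_mul hs0 hr hG h
    convert this using 2
    ring
  · refine ⟨m, M - S.gap s * (M - m), le_rfl, by linarith, by ring, hF1.mono (by linarith), ?_⟩
    have := hF2.sub_gap_mul hs0 hr hG (by linarith)
    convert this using 2
    ring

/-- A bounded Lipschitz function, as small as `e`, is absorbed into the cone by a multiple of a
function which is bounded below and lies in the smaller cone. -/
theorem Cone.add_of_lipschitz {a e t c : ℝ} (ha : 1 ≤ a) {h G : X → ℝ} (hh : S.Cone (a - 1) h)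
    (hc : ∀ x, c ≤ h x) (he : 0 ≤ e) (ht : 0 ≤ t) (hG : ∀ x, |G x| ≤ e)
    (hGL : ∀ x y, |G x - G y| ≤ e * S.d x y)
    (hte : e * (a * Real.exp (a * S.diam) + 1) ≤ t * c) :
    S.Cone a fun x => G x + t * h x := by
  have hE0 : (0 : ℝ) ≤ a * Real.exp (a * S.diam) := by positivity
  refine ⟨fun x => ?_, fun x y => ?_⟩
  · have h1 := neg_le_of_abs_le (hG x)
    have h2 := mul_le_mul_of_nonneg_left (hc x) ht
    nlinarith
  · have hd := S.d_nonneg x y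
    set u := S.d x y with hu
    have hE1 : u ≤ Real.exp (a * u) - Real.exp ((a - 1) * u) := by
      have := le_exp_sub_exp (u := a * u) (v := (a - 1) * u) (by nlinarith) (by nlinarith)
      linarith
    have hE2 : Real.exp (a * u) - 1 ≤ a * Real.exp (a * S.diam) * u := by
      have h1 := exp_sub_exp_le (u := a * u) (v := 0)
      have h2 : Real.exp (a * u) ≤ Real.exp (a * S.diam) :=
        Real.exp_le_exp.mpr (mul_le_mul_of_nonneg_left (S.d_le x y) (by linarith))
      have h4 : 0 ≤ a * u := by positivity
      rw [Real.exp_zero] at h1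
      nlinarith
    have hE3 : 0 ≤ Real.exp (a * u) - 1 := by
      have := Real.one_le_exp (x := a * u) (by positivity); linarith
    have k0 := hh.2 x y
    rw [← hu] at k0
    have k1 : t * h x ≤ t * (Real.exp ((a - 1) * u) * h y) := mul_le_mul_of_nonneg_left k0 ht
    have k2 : u * (t * h y) ≤ (Real.exp (a * u) - Real.exp ((a - 1) * u)) * (t * h y) :=
      mul_le_mul_of_nonneg_right hE1 (mul_nonneg ht (hh.1 y))
    have k3 : u * (t * c) ≤ u * (t * h y) :=
      mul_le_mul_of_nonneg_left (mul_le_mul_of_nonneg_left (hc y) ht) hd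
    have k4 := le_of_abs_le (hGL x y)
    have k5 : (Real.exp (a * u) - 1) * (-e) ≤ (Real.exp (a * u) - 1) * G y :=
      mul_le_mul_of_nonneg_left (neg_le_of_abs_le (hG y)) hE3
    have k6 : (Real.exp (a * u) - 1) * e ≤ a * Real.exp (a * S.diam) * u * e :=
      mul_le_mul_of_nonneg_right hE2 he
    have k7 := mul_le_mul_of_nonneg_left hte hd
    rw [← hu] at k4
    nlinarith

end ContractingSystem

/-! ### The positive eigenfunction -/

namespace ContractingSystem

variable {X I : Type} (S : ContractingSystem X I)

theorem abs_T_le {s : ℝ} (hs : 1 < s) {f : X → ℝ} {B : ℝ} (hB : ∀ x, |f x| ≤ B) (x : X) :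
    |S.T s f x| ≤ B * ∑' i, Real.exp (-s * S.len i x) := by
  rw [mul_comm, ← tsum_mul_right, ← Real.norm_eq_abs]
  refine tsum_of_norm_bounded ((S.summable_exp hs x).mul_right B).hasSum fun i => ?_
  rw [norm_mul, Real.norm_of_nonneg (Real.exp_pos _).le]
  exact mul_le_mul_of_nonneg_left (hB _) (Real.exp_pos _).le

theorem tsum_exp_le {s : ℝ} (hs : 1 < s) (x : X) : ∑' i, Real.exp (-s * S.len i x)
    ≤ Real.exp (s * S.distortion * S.diam) * ∑' i, Real.exp (-s * S.len i S.base) := by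
  have hs0 : 0 ≤ s := zero_le_one.trans hs.le
  rw [← tsum_mul_left]
  refine (S.summable_exp hs x).tsum_le_tsum (fun i => (S.exp_len_le hs0 i x S.base).trans ?_)
    ((S.summable_exp hs _).mul_left _)
  refine mul_le_mul_of_nonneg_right (Real.exp_le_exp.mpr ?_) (Real.exp_pos _).le
  exact mul_le_mul_of_nonneg_left (S.d_le _ _) (mul_nonneg hs0 S.distortion_nonneg)

variable {S}

theorem Bdd.T {s : ℝ} (hs : 1 < s) {f : X → ℝ} (hf : Bdd f) : Bdd (S.T s f) := by
  obtain ⟨B, hB⟩ := hf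
  have hB0 : 0 ≤ B := (norm_nonneg _).trans (hB S.base)
  exact ⟨_, fun x => (S.abs_T_le hs hB x).trans
    (mul_le_mul_of_nonneg_left (S.tsum_exp_le hs x) hB0)⟩

theorem Cone.iterate {s : ℝ} (hs : 1 < s) {f : X → ℝ} (hf : S.Cone (S.apt s) f) (N : ℕ) :
    S.Cone (S.apt s) ((S.T s)^[N] f) := by
  induction N with
  | zero => exact hf
  | succ N ih =>
    rw [Function.iterate_succ_apply']
    exact (ih.T_apt hs).mono (by linarith)

/-- Iterated form of `Cone.contract`. -/
theorem Cone.contract_iterate {s m₀ M₀ : ℝ} (hs : 1 < s) (hmM : m₀ ≤ M₀) {f g : X → ℝ}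
    (hfb : Bdd f) (hg : S.Cone (S.apt s) g) (h1 : S.Cone (S.apt s) fun x => f x - m₀ * g x)
    (h2 : S.Cone (S.apt s) fun x => M₀ * g x - f x) :
    ∃ m M : ℕ → ℝ, m 0 = m₀ ∧ (∀ N, m N ≤ m (N + 1)) ∧ (∀ N, M (N + 1) ≤ M N) ∧
      (∀ N, M N - m N = (M₀ - m₀) * (1 - S.gap s) ^ N) ∧
      ∀ N x, m N * (S.T s)^[N] g x ≤ (S.T s)^[N] f x ∧
        (S.T s)^[N] f x ≤ M N * (S.T s)^[N] g x := by
  have hgap := S.gap_lt_one (zero_le_one.trans hs.le)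
  let Q : ℕ → ℝ × ℝ → Prop := fun N p => p.1 ≤ p.2 ∧
    S.Cone (S.apt s) (fun x => (S.T s)^[N] f x - p.1 * (S.T s)^[N] g x) ∧
    S.Cone (S.apt s) (fun x => p.2 * (S.T s)^[N] g x - (S.T s)^[N] f x)
  have hb : ∀ N, Bdd ((S.T s)^[N] f) := by
    intro N
    induction N with
    | zero => exact hfb
    | succ N ih => rw [Function.iterate_succ_apply']; exact ih.T hs
  have step : ∀ N (p : ℝ × ℝ), Q N p → ∃ p' : ℝ × ℝ,
      (p.1 ≤ p'.1 ∧ p'.2 ≤ p.2 ∧ p'.2 - p'.1 = (1 - S.gap s) * (p.2 - p.1)) ∧ Q (N + 1) p' := by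
    rintro N ⟨m, M⟩ ⟨h0, h1, h2⟩
    obtain ⟨m', M', a1, a2, a3, a4, a5⟩ := Cone.contract hs h0 (hb N) (hg.iterate hs N) h1 h2
    refine ⟨(m', M'), ⟨a1, a2, a3⟩, ?_, ?_, ?_⟩
    · have := mul_nonneg (sub_nonneg.mpr hgap.le) (sub_nonneg.mpr h0)
      simp only
      linarith
    · simpa only [Function.iterate_succ_apply'] using a4
    · simpa only [Function.iterate_succ_apply'] using a5
  choose! nxt hR hQ using step
  let p : ℕ → ℝ × ℝ := fun N => Nat.rec (m₀, M₀) (fun N q => nxt N q) N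
  have hp : ∀ N, Q N (p N) := by
    intro N
    induction N with
    | zero => exact ⟨hmM, h1, h2⟩
    | succ N ih => exact hQ N _ ih
  have hRp : ∀ N, _ := fun N => hR N _ (hp N)
  refine ⟨fun N => (p N).1, fun N => (p N).2, rfl, fun N => (hRp N).1, fun N => (hRp N).2.1,
    fun N => ?_, fun N x => ⟨sub_nonneg.mp ((hp N).2.1.1 x), sub_nonneg.mp ((hp N).2.2.1 x)⟩⟩
  induction N with
  | zero => simp [p]
  | succ N ih =>
    rw [pow_succ, ← mul_assoc, ← ih, mul_comm]
    exact (hRp N).2.2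

variable (S)

/-- Iterates of the constant function, normalized at the base point. -/
noncomputable def normIter (s : ℝ) (N : ℕ) (x : X) : ℝ :=
  (S.T s)^[N] (fun _ => 1) x / (S.T s)^[N] (fun _ => 1) S.base

/-- The data of a positive eigenfunction `h` of the transfer operator with eigenvalue `l`,
normalized at the base point. -/
structure IsPerron (s l : ℝ) (h : X → ℝ) : Prop where
  pos : 0 < l
  cone : S.Cone (S.apt s - 1) h
  base : h S.base = 1
  eigen : ∀ x, S.T s h x = l * h x

variable {S}

open Filter Topology in
theorem tendsto_T {ι : Type*} {F : Filter ι} {s : ℝ} (hs : 1 < s) {v : ι → X → ℝ}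
    {h : X → ℝ} {B : ℝ} (hB : ∀ n x, |v n x| ≤ B)
    (hv : ∀ x, Tendsto (fun n => v n x) F (𝓝 (h x))) (x : X) :
    Tendsto (fun n => S.T s (v n) x) F (𝓝 (S.T s h x)) := by
  refine tendsto_tsum_of_dominated_convergence ((S.summable_exp hs x).mul_right B)
    (fun i => (hv _).const_mul _) (Eventually.of_forall fun n i => ?_)
  rw [norm_mul, Real.norm_of_nonneg (Real.exp_pos _).le]
  exact mul_le_mul_of_nonneg_left (hB _ _) (Real.exp_pos _).le

variable (S)

open Filter Topology in
/-- The normalized iterates of the constant function converge to a positive eigenfunction. -/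
theorem exists_isPerron {s : ℝ} (hs : 1 < s) :
    ∃ l h, S.IsPerron s l h ∧ ∀ x, Tendsto (fun N => S.normIter s N x) atTop (𝓝 (h x)) := by
  have hs0 : 0 ≤ s := zero_le_one.trans hs.le
  have ha := S.one_le_apt hs0
  have ha0 : 0 ≤ S.apt s := zero_le_one.trans ha
  set θ := 1 - S.gap s with hθ
  have hθ1 : θ < 1 := by have := S.gap_pos hs0; linarith
  have hgp := S.gap_pos hs0
  set u : ℕ → X → ℝ := fun N => (S.T s)^[N] (fun _ => 1) with hu
  have hone : S.Cone (S.apt s) fun _ => (1 : ℝ) := Cone.const ha0 zero_le_one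
  have hone' : S.Cone (S.apt s - 1) fun _ => (1 : ℝ) :=
    Cone.const (sub_nonneg.mpr ha) zero_le_one
  have hT1 := hone.T_apt hs
  have huC : ∀ N, S.Cone (S.apt s) (u N) := fun N => hone.iterate hs N
  have hupos : ∀ N x, 0 < u N x := by
    intro N
    induction N with
    | zero => intro x; exact one_pos
    | succ N ih =>
      intro x
      simp only [hu, Function.iterate_succ_apply'] at ih ⊢
      exact S.T_pos hs ((huC N).bdd ha0) ih x
  have hu1 : u 1 = S.T s fun _ => 1 := rfl
  have hb1 := hupos 1 S.base
  -- the initial order interval comes from comparing `T 1` with `1` at the base point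
  set r := 2 * u 1 S.base with hr
  have hr0 : 0 < r := by positivity
  have i1 : S.Cone (S.apt s) fun x => u 1 x - S.gap s * r * 1 :=
    hT1.sub_gap_mul hs0 hr0.le hone' (by rw [hr, ← hu1]; linarith)
  have i2 : S.Cone (S.apt s) fun x => 1 - S.gap s * (4 / r) * u 1 x := by
    refine hone'.sub_gap_mul hs0 (by positivity) hT1 ?_
    rw [hr]
    apply le_of_eq
    field_simp
    norm_num
  have i2' := i2.const_mul (c := r / (4 * S.gap s)) (by positivity)
  have e2 : (fun x => r / (4 * S.gap s) * (1 - S.gap s * (4 / r) * u 1 x))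
      = fun x => r / (4 * S.gap s) * 1 - u 1 x := by
    funext x; field_simp
  rw [e2] at i2'
  have hm0 : 0 < S.gap s * r := by positivity
  obtain ⟨m, M, hm_zero, hm, hM, hMm, hbd⟩ := Cone.contract_iterate (S := S) (s := s)
    (m₀ := S.gap s * r) (M₀ := r / (4 * S.gap s)) (f := u 1) (g := fun _ => 1) hs (by
      have h1 := i1.1 S.base
      have h2 := i2'.1 S.base
      linarith) (hT1.bdd (sub_nonneg.mpr ha)) hone i1 i2'
  have hbd' : ∀ N x, m N * u N x ≤ u (N + 1) x ∧ u (N + 1) x ≤ M N * u N x := by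
    intro N x
    have h := hbd N x
    rw [hu1, ← Function.iterate_succ_apply] at h
    exact h
  set C := r / (4 * S.gap s) - S.gap s * r with hC
  have hmono : ∀ N, S.gap s * r ≤ m N := fun N => by
    rw [← hm_zero]; exact monotone_nat_of_le_succ hm (Nat.zero_le N)
  -- the ratios `q N` lie in the nested intervals `[m N, M N]`, whose lengths decay geometrically
  set q : ℕ → ℝ := fun N => u (N + 1) S.base / u N S.base with hq
  have hqm : ∀ N, m N ≤ q N := fun N => by
    rw [hq, le_div_iff₀ (hupos N _)]; exact (hbd' N _).1
  have hqM : ∀ N, q N ≤ M N := fun N => by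
    rw [hq, div_le_iff₀ (hupos N _)]; exact (hbd' N _).2
  have hqC : CauchySeq q := by
    refine cauchySeq_of_le_geometric θ C hθ1 fun N => ?_
    rw [Real.dist_eq, abs_le, ← hMm N]
    constructor <;> linarith [hqm N, hqM N, hqm (N + 1), hqM (N + 1), hm N, hM N]
  obtain ⟨l, hl⟩ := cauchySeq_tendsto_of_complete hqC
  have hl0 : 0 < l := hm0.trans_le
    (ge_of_tendsto hl (Eventually.of_forall fun N => (hmono N).trans (hqm N)))
  set v := fun N x => S.normIter s N x with hv
  have hve : ∀ N x, v N x = u N x / u N S.base := fun N x => rfl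
  set K := Real.exp (S.apt s * S.diam) with hK
  have hvK : ∀ N x, v N x ≤ K := fun N x => by
    rw [hve, div_le_iff₀ (hupos N _)]; exact (huC N).le_diam ha0 _ _
  have hv0 : ∀ N x, 0 ≤ v N x := fun N x => div_nonneg (hupos N _).le (hupos N _).le
  have hvC : ∀ x, CauchySeq fun N => v N x := by
    intro x
    refine cauchySeq_of_le_geometric θ (C * K / (S.gap s * r)) hθ1 fun N => ?_
    have e : v N x - v (N + 1) x = (q N * u N x - u (N + 1) x) / u (N + 1) S.base := by
      rw [hve, hve, hq]
      have := (hupos N S.base).ne'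
      have := (hupos (N + 1) S.base).ne'
      field_simp
    have hN := hbd' N x
    have hux := hupos N x
    have k1 : |q N * u N x - u (N + 1) x| ≤ (M N - m N) * u N x := by
      have a1 := mul_le_mul_of_nonneg_right (hqm N) hux.le
      have a2 := mul_le_mul_of_nonneg_right (hqM N) hux.le
      rw [abs_le]
      constructor <;> linarith
    have k2 : S.gap s * r * u N S.base ≤ u (N + 1) S.base :=
      (mul_le_mul_of_nonneg_right (hmono N) (hupos N _).le).trans (hbd' N _).1
    have hMm0 : 0 ≤ M N - m N := sub_nonneg.mpr ((hqm N).trans (hqM N))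
    rw [Real.dist_eq, e, abs_div, abs_of_pos (hupos (N + 1) S.base)]
    calc |q N * u N x - u (N + 1) x| / u (N + 1) S.base
        ≤ (M N - m N) * u N x / (S.gap s * r * u N S.base) := by
          have := hupos N S.base
          gcongr
      _ = (M N - m N) * v N x / (S.gap s * r) := by
          rw [hve]
          have := (hupos N S.base).ne'
          field_simp
      _ ≤ (M N - m N) * K / (S.gap s * r) := by
          have := hvK N x
          gcongr
      _ = C * K / (S.gap s * r) * θ ^ N := by rw [hMm N]; ring
  choose h hh using fun x => cauchySeq_tendsto_of_complete (hvC x)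
  have hbase : h S.base = 1 := by
    refine tendsto_nhds_unique (hh S.base) ?_
    have : (fun N => v N S.base) = fun _ => 1 := by
      funext N; rw [hve, div_self (hupos N _).ne']
    rw [this]
    exact tendsto_const_nhds
  have hcone : S.Cone (S.apt s) h := by
    refine ⟨fun x => ge_of_tendsto' (hh x) fun N => hv0 N x, fun x y => ?_⟩
    refine le_of_tendsto_of_tendsto' (hh x) ((hh y).const_mul _) fun N => ?_
    rw [hve, hve, ← mul_div_assoc]
    exact div_le_div_of_nonneg_right ((huC N).2 x y) (hupos N _).le
  have heig : ∀ x, S.T s h x = l * h x := by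
    intro x
    refine tendsto_nhds_unique (tendsto_T hs (B := K) (fun N y => ?_) hh x) ?_
    · rw [abs_of_nonneg (hv0 N y)]; exact hvK N y
    · have : (fun N => S.T s (v N) x) = fun N => q N * v (N + 1) x := by
        funext N
        have e1 : v N = fun y => (u N S.base)⁻¹ * u N y := by
          funext y; rw [hve, div_eq_inv_mul]
        have e2 : S.T s (u N) x = u (N + 1) x := by
          simp only [hu, Function.iterate_succ_apply']
        rw [e1, S.T_const_mul, e2, hve, hq]
        have := (hupos N S.base).ne'
        have := (hupos (N + 1) S.base).ne'
        field_simp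
      rw [this]
      exact hl.mul ((tendsto_add_atTop_iff_nat 1).mpr (hh x))
  -- `h = l⁻¹ * T h` lies in the smaller cone, as an image under `T`
  refine ⟨l, h, ⟨hl0, ?_, hbase, heig⟩, hh⟩
  have := (hcone.T_apt hs).const_mul (inv_nonneg.mpr hl0.le)
  convert this using 2 with x
  rw [heig x, inv_mul_cancel_left₀ hl0.ne']

variable {S}

theorem IsPerron.exp_le_apply {s l : ℝ} (hs : 1 < s) {h : X → ℝ} (hh : S.IsPerron s l h) (x : X) :
    Real.exp (-((S.apt s - 1) * S.diam)) ≤ h x := by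
  have ha := S.one_le_apt (zero_le_one.trans hs.le)
  have := hh.cone.le_diam (sub_nonneg.mpr ha) S.base x
  rw [hh.base] at this
  rw [Real.exp_neg, inv_le_iff_one_le_mul₀' (Real.exp_pos _)]
  exact this

/-- Comparison of eigenvalues. Applied twice, it shows that all positive eigenfunctions, bounded
and bounded away from `0`, belong to the same eigenvalue. -/
theorem eigenvalue_le {s l₁ l₂ c B : ℝ} (hs : 1 < s) {f g : X → ℝ} (hl₂ : 0 < l₂) (hc : 0 < c)
    (hf : ∀ x, 0 < f x) (hfB : ∀ x, f x ≤ B) (hg : ∀ x, c ≤ g x) (hgb : Bdd g)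
    (ef : ∀ x, l₁ * f x ≤ S.T s f x) (eg : ∀ x, S.T s g x ≤ l₂ * g x) : l₁ ≤ l₂ := by
  by_contra! hlt
  have hl₁ : 0 < l₁ := hl₂.trans hlt
  have hB : 0 < B := (hf S.base).trans_le (hfB S.base)
  have hfb : Bdd f := ⟨B, fun x => by rw [Real.norm_of_nonneg (hf x).le]; exact hfB x⟩
  -- the `N`-fold application of the operator to `f ≤ (B / c) * g`
  have key : ∀ N : ℕ, ∀ x, (l₁ / l₂) ^ N * f x ≤ B / c * g x := by
    intro N
    induction N with
    | zero =>
      intro x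
      rw [pow_zero, one_mul]
      calc f x ≤ B := hfB x
        _ = B / c * c := by field_simp
        _ ≤ B / c * g x := mul_le_mul_of_nonneg_left (hg x) (by positivity)
    | succ N ih =>
      intro x
      have h1 := S.T_mono hs (hfb.const_mul _) (hgb.const_mul _) ih x
      rw [S.T_const_mul, S.T_const_mul] at h1
      replace h1 := h1.trans (mul_le_mul_of_nonneg_left (eg x) (div_pos hB hc).le)
      have h2 := mul_le_mul_of_nonneg_left (ef x) (pow_nonneg (div_pos hl₁ hl₂).le N)
      have h3 := h2.trans h1
      rw [← mul_le_mul_iff_right₀ hl₂]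
      calc l₂ * ((l₁ / l₂) ^ (N + 1) * f x) = (l₁ / l₂) ^ N * (l₁ * f x) := by
            rw [pow_succ]; field_simp
        _ ≤ _ := h3
        _ = _ := by ring
  have htend := tendsto_pow_atTop_atTop_of_one_lt ((one_lt_div hl₂).mpr hlt)
  obtain ⟨N, hN⟩ := (htend.eventually_gt_atTop (B / c * g S.base / f S.base)).exists
  have h1 := key N S.base
  rw [div_lt_iff₀ (hf _)] at hN
  linarith

end ContractingSystem

/-! ### The complex operator and the leading eigenvalue -/

namespace ContractingSystem

variable {X I : Type} (S : ContractingSystem X I)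

/-- The transfer operator with complex parameter, on complex functions. -/
noncomputable def Tc (s : ℂ) (f : X → ℂ) (x : X) : ℂ :=
  ∑' i, Complex.exp (-s * S.len i x) * f (S.map i x)

theorem norm_cexp (s : ℂ) (i : I) (x : X) :
    ‖Complex.exp (-s * S.len i x)‖ = Real.exp (-s.re * S.len i x) := by
  rw [Complex.norm_exp]
  simp

theorem exp_le_exp_of_le {s t : ℝ} (h : s ≤ t) (i : I) (x : X) :
    Real.exp (-t * S.len i x) ≤ Real.exp (-s * S.len i x) :=
  Real.exp_le_exp.mpr (mul_le_mul_of_nonneg_right (neg_le_neg h) (S.len_nonneg i x))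

theorem summable_Tc {s : ℂ} (hs : 1 < s.re) {f : X → ℂ} (hf : Bdd f) (x : X) :
    Summable fun i => Complex.exp (-s * S.len i x) * f (S.map i x) := by
  obtain ⟨B, hB⟩ := hf
  refine Summable.of_norm_bounded ((S.summable_exp hs x).mul_right B) fun i => ?_
  rw [norm_mul, S.norm_cexp]
  exact mul_le_mul_of_nonneg_left (hB _) (Real.exp_pos _).le

theorem Tc_ofReal (s : ℝ) (f : X → ℝ) (x : X) :
    S.Tc s (fun x => (f x : ℂ)) x = (S.T s f x : ℂ) := by
  unfold Tc T
  rw [Complex.ofReal_tsum]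
  refine tsum_congr fun i => ?_
  push_cast
  rfl

/-- Real-linear functionals of the form `z ↦ re (u z)` commute with a transfer operator of real
parameter. -/
theorem re_mul_Tc {s : ℝ} (hs : 1 < s) {f : X → ℂ} (hf : Bdd f) (u : ℂ) (x : X) :
    (u * S.Tc s f x).re = S.T s (fun x => (u * f x).re) x := by
  unfold Tc T
  rw [← tsum_mul_left, Complex.re_tsum ((S.summable_Tc (by simpa using hs) hf x).mul_left u)]
  refine tsum_congr fun i => ?_
  have : Complex.exp (-(s : ℂ) * S.len i x) = ((Real.exp (-s * S.len i x) : ℝ) : ℂ) := by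
    push_cast; rfl
  rw [this, mul_left_comm, Complex.re_ofReal_mul]

theorem Bdd.re_mul {f : X → ℂ} (hf : Bdd f) (u : ℂ) : Bdd fun x => (u * f x).re := by
  obtain ⟨B, hB⟩ := hf
  refine ⟨‖u‖ * B, fun x => (Complex.abs_re_le_norm _).trans ?_⟩
  rw [norm_mul]
  exact mul_le_mul_of_nonneg_left (hB x) (norm_nonneg _)

theorem exists_unit_mul_eq_norm (z : ℂ) : ∃ u : ℂ, ‖u‖ = 1 ∧ u * z = ‖z‖ := by
  by_cases hz : z = 0
  · exact ⟨1, by simp, by simp [hz]⟩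
  · have hz' : (‖z‖ : ℂ) ≠ 0 := by simpa using hz
    refine ⟨(starRingEnd ℂ) z / ‖z‖, ?_, ?_⟩
    · rw [norm_div, RCLike.norm_conj, Complex.norm_real, norm_norm,
        div_self (norm_ne_zero_iff.mpr hz)]
    · rw [div_mul_eq_mul_div, mul_comm, Complex.mul_conj, Complex.normSq_eq_norm_sq]
      push_cast
      field_simp

theorem eq_ofReal_of_norm_le {z : ℂ} {r : ℝ} (h1 : ‖z‖ ≤ r) (h2 : z.re = r) : z = r := by
  have h3 : ‖z‖ ^ 2 ≤ r ^ 2 := by gcongr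
  rw [Complex.sq_norm, Complex.normSq_apply, h2] at h3
  have h4 : z.im = 0 := by nlinarith [sq_nonneg z.im]
  exact Complex.ext (by simpa using h2) (by simpa using h4)

variable {S}

/-- The triangle inequality for an eigenfunction `f` dominated by `M * h`. -/
theorem norm_mul_le_of_eigen {s l M : ℝ} {μ : ℂ} (hs : 1 < s) {h : X → ℝ} (hh : S.IsPerron s l h)
    (hhb : Bdd h) {f : X → ℂ} (hf : Bdd f) (hM : ∀ x, ‖f x‖ ≤ M * h x)
    (ef : ∀ x, S.Tc s f x = μ * f x) (x : X) : ‖μ‖ * ‖f x‖ ≤ l * (M * h x) := by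
  obtain ⟨u, hu, hux⟩ := exists_unit_mul_eq_norm (μ * f x)
  rw [← norm_mul]
  have h1 : ‖μ * f x‖ = S.T s (fun x => (u * f x).re) x := by
    rw [← S.re_mul_Tc hs hf u x, ef, hux, Complex.ofReal_re]
  rw [h1, mul_left_comm, ← hh.eigen, ← S.T_const_mul]
  refine S.T_mono hs (hf.re_mul u) (hhb.const_mul M) (fun y => ?_) x
  refine (Complex.re_le_norm _).trans ?_
  rw [norm_mul, hu, one_mul]
  exact hM y

/-- At a point where `‖f‖ / h` is maximal, an eigenfunction `f` whose eigenvalue has maximal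
modulus has no room for cancellation: along every branch `f / h` is multiplied by `μ / l`. -/
theorem apply_map_of_extremal {s l M : ℝ} {μ : ℂ} (hs : 1 < s) {h : X → ℝ}
    (hh : S.IsPerron s l h) (hhb : Bdd h) {f : X → ℂ} (hf : Bdd f)
    (hM : ∀ x, ‖f x‖ ≤ M * h x) (ef : ∀ x, S.Tc s f x = μ * f x) (hμ : ‖μ‖ = l) {x : X}
    (hx : ‖f x‖ = M * h x) (i : I) : f (S.map i x) * (l * h x) = μ * f x * h (S.map i x) := by
  obtain ⟨u, hu, hux⟩ := exists_unit_mul_eq_norm (μ * f x)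
  have hnorm : ‖μ * f x‖ = l * (M * h x) := by rw [norm_mul, hμ, hx]
  have hle : ∀ y, (u * f y).re ≤ M * h y := fun y => by
    refine (Complex.re_le_norm _).trans ?_
    rw [norm_mul, hu, one_mul]
    exact hM y
  have hb1 := hhb.const_mul M
  have hb2 := hf.re_mul u
  -- `T s` vanishes at `x` on this nonnegative function, hence so does the term of every branch
  have hsum : S.T s (fun y => M * h y - (u * f y).re) x = 0 := by
    rw [S.T_sub hs hb1 hb2, S.T_const_mul, hh.eigen, ← S.re_mul_Tc hs hf u x, ef, hux,
      Complex.ofReal_re, hnorm]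
    ring
  have hsm := S.summable_T hs (hb1.sub hb2) x
  have hsm0 : HasSum (fun j => Real.exp (-s * S.len j x) *
      (M * h (S.map j x) - (u * f (S.map j x)).re)) 0 := by
    rw [← hsum]; exact hsm.hasSum
  have hz := (hasSum_zero_iff_of_nonneg fun j => mul_nonneg (Real.exp_pos _).le
    (sub_nonneg.mpr (hle _))).mp hsm0
  have hzi := (mul_eq_zero.mp (congr_fun hz i)).resolve_left (Real.exp_pos _).ne'
  have h3 : u * f (S.map i x) = ((M * h (S.map i x) : ℝ) : ℂ) := by
    refine eq_ofReal_of_norm_le ?_ (by linarith)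
    rw [norm_mul, hu, one_mul]
    exact hM _
  have hu0 : u ≠ 0 := norm_ne_zero_iff.mp (by rw [hu]; exact one_ne_zero)
  apply mul_left_cancel₀ hu0
  calc u * (f (S.map i x) * (l * h x)) = u * f (S.map i x) * (l * h x) := by ring
    _ = u * (μ * f x) * h (S.map i x) := by rw [h3, hux, hnorm]; push_cast; ring
    _ = _ := by ring

theorem IsPerron.bdd {s l : ℝ} (hs : 1 < s) {h : X → ℝ} (hh : S.IsPerron s l h) : Bdd h :=
  hh.cone.bdd (sub_nonneg.mpr (S.one_le_apt (zero_le_one.trans hs.le)))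

theorem IsPerron.apply_pos {s l : ℝ} (hs : 1 < s) {h : X → ℝ} (hh : S.IsPerron s l h) (x : X) :
    0 < h x :=
  (Real.exp_pos _).trans_le (hh.exp_le_apply hs x)

open Filter Topology

theorem Cone.continuous [TopologicalSpace X]
    (hlim : ∀ x, Tendsto (S.d x) (𝓝 x) (𝓝 0)) {a : ℝ} {f : X → ℝ} (hf : S.Cone a f) :
    Continuous f := by
  rw [continuous_iff_continuousAt]
  intro x
  have h1 : Tendsto (fun y => Real.exp (a * S.d x y)) (𝓝 x) (𝓝 1) := by
    have := ((hlim x).const_mul a).rexp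
    simpa using this
  have h2 : Tendsto (fun y => Real.exp (a * S.d x y) * f x) (𝓝 x) (𝓝 (f x)) := by
    simpa using h1.mul_const (f x)
  have h3 : Tendsto (fun y => (Real.exp (a * S.d x y))⁻¹ * f x) (𝓝 x) (𝓝 (f x)) := by
    simpa using (h1.inv₀ one_ne_zero).mul_const (f x)
  refine tendsto_of_tendsto_of_tendsto_of_le_of_le h3 h2 (fun y => ?_) fun y => ?_
  · simp only
    rw [inv_mul_le_iff₀ (Real.exp_pos _)]
    exact hf.2 x y
  · have := hf.2 y x
    rwa [S.d_comm y x] at this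

theorem Bdd.of_continuous [TopologicalSpace X] [CompactSpace X] {E : Type}
    [SeminormedAddCommGroup E] {f : X → E} (hf : Continuous f) : Bdd f := by
  obtain ⟨C, hC⟩ := isCompact_univ.exists_bound_of_continuousOn hf.continuousOn
  exact ⟨C, fun x => hC x (Set.mem_univ x)⟩

theorem exists_extremal [TopologicalSpace X] [CompactSpace X] {h : X → ℝ} (hc : Continuous h)
    (h0 : ∀ x, 0 < h x) {f : X → ℂ} (hf : Continuous f) (hne : f ≠ 0) :
    ∃ M x₁, 0 < M ∧ ‖f x₁‖ = M * h x₁ ∧ ∀ x, ‖f x‖ ≤ M * h x := by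
  obtain ⟨y, hy⟩ := Function.ne_iff.mp hne
  obtain ⟨x₁, -, hx₁⟩ := isCompact_univ.exists_isMaxOn ⟨y, Set.mem_univ y⟩
    (f := fun x => ‖f x‖ / h x) (hf.norm.div hc fun x => (h0 x).ne').continuousOn
  have hmax : ∀ x, ‖f x‖ / h x ≤ ‖f x₁‖ / h x₁ := fun x => hx₁ (Set.mem_univ x)
  refine ⟨‖f x₁‖ / h x₁, x₁, ?_, by rw [div_mul_cancel₀ _ (h0 _).ne'], fun x => ?_⟩
  · exact (div_pos (norm_pos_iff.mpr hy) (h0 y)).trans_le (hmax y)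
  · rw [← div_le_iff₀ (h0 x)]; exact hmax x

/-- A continuous eigenfunction has an eigenvalue of smaller modulus, or the eigenvalue `l`
itself. -/
theorem IsPerron.norm_lt [MetricSpace X] [CompactSpace X] (hdist : ∀ x y, dist x y ≤ S.d x y)
    (hlim : ∀ x, Tendsto (S.d x) (𝓝 x) (𝓝 0)) {s l : ℝ} {μ : ℂ} (hs : 1 < s) {h : X → ℝ}
    (hh : S.IsPerron s l h) {f : X → ℂ} (hf : Continuous f) (hne : f ≠ 0)
    (ef : ∀ x, S.Tc s f x = μ * f x) (hμ : μ ≠ l) : ‖μ‖ < l := by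
  have hc := hh.cone.continuous hlim
  have h0 := hh.apply_pos hs
  have hb := Bdd.of_continuous hf
  obtain ⟨M, x₁, hM0, hx₁, hM⟩ := exists_extremal hc h0 hf hne
  have hle : ‖μ‖ ≤ l := by
    have := norm_mul_le_of_eigen hs hh (hh.bdd hs) hb hM ef x₁
    rw [hx₁] at this
    exact le_of_mul_le_mul_right this (mul_pos hM0 (h0 _))
  refine lt_of_le_of_ne hle fun heq => hμ ?_
  by_contra hμ
  have hl : (l : ℂ) ≠ 0 := by exact_mod_cast hh.pos.ne'
  have hhC : ∀ x, (h x : ℂ) ≠ 0 := fun x => by exact_mod_cast (h0 x).ne'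
  -- follow one branch: `f / h` rotates by the fixed factor `μ / l`, but its increments tend to `0`
  set y : ℕ → X := fun N => (S.map S.index)^[N] x₁ with hy
  have hy1 : ∀ N, y (N + 1) = S.map S.index (y N) := fun N => Function.iterate_succ_apply' _ _ _
  have hext : ∀ N, ‖f (y N)‖ = M * h (y N) := by
    intro N
    induction N with
    | zero => exact hx₁
    | succ N ih =>
      have h1 := apply_map_of_extremal hs hh (hh.bdd hs) hb hM ef heq ih S.index
      have h2 := congr_arg norm h1
      rw [norm_mul, norm_mul, norm_mul, norm_mul, Complex.norm_real, Complex.norm_real,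
        Complex.norm_real, Real.norm_of_nonneg hh.pos.le, Real.norm_of_nonneg (h0 _).le,
        Real.norm_of_nonneg (h0 _).le, heq, ih] at h2
      rw [hy1]
      have h3 : l * h (y N) ≠ 0 := mul_ne_zero hh.pos.ne' (h0 _).ne'
      apply mul_right_cancel₀ h3
      linarith
  have hrot : ∀ N, f (y (N + 1)) / h (y (N + 1)) - f (y N) / h (y N)
      = (μ / l - 1) * (f (y N) / h (y N)) := by
    intro N
    have h1 := apply_map_of_extremal hs hh (hh.bdd hs) hb hM ef heq (hext N) S.index
    rw [← hy1] at h1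
    have h2 := hhC (y N)
    have h3 := hhC (y (N + 1))
    field_simp
    linear_combination h1
  have hd : ∀ N, S.d (y (N + 1)) (y N) ≤ S.diam * S.ratio ^ N := by
    intro N
    induction N with
    | zero => simpa using S.d_le _ _
    | succ N ih =>
      rw [hy1 (N + 1), hy1 N]
      refine (S.d_map_le _ _ _).trans ?_
      rw [← hy1]
      calc S.ratio * S.d (y (N + 1)) (y N) ≤ S.ratio * (S.diam * S.ratio ^ N) :=
            mul_le_mul_of_nonneg_left ih S.ratio_nonneg
        _ = _ := by ring
  have hcont : Continuous fun x => f x / (h x : ℂ) :=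
    hf.div (Complex.continuous_ofReal.comp hc) hhC
  have huc := CompactSpace.uniformContinuous_of_continuous hcont
  have hε : 0 < ‖μ / l - 1‖ * M := by
    refine mul_pos (norm_pos_iff.mpr fun h => hμ ?_) hM0
    rw [sub_eq_zero, div_eq_one_iff_eq hl] at h
    exact h
  obtain ⟨δ, hδ, huc⟩ := Metric.uniformContinuous_iff.mp huc _ hε
  have htend : Tendsto (fun N => S.diam * S.ratio ^ N) atTop (𝓝 0) := by
    simpa using (tendsto_pow_atTop_nhds_zero_of_lt_one S.ratio_nonneg S.ratio_lt_one).const_mul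
      S.diam
  obtain ⟨N, hN⟩ := (htend.eventually_lt_const hδ).exists
  have := huc (((hdist _ _).trans (hd N)).trans_lt hN)
  rw [dist_eq_norm, hrot, norm_mul, norm_div, hext, Complex.norm_real,
    Real.norm_of_nonneg (h0 _).le, mul_div_cancel_right₀ _ (h0 _).ne'] at this
  exact lt_irrefl _ this

end ContractingSystem

/-! ### Eigenmeasures of the dual operator -/

namespace ContractingSystem

variable {X I : Type} (S : ContractingSystem X I)

open Filter Topology

/-- Riesz representation on a compact space, in terms of continuous functions. -/
theorem exists_measure_of_nonneg [MetricSpace X] [CompactSpace X] [MeasurableSpace X]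
    [BorelSpace X] (L : C(X, ℝ) →ₗ[ℝ] ℝ) (hL : ∀ f : C(X, ℝ), (∀ x, 0 ≤ f x) → 0 ≤ L f) :
    ∃ ν : Measure X, IsFiniteMeasure ν ∧ ∀ f : C(X, ℝ), ∫ x, f x ∂ν = L f := by
  let L' : CompactlySupportedContinuousMap X ℝ →ₗ[ℝ] ℝ :=
    { toFun := fun f => L f.toContinuousMap
      map_add' := fun f g => L.map_add f.toContinuousMap g.toContinuousMap
      map_smul' := fun c f => L.map_smul c f.toContinuousMap }
  let Λ := PositiveLinearMap.mk₀ L' fun f hf => hL _ fun x => CompactlySupportedContinuousMap.le_def.mp hf x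
  refine ⟨RealRMK.rieszMeasure Λ, inferInstance, fun f => ?_⟩
  exact RealRMK.integral_rieszMeasure Λ (CompactlySupportedContinuousMap.continuousMapEquiv f)

theorem continuous_len [TopologicalSpace X] (hlim : ∀ x, Tendsto (S.d x) (𝓝 x) (𝓝 0)) (i : I) :
    Continuous (S.len i) := by
  rw [continuous_iff_continuousAt]
  intro x
  rw [ContinuousAt, tendsto_iff_norm_sub_tendsto_zero]
  have h : Tendsto (fun y => S.distortion * S.d x y) (𝓝 x) (𝓝 0) := by
    simpa using (hlim x).const_mul S.distortion
  refine squeeze_zero (fun _ => norm_nonneg _) (fun y => ?_) h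
  rw [Real.norm_eq_abs, abs_le]
  have h1 := S.len_sub_le i x y
  have h2 := S.len_sub_le i y x
  rw [S.d_comm y x] at h2
  constructor <;> linarith

theorem continuous_map [MetricSpace X] (hdist : ∀ x y, dist x y ≤ S.d x y)
    (hlim : ∀ x, Tendsto (S.d x) (𝓝 x) (𝓝 0)) (i : I) : Continuous (S.map i) := by
  rw [continuous_iff_continuousAt]
  intro x
  rw [ContinuousAt, tendsto_iff_dist_tendsto_zero]
  have h : Tendsto (fun y => S.ratio * S.d x y) (𝓝 x) (𝓝 0) := by
    simpa using (hlim x).const_mul S.ratio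
  refine squeeze_zero (fun _ => dist_nonneg) (fun y => ?_) h
  rw [dist_comm]
  exact (hdist _ _).trans (S.d_map_le i x y)

theorem continuous_T [MetricSpace X] [CompactSpace X] (hdist : ∀ x y, dist x y ≤ S.d x y)
    (hlim : ∀ x, Tendsto (S.d x) (𝓝 x) (𝓝 0)) {s : ℝ} (hs : 1 < s) {f : X → ℝ}
    (hf : Continuous f) : Continuous (S.T s f) := by
  obtain ⟨B, hB⟩ := Bdd.of_continuous hf
  have hs0 : 0 ≤ s := zero_le_one.trans hs.le
  refine continuous_tsum (u := fun i => Real.exp (s * S.distortion * S.diam) *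
    Real.exp (-s * S.len i S.base) * B) (fun i => ?_) ?_ fun i x => ?_
  · exact (Real.continuous_exp.comp ((S.continuous_len hlim i).const_mul _)).mul
      (hf.comp (S.continuous_map hdist hlim i))
  · exact ((S.summable_exp hs _).mul_left _).mul_right _
  · rw [norm_mul, Real.norm_of_nonneg (Real.exp_pos _).le]
    refine mul_le_mul ((S.exp_len_le hs0 i x S.base).trans ?_) (hB _) (norm_nonneg _)
      (by positivity)
    refine mul_le_mul_of_nonneg_right (Real.exp_le_exp.mpr ?_) (Real.exp_pos _).le
    exact mul_le_mul_of_nonneg_left (S.d_le _ _) (mul_nonneg hs0 S.distortion_nonneg)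

variable {S}

theorem Bdd.iterate {s : ℝ} (hs : 1 < s) {f : X → ℝ} (hf : Bdd f) (N : ℕ) :
    Bdd ((S.T s)^[N] f) := by
  induction N with
  | zero => exact hf
  | succ N ih => rw [Function.iterate_succ_apply']; exact ih.T hs

theorem iterate_add {s : ℝ} (hs : 1 < s) {f g : X → ℝ} (hf : Bdd f) (hg : Bdd g) (N : ℕ) (x : X) :
    (S.T s)^[N] (fun x => f x + g x) x = (S.T s)^[N] f x + (S.T s)^[N] g x := by
  induction N generalizing x with
  | zero => rfl
  | succ N ih =>
    simp only [Function.iterate_succ_apply']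
    rw [← S.T_add hs (hf.iterate hs N) (hg.iterate hs N)]
    congr 1
    funext y
    exact ih y

theorem iterate_const_mul (s c : ℝ) (f : X → ℝ) (N : ℕ) (x : X) :
    (S.T s)^[N] (fun x => c * f x) x = c * (S.T s)^[N] f x := by
  induction N generalizing x with
  | zero => rfl
  | succ N ih =>
    simp only [Function.iterate_succ_apply']
    rw [← S.T_const_mul]
    congr 1
    funext y
    exact ih y

theorem iterate_nonneg (s : ℝ) {f : X → ℝ} (hf : ∀ x, 0 ≤ f x) (N : ℕ) (x : X) :
    0 ≤ (S.T s)^[N] f x := by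
  induction N generalizing x with
  | zero => exact hf x
  | succ N ih =>
    rw [Function.iterate_succ_apply']
    exact S.T_nonneg s ih x

theorem IsPerron.abs_iterate_le {s l A : ℝ} (hs : 1 < s) {h : X → ℝ} (hh : S.IsPerron s l h)
    {f : X → ℝ} (hf : ∀ x, |f x| ≤ A * h x) (N : ℕ) (x : X) :
    |(S.T s)^[N] f x| ≤ l ^ N * (A * h x) := by
  have hhb := hh.bdd hs
  have hfb : Bdd f := by
    obtain ⟨B, hB⟩ := hhb.const_mul A
    exact ⟨B, fun x => (hf x).trans ((le_abs_self _).trans (hB x))⟩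
  induction N generalizing x with
  | zero => simpa using hf x
  | succ N ih =>
    have hb := hfb.iterate (S := S) hs N
    have e : S.T s (fun y => l ^ N * A * h y) x = l ^ (N + 1) * (A * h x) := by
      rw [S.T_const_mul, hh.eigen]; ring
    have ih' : ∀ y, |(S.T s)^[N] f y| ≤ l ^ N * A * h y := fun y => by
      rw [mul_assoc]; exact ih y
    rw [Function.iterate_succ_apply', abs_le, ← e]
    constructor
    · have := S.T_mono hs (hhb.const_mul (-(l ^ N * A))) hb
        (fun y => by have := neg_le_of_abs_le (ih' y); linarith) x
      rw [S.T_const_mul] at this ⊢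
      linarith
    · exact S.T_mono hs hb (hhb.const_mul _) (fun y => le_of_abs_le (ih' y)) x

/-- Averages of the orbit of `f` under the normalized transfer operator, at the base point. -/
noncomputable def average (S : ContractingSystem X I) (s l : ℝ) (f : X → ℝ) (N : ℕ) : ℝ :=
  (∑ k ∈ Finset.range (N + 1), (l ^ k)⁻¹ * (S.T s)^[k] f S.base) / (N + 1)

theorem IsPerron.abs_average_le {s l A : ℝ} (hs : 1 < s) {h : X → ℝ} (hh : S.IsPerron s l h)
    {f : X → ℝ} (hf : ∀ x, |f x| ≤ A * h x) (N : ℕ) : |S.average s l f N| ≤ A := by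
  have hN : (0 : ℝ) < N + 1 := by positivity
  rw [average, abs_div, abs_of_pos hN, div_le_iff₀ hN]
  refine (Finset.abs_sum_le_sum_abs _ _).trans ?_
  refine (Finset.sum_le_card_nsmul _ _ A fun k _ => ?_).trans (by simp [mul_comm])
  have hk := pow_pos hh.pos k
  rw [abs_mul, abs_of_pos (inv_pos.mpr hk), inv_mul_le_iff₀ hk]
  simpa [hh.base] using hh.abs_iterate_le hs hf k S.base

/-- The averages are almost eigenvectors of the dual operator: the sum telescopes. -/
theorem average_T_sub {s l : ℝ} (hl : 0 < l) (f : X → ℝ) (N : ℕ) :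
    S.average s l (S.T s f) N - l * S.average s l f N
      = l * ((l ^ (N + 1))⁻¹ * (S.T s)^[N + 1] f S.base - f S.base) / (N + 1) := by
  have h1 := Finset.sum_range_succ' (fun k => (l ^ k)⁻¹ * (S.T s)^[k] f S.base) (N + 1)
  have h2 := Finset.sum_range_succ (fun k => (l ^ k)⁻¹ * (S.T s)^[k] f S.base) (N + 1)
  have h3 : ∑ k ∈ Finset.range (N + 1), (l ^ k)⁻¹ * (S.T s)^[k] (S.T s f) S.base
      = l * ∑ k ∈ Finset.range (N + 1), (l ^ (k + 1))⁻¹ * (S.T s)^[k + 1] f S.base := by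
    rw [Finset.mul_sum]
    refine Finset.sum_congr rfl fun k _ => ?_
    rw [Function.iterate_succ_apply, pow_succ]
    field_simp
  unfold average
  rw [h3, ← mul_div_assoc, ← sub_div, ← mul_sub]
  congr 2
  simp only [pow_zero, inv_one, one_mul, Function.iterate_zero, id] at h1
  linarith

/-- The eigenvalue of the positive eigenfunction is the eigenvalue of an eigenmeasure of the dual
operator, namely of a limit of the functionals `average` along an ultrafilter. -/
theorem exists_eigenmeasure [MetricSpace X] [CompactSpace X] [MeasurableSpace X]
    [BorelSpace X] (hdist : ∀ x y, dist x y ≤ S.d x y)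
    (hlim : ∀ x, Tendsto (S.d x) (𝓝 x) (𝓝 0)) {s l : ℝ} (hs : 1 < s) {h : X → ℝ}
    (hh : S.IsPerron s l h) :
    ∃ ν : Measure X, IsProbabilityMeasure ν ∧
      ∀ f : C(X, ℝ), ∫ x, S.T s f x ∂ν = l * ∫ x, f x ∂ν := by
  set c := Real.exp (-((S.apt s - 1) * S.diam)) with hc
  have hc0 : 0 < c := Real.exp_pos _
  have hch : ∀ x, c ≤ h x := hh.exp_le_apply hs
  have hdom : ∀ (f : C(X, ℝ)) x, |f x| ≤ ‖f‖ / c * h x := fun f x =>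
    calc |f x| ≤ ‖f‖ := f.norm_coe_le_norm x
      _ = ‖f‖ / c * c := by field_simp
      _ ≤ ‖f‖ / c * h x := mul_le_mul_of_nonneg_left (hch x) (by positivity)
  have hb : ∀ f : C(X, ℝ), Bdd (f : X → ℝ) := fun f => Bdd.of_continuous f.continuous
  let U : Ultrafilter ℕ := Filter.hyperfilter ℕ
  have hU : (U : Filter ℕ) ≤ atTop := Nat.hyperfilter_le_atTop
  have hconv : ∀ f : C(X, ℝ), ∃ L, Tendsto (S.average s l f) U (𝓝 L) := by
    intro f
    obtain ⟨L, -, hL⟩ := (isCompact_Icc (a := -(‖f‖ / c)) (b := ‖f‖ / c)).ultrafilter_le_nhds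
      (U.map (S.average s l f)) (by
        rw [le_principal_iff, Ultrafilter.mem_coe, Ultrafilter.mem_map]
        exact Filter.univ_mem' fun N => abs_le.mp (hh.abs_average_le hs (hdom f) N))
    exact ⟨L, hL⟩
  choose Λ hΛ using hconv
  have hadd : ∀ f g, Λ (f + g) = Λ f + Λ g := fun f g => by
    refine tendsto_nhds_unique (hΛ (f + g)) (((hΛ f).add (hΛ g)).congr fun N => ?_)
    have : ((f + g : C(X, ℝ)) : X → ℝ) = fun x => f x + g x := rfl
    rw [this]
    simp only [average, iterate_add hs (hb f) (hb g), mul_add, Finset.sum_add_distrib, add_div]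
  have hsmul : ∀ (a : ℝ) f, Λ (a • f) = a * Λ f := fun a f => by
    refine tendsto_nhds_unique (hΛ (a • f)) (((hΛ f).const_mul a).congr fun N => ?_)
    have : ((a • f : C(X, ℝ)) : X → ℝ) = fun x => a * f x := rfl
    rw [this]
    simp only [average, iterate_const_mul]
    rw [← mul_div_assoc, Finset.mul_sum]
    congr 1
    exact Finset.sum_congr rfl fun k _ => by ring
  have hnn : ∀ f : C(X, ℝ), (∀ x, 0 ≤ f x) → 0 ≤ Λ f := fun f hf =>
    ge_of_tendsto' (hΛ f) fun N => div_nonneg (Finset.sum_nonneg fun k _ =>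
      mul_nonneg (inv_nonneg.mpr (pow_nonneg hh.pos.le _)) (iterate_nonneg s hf k _)) (by positivity)
  let TC : C(X, ℝ) → C(X, ℝ) := fun f => ⟨S.T s f, S.continuous_T hdist hlim hs f.continuous⟩
  have hinv : ∀ f, Λ (TC f) = l * Λ f := fun f => by
    rw [← sub_eq_zero]
    refine tendsto_nhds_unique ((hΛ (TC f)).sub ((hΛ f).const_mul l)) ?_
    have hsq : Tendsto (fun N : ℕ => l * (2 * (‖f‖ / c)) * (1 / ((N : ℝ) + 1))) U (𝓝 0) := by
      simpa using (tendsto_one_div_add_atTop_nhds_zero_nat.mono_left hU).const_mul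
        (l * (2 * (‖f‖ / c)))
    refine squeeze_zero_norm (fun N => ?_) hsq
    have e : S.average s l (TC f) N = S.average s l (S.T s f) N := rfl
    have hN : (0 : ℝ) < N + 1 := by positivity
    rw [e, average_T_sub hh.pos, Real.norm_eq_abs, abs_div, abs_of_pos hN, mul_one_div]
    refine div_le_div_of_nonneg_right ?_ hN.le
    rw [abs_mul, abs_of_pos hh.pos]
    refine mul_le_mul_of_nonneg_left ?_ hh.pos.le
    have hp := pow_pos hh.pos (N + 1)
    have h1 : |(l ^ (N + 1))⁻¹ * (S.T s)^[N + 1] f S.base| ≤ ‖f‖ / c := by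
      rw [abs_mul, abs_of_pos (inv_pos.mpr hp), inv_mul_le_iff₀ hp]
      simpa [hh.base] using hh.abs_iterate_le hs (hdom f) (N + 1) S.base
    have h2 : |f S.base| ≤ ‖f‖ / c := by simpa [hh.base] using hdom f S.base
    exact (abs_sub _ _).trans (by linarith)
  -- the functional is nonzero since its value at `h` is `1`
  have hone : 0 < Λ 1 := by
    let hC : C(X, ℝ) := ⟨h, hh.cone.continuous hlim⟩
    have h1 : Λ hC = 1 := by
      refine tendsto_nhds_unique (hΛ hC) (tendsto_const_nhds.congr fun N => ?_)
      have hk : ∀ k x, (S.T s)^[k] h x = l ^ k * h x := by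
        intro k
        induction k with
        | zero => intro x; simp
        | succ k ih =>
          intro x
          rw [Function.iterate_succ_apply', show (S.T s)^[k] h = fun x => l ^ k * h x from
            funext ih, S.T_const_mul, hh.eigen, pow_succ]
          ring
      have hN : (N : ℝ) + 1 ≠ 0 := by positivity
      have : ∀ k, (l ^ k)⁻¹ * (S.T s)^[k] hC S.base = 1 := fun k => by
        change (l ^ k)⁻¹ * (S.T s)^[k] h S.base = 1
        rw [hk, hh.base, mul_one, inv_mul_cancel₀ (pow_pos hh.pos k).ne']
      simp only [average, this]
      simp [hN]
    have h2 : 0 ≤ Λ (‖hC‖ • (1 : C(X, ℝ)) + (-1 : ℝ) • hC) := hnn _ fun x => by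
      have := (le_abs_self _).trans (hC.norm_coe_le_norm x)
      simp only [ContinuousMap.coe_add, ContinuousMap.coe_smul, Pi.add_apply, Pi.smul_apply,
        ContinuousMap.one_apply, smul_eq_mul]
      linarith
    rw [hadd, hsmul, hsmul, h1] at h2
    have h3 := norm_nonneg hC
    by_contra! h4
    nlinarith
  obtain ⟨ν, hν, hνΛ⟩ := exists_measure_of_nonneg
    { toFun := Λ, map_add' := hadd, map_smul' := hsmul } hnn
  have hνΛ' : ∀ f : C(X, ℝ), ∫ x, f x ∂ν = Λ f := hνΛ
  have hmass : ν.real Set.univ = Λ 1 := by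
    rw [← hνΛ' 1]; simp
  have hν0 : ν ≠ 0 := fun h0 => by
    rw [h0] at hmass
    simp at hmass
    exact hone.ne hmass
  have : NeZero ν := ⟨hν0⟩
  refine ⟨(ν Set.univ)⁻¹ • ν, inferInstance, fun f => ?_⟩
  rw [integral_smul_measure, integral_smul_measure, hνΛ' f,
    show ∫ x, S.T s f x ∂ν = Λ (TC f) from hνΛ' (TC f), hinv, smul_eq_mul, smul_eq_mul]
  ring

/-- The eigenvalue of a positive continuous eigenfunction is the only eigenvalue of an
eigenmeasure, as one sees by integrating the eigenfunction. -/
theorem IsPerron.eq_of_eigenmeasure [MetricSpace X] [CompactSpace X] [MeasurableSpace X]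
    [BorelSpace X] (hlim : ∀ x, Tendsto (S.d x) (𝓝 x) (𝓝 0)) {s l r : ℝ} (hs : 1 < s) {h : X → ℝ}
    (hh : S.IsPerron s l h) {ν : Measure X} [IsProbabilityMeasure ν]
    (hν : ∀ f : C(X, ℝ), ∫ x, S.T s f x ∂ν = r * ∫ x, f x ∂ν) : r = l := by
  have hc := hh.cone.continuous hlim
  have h1 := hν ⟨h, hc⟩
  simp only [ContinuousMap.coe_mk, hh.eigen] at h1
  rw [integral_const_mul] at h1
  have hpos : 0 < ∫ x, h x ∂ν := by
    have hint : Integrable h ν :=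
      (BoundedContinuousFunction.mkOfCompact ⟨h, hc⟩).integrable ν
    have hlow := integral_mono (integrable_const _) hint (hh.exp_le_apply hs)
    rw [integral_const] at hlow
    simp only [probReal_univ, one_smul] at hlow
    exact (Real.exp_pos _).trans_le hlow
  exact (mul_right_cancel₀ hpos.ne' h1).symm

end ContractingSystem

/-! ### Contraction of oscillations, in the real and the complex operator -/

namespace ContractingSystem

variable {X I : Type} (S : ContractingSystem X I)

/-- The oscillation of the real function `f` relative to `h`, in the order defined by the cone of
constant `a`, is at most `τ`. -/
def OscLe (a : ℝ) (h f : X → ℝ) (τ : ℝ) : Prop :=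
  ∃ m M, M - m ≤ τ ∧ S.Cone a (fun x => f x - m * h x) ∧ S.Cone a (fun x => M * h x - f x)

/-- The oscillation of the complex function `f` relative to `h` is at most `τ`, in every
direction of the complex plane. -/
def COscLe (a : ℝ) (h : X → ℝ) (f : X → ℂ) (τ : ℝ) : Prop :=
  ∀ u : ℂ, ‖u‖ = 1 → S.OscLe a h (fun x => (u * f x).re) τ

variable {S}

theorem Cone.zero (a : ℝ) : S.Cone a fun _ => 0 := ⟨fun _ => le_rfl, fun _ _ => by simp⟩

theorem OscLe.add {a τ τ' : ℝ} {h f g : X → ℝ} (hf : S.OscLe a h f τ) (hg : S.OscLe a h g τ') :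
    S.OscLe a h (fun x => f x + g x) (τ + τ') := by
  obtain ⟨m, M, h1, h2, h3⟩ := hf
  obtain ⟨m', M', h1', h2', h3'⟩ := hg
  refine ⟨m + m', M + M', by linarith, ?_, ?_⟩
  · convert h2.add h2' using 2; ring
  · convert h3.add h3' using 2; ring

theorem OscLe.const_mul {a τ c : ℝ} (hc : 0 ≤ c) {h f : X → ℝ} (hf : S.OscLe a h f τ) :
    S.OscLe a h (fun x => c * f x) (c * τ) := by
  obtain ⟨m, M, h1, h2, h3⟩ := hf
  refine ⟨c * m, c * M, by nlinarith, ?_, ?_⟩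
  · convert h2.const_mul hc using 2; ring
  · convert h3.const_mul hc using 2; ring

theorem OscLe.mono {a τ τ' : ℝ} (hτ : τ ≤ τ') {h f : X → ℝ} (hf : S.OscLe a h f τ) :
    S.OscLe a h f τ' := by
  obtain ⟨m, M, h1, h2⟩ := hf
  exact ⟨m, M, h1.trans hτ, h2⟩

theorem COscLe.add {a τ τ' : ℝ} {h : X → ℝ} {f g : X → ℂ} (hf : S.COscLe a h f τ)
    (hg : S.COscLe a h g τ') : S.COscLe a h (fun x => f x + g x) (τ + τ') := fun u hu => by
  simpa only [mul_add, Complex.add_re] using (hf u hu).add (hg u hu)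

theorem COscLe.mono {a τ τ' : ℝ} (hτ : τ ≤ τ') {h : X → ℝ} {f : X → ℂ}
    (hf : S.COscLe a h f τ) : S.COscLe a h f τ' := fun u hu => (hf u hu).mono hτ

theorem COscLe.const_mul {a τ : ℝ} (c : ℂ) {h : X → ℝ} {f : X → ℂ} (hf : S.COscLe a h f τ) :
    S.COscLe a h (fun x => c * f x) (‖c‖ * τ) := fun u hu => by
  obtain ⟨v, hv, hvc⟩ := exists_unit_mul_eq_norm c
  have hv0 : v ≠ 0 := norm_ne_zero_iff.mp (by rw [hv]; exact one_ne_zero)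
  have h1 := (hf (u * v⁻¹) (by rw [norm_mul, norm_inv, hu, hv]; simp)).const_mul (norm_nonneg c)
  convert h1 using 2 with x
  rw [← Complex.re_ofReal_mul, ← hvc]
  congr 1
  field_simp

theorem COscLe.sub {a τ τ' : ℝ} {h : X → ℝ} {f g : X → ℂ} (hf : S.COscLe a h f τ)
    (hg : S.COscLe a h g τ') : S.COscLe a h (fun x => f x - g x) (τ + τ') := by
  have := hf.add (hg.const_mul (-1))
  simpa [sub_eq_add_neg] using this

theorem COscLe.self (a : ℝ) (h : X → ℝ) : S.COscLe a h (fun x => (h x : ℂ)) 0 := fun u _ => by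
  refine ⟨u.re, u.re, by simp, ?_, ?_⟩ <;> simpa using Cone.zero a

theorem OscLe.nonneg {a τ : ℝ} {h f : X → ℝ} (h1 : h S.base = 1) (hf : S.OscLe a h f τ) :
    0 ≤ τ := by
  obtain ⟨m, M, k1, k2, k3⟩ := hf
  have a1 := k2.1 S.base
  have a2 := k3.1 S.base
  simp only [h1] at a1 a2
  linarith

theorem COscLe.nonneg {a τ : ℝ} {h : X → ℝ} {f : X → ℂ} (h1 : h S.base = 1)
    (hf : S.COscLe a h f τ) : 0 ≤ τ := (hf 1 (by simp)).nonneg h1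

theorem OscLe.abs_le {a τ : ℝ} {h f : X → ℝ} (h1 : h S.base = 1) (h0 : ∀ x, 0 ≤ h x)
    (hf : S.OscLe a h f τ) (hf0 : f S.base = 0) (x : X) : |f x| ≤ τ * h x := by
  obtain ⟨m, M, k1, k2, k3⟩ := hf
  have a1 := k2.1 S.base
  have a2 := k3.1 S.base
  simp only [h1, hf0] at a1 a2
  have b1 := k2.1 x
  have b2 := k3.1 x
  have b3 := h0 x
  rw [_root_.abs_le]
  constructor <;> nlinarith

theorem Cone.sub_le {a B : ℝ} (ha : 0 ≤ a) {f : X → ℝ} (hf : S.Cone a f) (hB : ∀ x, f x ≤ B)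
    (x y : X) : f x - f y ≤ a * Real.exp (a * S.diam) * B * S.d x y := by
  have h1 := hf.2 x y
  have h2 := exp_sub_exp_le (u := a * S.d x y) (v := 0)
  rw [Real.exp_zero, sub_zero] at h2
  have hd := S.d_nonneg x y
  have h3 : Real.exp (a * S.d x y) ≤ Real.exp (a * S.diam) :=
    Real.exp_le_exp.mpr (mul_le_mul_of_nonneg_left (S.d_le x y) ha)
  have h0 := hf.1 y
  calc f x - f y ≤ (Real.exp (a * S.d x y) - 1) * f y := by linarith
    _ ≤ a * S.d x y * Real.exp (a * S.d x y) * f y := mul_le_mul_of_nonneg_right h2 h0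
    _ ≤ a * S.d x y * Real.exp (a * S.diam) * B := by
        have := hB y
        gcongr
    _ = _ := by ring

theorem OscLe.sub_le {a τ H : ℝ} (ha : 0 ≤ a) {h f : X → ℝ} (h1 : h S.base = 1)
    (hh : S.Cone a h) (hH : ∀ x, h x ≤ H) (hf : S.OscLe a h f τ) (hf0 : f S.base = 0) (x y : X) :
    f x - f y ≤ 2 * (a * Real.exp (a * S.diam) * H) * τ * S.d x y := by
  obtain ⟨m, M, k1, k2, k3⟩ := hf
  have a1 := k2.1 S.base
  have a2 := k3.1 S.base
  simp only [h1, hf0] at a1 a2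
  have hH0 : 0 ≤ H := (hh.1 x).trans (hH x)
  have hub : ∀ z, f z - m * h z ≤ τ * H := fun z => by
    have b2 := k3.1 z
    have b3 := mul_le_mul_of_nonneg_left (hH z) (show 0 ≤ τ by linarith)
    have b4 := hh.1 z
    nlinarith
  have c1 := k2.sub_le ha hub x y
  have c2 := hh.sub_le ha hH y x
  rw [S.d_comm y x] at c2
  have hK : 0 ≤ a * Real.exp (a * S.diam) * H * S.d x y :=
    mul_nonneg (by positivity) (S.d_nonneg x y)
  have c3 := mul_le_mul_of_nonneg_left c2 (show 0 ≤ -m by linarith)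
  have c4 : -m * (a * Real.exp (a * S.diam) * H * S.d x y)
      ≤ τ * (a * Real.exp (a * S.diam) * H * S.d x y) :=
    mul_le_mul_of_nonneg_right (by linarith) hK
  nlinarith

theorem COscLe.norm_le {a τ : ℝ} {h : X → ℝ} {f : X → ℂ} (h1 : h S.base = 1)
    (h0 : ∀ x, 0 ≤ h x) (hf : S.COscLe a h f τ) (hf0 : f S.base = 0) (x : X) :
    ‖f x‖ ≤ τ * h x := by
  obtain ⟨u, hu, hux⟩ := exists_unit_mul_eq_norm (f x)
  have := (hf u hu).abs_le h1 h0 (by simp [hf0]) x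
  simpa [hux] using this

theorem COscLe.norm_sub_le {a τ H : ℝ} (ha : 0 ≤ a) {h : X → ℝ} {f : X → ℂ} (h1 : h S.base = 1)
    (hh : S.Cone a h) (hH : ∀ x, h x ≤ H) (hf : S.COscLe a h f τ) (hf0 : f S.base = 0) (x y : X) :
    ‖f x - f y‖ ≤ 2 * (a * Real.exp (a * S.diam) * H) * τ * S.d x y := by
  obtain ⟨u, hu, hux⟩ := exists_unit_mul_eq_norm (f x - f y)
  have := (hf u hu).sub_le ha h1 hh hH (by simp [hf0]) x y
  rw [← Complex.sub_re, ← mul_sub, hux, Complex.ofReal_re] at this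
  exact this

theorem OscLe.of_lipschitz {a e c : ℝ} (ha : 1 ≤ a) {h G : X → ℝ} (hh : S.Cone (a - 1) h)
    (hc0 : 0 < c) (hc : ∀ x, c ≤ h x) (he : 0 ≤ e) (hG : ∀ x, |G x| ≤ e)
    (hGL : ∀ x y, |G x - G y| ≤ e * S.d x y) :
    S.OscLe a h G (2 * (a * Real.exp (a * S.diam) + 1) / c * e) := by
  set t := e * (a * Real.exp (a * S.diam) + 1) / c with ht
  have ht0 : 0 ≤ t := by positivity
  have hte : e * (a * Real.exp (a * S.diam) + 1) ≤ t * c := by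
    rw [ht, div_mul_cancel₀ _ hc0.ne']
  refine ⟨-t, t, ?_, ?_, ?_⟩
  · rw [ht]; apply le_of_eq; ring
  · have := hh.add_of_lipschitz ha hc he ht0 hG hGL hte
    convert this using 2; ring
  · have := hh.add_of_lipschitz (G := fun x => - G x) ha hc he ht0 (fun x => by
      rw [abs_neg]; exact hG x) (fun x y => by
      rw [show -G x - -G y = -(G x - G y) by ring, abs_neg]; exact hGL x y) hte
    convert this using 2; ring

theorem COscLe.of_lipschitz {a e c : ℝ} (ha : 1 ≤ a) {h : X → ℝ} {G : X → ℂ}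
    (hh : S.Cone (a - 1) h) (hc0 : 0 < c) (hc : ∀ x, c ≤ h x) (he : 0 ≤ e)
    (hG : ∀ x, ‖G x‖ ≤ e) (hGL : ∀ x y, ‖G x - G y‖ ≤ e * S.d x y) :
    S.COscLe a h G (2 * (a * Real.exp (a * S.diam) + 1) / c * e) := fun u hu => by
  refine OscLe.of_lipschitz ha hh hc0 hc he (fun x => ?_) fun x y => ?_
  · refine (Complex.abs_re_le_norm _).trans ?_
    rw [norm_mul, hu, one_mul]; exact hG x
  · rw [← Complex.sub_re, ← mul_sub]
    refine (Complex.abs_re_le_norm _).trans ?_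
    rw [norm_mul, hu, one_mul]; exact hGL x y

/-- The normalized transfer operator contracts the oscillation relative to its eigenfunction. -/
theorem IsPerron.oscLe_T {s l τ : ℝ} (hs : 1 < s) {h : X → ℝ} (hh : S.IsPerron s l h)
    {f : X → ℝ} (hfb : Bdd f) (hf : S.OscLe (S.apt s) h f τ) :
    S.OscLe (S.apt s) h (fun x => l⁻¹ * S.T s f x) ((1 - S.gap s) * τ) := by
  obtain ⟨m, M, k1, k2, k3⟩ := hf
  have a1 := k2.1 S.base
  have a2 := k3.1 S.base
  simp only [hh.base] at a1 a2
  obtain ⟨m', M', -, -, c1, c2, c3⟩ :=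
    Cone.contract hs (by linarith) hfb (hh.cone.mono (by linarith)) k2 k3
  have hl := hh.pos
  have hgap := S.gap_lt_one (zero_le_one.trans hs.le)
  refine ⟨m', M', ?_, ?_, ?_⟩
  · rw [c1]; exact mul_le_mul_of_nonneg_left k1 (by linarith)
  · convert c2.const_mul (inv_nonneg.mpr hl.le) using 2 with x
    rw [hh.eigen]; field_simp
  · convert c3.const_mul (inv_nonneg.mpr hl.le) using 2 with x
    rw [hh.eigen]; field_simp

theorem IsPerron.cOscLe_Tc {s l τ : ℝ} (hs : 1 < s) {h : X → ℝ} (hh : S.IsPerron s l h)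
    {f : X → ℂ} (hfb : Bdd f) (hf : S.COscLe (S.apt s) h f τ) :
    S.COscLe (S.apt s) h (fun x => (l : ℂ)⁻¹ * S.Tc s f x) ((1 - S.gap s) * τ) := fun u hu => by
  have := hh.oscLe_T hs (hfb.re_mul u) (hf u hu)
  convert this using 2 with x
  rw [← S.re_mul_Tc hs hfb, mul_left_comm, ← Complex.ofReal_inv, Complex.re_ofReal_mul]

theorem IsPerron.norm_Tc_le {s l A : ℝ} (hs : 1 < s) {h : X → ℝ} (hh : S.IsPerron s l h)
    {f : X → ℂ} (hfb : Bdd f) (hf : ∀ x, ‖f x‖ ≤ A * h x) (x : X) :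
    ‖(l : ℂ)⁻¹ * S.Tc s f x‖ ≤ A * h x := by
  obtain ⟨u, hu, hux⟩ := exists_unit_mul_eq_norm (S.Tc s f x)
  have h1 : ‖S.Tc s f x‖ = S.T s (fun x => (u * f x).re) x := by
    rw [← S.re_mul_Tc hs hfb u x, hux, Complex.ofReal_re]
  rw [norm_mul, norm_inv, Complex.norm_real, Real.norm_of_nonneg hh.pos.le,
    inv_mul_le_iff₀ hh.pos, h1, mul_left_comm, ← hh.eigen, ← S.T_const_mul]
  refine S.T_mono hs (hfb.re_mul u) ((hh.bdd hs).const_mul A) (fun y => ?_) x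
  refine (Complex.re_le_norm _).trans ?_
  rw [norm_mul, hu, one_mul]
  exact hf y

/-! ### Dependence of the weights on the parameter -/

theorem norm_cexp_sub_one_le (z : ℂ) : ‖Complex.exp z - 1‖ ≤ ‖z‖ * Real.exp ‖z‖ := by
  have h := Complex.norm_exp_sub_sum_le_norm_mul_exp z 1
  simpa using h

theorem norm_cexp_mul_sub_one_le {κ t : ℝ} (hκ : 0 < κ) (ht : 0 ≤ t) {z : ℂ} (hz : ‖z‖ ≤ κ) :
    ‖Complex.exp (-z * t) - 1‖ ≤ ‖z‖ / κ * Real.exp (2 * κ * t) := by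
  refine (norm_cexp_sub_one_le _).trans ?_
  rw [norm_mul, norm_neg, Complex.norm_real, Real.norm_of_nonneg ht]
  have h1 : κ * t ≤ Real.exp (κ * t) := by linarith [Real.add_one_le_exp (κ * t)]
  have h2 : Real.exp (‖z‖ * t) ≤ Real.exp (κ * t) :=
    Real.exp_le_exp.mpr (mul_le_mul_of_nonneg_right hz ht)
  have h3 : Real.exp (2 * κ * t) = Real.exp (κ * t) * Real.exp (κ * t) := by
    rw [← Real.exp_add]; ring_nf
  rw [h3]
  calc ‖z‖ * t * Real.exp (‖z‖ * t) = ‖z‖ / κ * ((κ * t) * Real.exp (‖z‖ * t)) := by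
        field_simp
    _ ≤ _ := by gcongr

/-- The change of the weights under a change of the parameter from `s₀` to `s`, together with its
Lipschitz constant, is of order `‖s - s₀‖`, with a summable factor. -/
theorem exists_weight_bound (S : ContractingSystem X I) {s₀ : ℝ} (hs₀ : 1 < s₀) :
    ∃ C, 0 ≤ C ∧ ∃ b : I → ℝ, Summable b ∧ (∀ i, 0 ≤ b i) ∧
      ∀ s : ℂ, ‖s - s₀‖ ≤ (s₀ - 1) / 4 → ∀ i x,
        ‖Complex.exp (-s * S.len i x) - Complex.exp (-(s₀ : ℂ) * S.len i x)‖
          ≤ C * ‖s - s₀‖ * b i ∧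
        ∀ y, ‖(Complex.exp (-s * S.len i x) - Complex.exp (-(s₀ : ℂ) * S.len i x)) -
            (Complex.exp (-s * S.len i y) - Complex.exp (-(s₀ : ℂ) * S.len i y))‖
          ≤ C * ‖s - s₀‖ * b i * S.d x y := by
  set κ := (s₀ - 1) / 4 with hκ
  have hκ0 : 0 < κ := by rw [hκ]; linarith
  set s₁ := s₀ - 2 * κ with hs₁
  have hs₁1 : 1 < s₁ := by rw [hs₁, hκ]; linarith
  set c := S.distortion with hc
  have hc0 : 0 ≤ c := S.distortion_nonneg
  have hR := S.diam_nonneg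
  set W := Real.exp (s₁ * c * S.diam) with hW
  have hW0 : 0 < W := Real.exp_pos _
  set C := W / κ + (s₀ * c * Real.exp (s₀ * c * S.diam) * (W / κ)
    + W * (c * Real.exp (κ * c * S.diam))) with hC
  have hCa : 0 ≤ s₀ * c * Real.exp (s₀ * c * S.diam) * (W / κ) := by positivity
  have hCb : 0 ≤ W * (c * Real.exp (κ * c * S.diam)) := by positivity
  refine ⟨C, by positivity, fun i => Real.exp (-s₁ * S.len i S.base), S.summable_exp hs₁1 _,
    fun i => (Real.exp_pos _).le, fun s hs i x => ?_⟩
  have hWb : ∀ y, Real.exp (-s₁ * S.len i y) ≤ W * Real.exp (-s₁ * S.len i S.base) := fun y => by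
    refine (S.exp_len_le (by linarith) i y S.base).trans ?_
    refine mul_le_mul_of_nonneg_right (Real.exp_le_exp.mpr ?_) (Real.exp_pos _).le
    exact mul_le_mul_of_nonneg_left (S.d_le _ _) (by positivity)
  set z := s - s₀ with hz
  set b := Real.exp (-s₁ * S.len i S.base) with hb
  have hb0 : 0 < b := Real.exp_pos _
  have hfac : ∀ y, Complex.exp (-s * S.len i y) - Complex.exp (-(s₀ : ℂ) * S.len i y)
      = Complex.exp (-(s₀ : ℂ) * S.len i y) * (Complex.exp (-z * S.len i y) - 1) := fun y => by
    rw [mul_sub, ← Complex.exp_add, mul_one, hz]; congr 2; ring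
  have hn0 : ∀ y, ‖Complex.exp (-(s₀ : ℂ) * S.len i y)‖ = Real.exp (-s₀ * S.len i y) := fun y => by
    rw [S.norm_cexp]; simp
  have hw : ∀ y, Real.exp (-s₀ * S.len i y) * ‖Complex.exp (-z * S.len i y) - 1‖
      ≤ W / κ * ‖z‖ * b := fun y => by
    calc Real.exp (-s₀ * S.len i y) * ‖Complex.exp (-z * S.len i y) - 1‖
        ≤ Real.exp (-s₀ * S.len i y) * (‖z‖ / κ * Real.exp (2 * κ * S.len i y)) :=
          mul_le_mul_of_nonneg_left (norm_cexp_mul_sub_one_le hκ0 (S.len_nonneg i y) hs)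
            (Real.exp_pos _).le
      _ = ‖z‖ / κ * Real.exp (-s₁ * S.len i y) := by
          rw [mul_left_comm, ← Real.exp_add, hs₁]; ring_nf
      _ ≤ ‖z‖ / κ * (W * b) := mul_le_mul_of_nonneg_left (hWb y) (by positivity)
      _ = _ := by ring
  refine ⟨?_, fun y => ?_⟩
  · rw [hfac, norm_mul, hn0]
    refine (hw x).trans ?_
    rw [hC]
    gcongr
    linarith
  · have hd := S.d_nonneg x y
    set t := S.d x y with ht
    have hdl : |S.len i x - S.len i y| ≤ c * t := by
      have h1 := S.len_sub_le i x y
      have h2 := S.len_sub_le i y x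
      rw [S.d_comm y x] at h2
      rw [abs_le]
      constructor <;> linarith
    have hctR : c * t ≤ c * S.diam := mul_le_mul_of_nonneg_left (S.d_le x y) hc0
    have hsplit : (Complex.exp (-s * S.len i x) - Complex.exp (-(s₀ : ℂ) * S.len i x)) -
        (Complex.exp (-s * S.len i y) - Complex.exp (-(s₀ : ℂ) * S.len i y))
        = -(Complex.exp ((s₀ * (S.len i x - S.len i y) : ℝ)) - 1) *
            (Complex.exp (-(s₀ : ℂ) * S.len i x) * (Complex.exp (-z * S.len i x) - 1))
          + Complex.exp (-s * S.len i y) *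
            (Complex.exp (-z * (S.len i x - S.len i y : ℝ)) - 1) := by
      have e1 : Complex.exp ((s₀ * (S.len i x - S.len i y) : ℝ)) *
          Complex.exp (-(s₀ : ℂ) * S.len i x) = Complex.exp (-(s₀ : ℂ) * S.len i y) := by
        rw [← Complex.exp_add]; congr 1; push_cast; ring
      have e2 : Complex.exp (-(s₀ : ℂ) * S.len i x) * Complex.exp (-z * S.len i x)
          = Complex.exp (-s * S.len i x) := by
        rw [← Complex.exp_add, hz]; congr 1; ring
      have e3 : Complex.exp (-s * S.len i y) * Complex.exp (-z * (S.len i x - S.len i y : ℝ))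
          = Complex.exp (-(s₀ : ℂ) * S.len i y) * Complex.exp (-z * S.len i x) := by
        rw [← Complex.exp_add, ← Complex.exp_add, hz]; congr 1; push_cast; ring
      have e4 : Complex.exp ((s₀ * (S.len i x - S.len i y) : ℝ)) *
          (Complex.exp (-(s₀ : ℂ) * S.len i x) * Complex.exp (-z * S.len i x))
          = Complex.exp (-(s₀ : ℂ) * S.len i y) * Complex.exp (-z * S.len i x) := by
        rw [← mul_assoc, e1]
      linear_combination e4 - e1 - e3 - e2
    have hA : ‖Complex.exp ((s₀ * (S.len i x - S.len i y) : ℝ)) - 1‖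
        ≤ s₀ * c * Real.exp (s₀ * c * S.diam) * t := by
      refine (norm_cexp_sub_one_le _).trans ?_
      rw [Complex.norm_real, norm_mul, Real.norm_of_nonneg (by linarith), Real.norm_eq_abs]
      calc s₀ * |S.len i x - S.len i y| * Real.exp (s₀ * |S.len i x - S.len i y|)
          ≤ s₀ * (c * t) * Real.exp (s₀ * (c * S.diam)) := by
            gcongr
            exact hdl.trans hctR
        _ = _ := by ring_nf
    have hB : ‖Complex.exp (-z * (S.len i x - S.len i y : ℝ)) - 1‖
        ≤ ‖z‖ * (c * Real.exp (κ * c * S.diam)) * t := by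
      refine (norm_cexp_sub_one_le _).trans ?_
      rw [norm_mul, norm_neg, Complex.norm_real, Real.norm_eq_abs]
      calc ‖z‖ * |S.len i x - S.len i y| * Real.exp (‖z‖ * |S.len i x - S.len i y|)
          ≤ ‖z‖ * (c * t) * Real.exp (κ * (c * S.diam)) := by
            gcongr
            exact hdl.trans hctR
        _ = _ := by ring_nf
    have hs' : s₁ ≤ s.re := by
      have h1 := Complex.abs_re_le_norm z
      have h2 : z.re = s.re - s₀ := by simp [hz]
      have h3 := neg_le_of_abs_le (h1.trans hs)
      rw [h2] at h3
      rw [hs₁]; linarith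
    have hny : ‖Complex.exp (-s * S.len i y)‖ ≤ W * b := by
      rw [S.norm_cexp]
      exact (S.exp_le_exp_of_le hs' i y).trans (hWb y)
    rw [hsplit]
    refine (norm_add_le _ _).trans ?_
    rw [norm_mul, norm_neg, norm_mul, norm_mul, hn0]
    calc ‖Complex.exp ((s₀ * (S.len i x - S.len i y) : ℝ)) - 1‖ *
            (Real.exp (-s₀ * S.len i x) * ‖Complex.exp (-z * S.len i x) - 1‖)
          + ‖Complex.exp (-s * S.len i y)‖ *
            ‖Complex.exp (-z * (S.len i x - S.len i y : ℝ)) - 1‖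
        ≤ s₀ * c * Real.exp (s₀ * c * S.diam) * t * (W / κ * ‖z‖ * b)
          + W * b * (‖z‖ * (c * Real.exp (κ * c * S.diam)) * t) :=
          add_le_add (mul_le_mul hA (hw x) (by positivity) (by positivity))
            (mul_le_mul hny hB (norm_nonneg _) (by positivity))
      _ = (s₀ * c * Real.exp (s₀ * c * S.diam) * (W / κ)
            + W * (c * Real.exp (κ * c * S.diam))) * ‖z‖ * b * t := by ring
      _ ≤ _ := by
          have : 0 ≤ W / κ := by positivity
          have hle : s₀ * c * Real.exp (s₀ * c * S.diam) * (W / κ)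
              + W * (c * Real.exp (κ * c * S.diam)) ≤ C := by linarith
          gcongr

/-- Perturbation estimate for the transfer operator on Lipschitz functions. -/
theorem exists_perturbation_bound (S : ContractingSystem X I) {s₀ : ℝ} (hs₀ : 1 < s₀) :
    ∃ C, 0 ≤ C ∧ ∀ s : ℂ, ‖s - s₀‖ ≤ (s₀ - 1) / 4 → ∀ (f : X → ℂ) (B : ℝ), 0 ≤ B →
      (∀ x, ‖f x‖ ≤ B) → (∀ x y, ‖f x - f y‖ ≤ B * S.d x y) →
      (∀ x, ‖S.Tc s f x - S.Tc s₀ f x‖ ≤ C * ‖s - s₀‖ * B) ∧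
      ∀ x y, ‖(S.Tc s f x - S.Tc s₀ f x) - (S.Tc s f y - S.Tc s₀ f y)‖
        ≤ C * ‖s - s₀‖ * B * S.d x y := by
  obtain ⟨C, hC0, b, hb, hb0, hC⟩ := S.exists_weight_bound hs₀
  refine ⟨2 * C * ∑' i, b i, mul_nonneg (by positivity) (tsum_nonneg hb0),
    fun s hs f B hB0 hB hL => ?_⟩
  have hsum0 : 0 ≤ ∑' i, b i := tsum_nonneg hb0
  have hsre : 1 < s.re := by
    have h1 := neg_le_of_abs_le ((Complex.abs_re_le_norm (s - s₀)).trans hs)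
    simp only [Complex.sub_re, Complex.ofReal_re] at h1
    linarith
  have hre0 : 1 < (s₀ : ℂ).re := by simpa using hs₀
  have hfb : Bdd f := ⟨B, hB⟩
  have hdiff : ∀ x, HasSum (fun i => (Complex.exp (-s * S.len i x)
      - Complex.exp (-(s₀ : ℂ) * S.len i x)) * f (S.map i x)) (S.Tc s f x - S.Tc s₀ f x) := by
    intro x
    have := (S.summable_Tc hsre hfb x).hasSum.sub (S.summable_Tc hre0 hfb x).hasSum
    simp only [sub_mul]
    exact this
  have key : ∀ (g : I → ℂ) (v : ℂ) (K : ℝ), HasSum g v → (∀ i, ‖g i‖ ≤ K * b i) →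
      ‖v‖ ≤ K * ∑' i, b i := by
    intro g v K hg hK
    rw [← hg.tsum_eq]
    exact tsum_of_norm_bounded (hb.hasSum.mul_left K) hK
  refine ⟨fun x => ?_, fun x y => ?_⟩
  · refine (key _ _ (C * ‖s - s₀‖ * B) (hdiff x) fun i => ?_).trans ?_
    · rw [norm_mul]
      calc _ ≤ C * ‖s - s₀‖ * b i * B := mul_le_mul ((hC s hs i x).1) (hB _) (norm_nonneg _)
            (mul_nonneg (by positivity) (hb0 i))
        _ = _ := by ring
    · have : 0 ≤ C * ‖s - s₀‖ * B * ∑' i, b i := by positivity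
      linarith
  · have hd := S.d_nonneg x y
    refine (key _ _ (2 * C * ‖s - s₀‖ * B * S.d x y) ((hdiff x).sub (hdiff y))
      fun i => ?_).trans (le_of_eq (by ring))
    have e : (Complex.exp (-s * S.len i x) - Complex.exp (-(s₀ : ℂ) * S.len i x)) * f (S.map i x)
        - (Complex.exp (-s * S.len i y) - Complex.exp (-(s₀ : ℂ) * S.len i y)) * f (S.map i y)
        = ((Complex.exp (-s * S.len i x) - Complex.exp (-(s₀ : ℂ) * S.len i x)) -
            (Complex.exp (-s * S.len i y) - Complex.exp (-(s₀ : ℂ) * S.len i y))) * f (S.map i x)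
          + (Complex.exp (-s * S.len i y) - Complex.exp (-(s₀ : ℂ) * S.len i y)) *
            (f (S.map i x) - f (S.map i y)) := by ring
    rw [e]
    refine (norm_add_le _ _).trans ?_
    rw [norm_mul, norm_mul]
    have h3 : ‖f (S.map i x) - f (S.map i y)‖ ≤ B * S.d x y := by
      refine (hL _ _).trans (mul_le_mul_of_nonneg_left ?_ hB0)
      refine (S.d_map_le i x y).trans ?_
      exact mul_le_of_le_one_left hd S.ratio_lt_one.le
    have hbi := hb0 i
    calc _ ≤ C * ‖s - s₀‖ * b i * S.d x y * B + C * ‖s - s₀‖ * b i * (B * S.d x y) :=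
          add_le_add (mul_le_mul ((hC s hs i x).2 y) (hB _) (norm_nonneg _) (by positivity))
            (mul_le_mul ((hC s hs i y).1) h3 (norm_nonneg _) (by positivity))
      _ = _ := by ring

end ContractingSystem

/-! ### Analytic dependence of the eigenvalue -/

namespace ContractingSystem

variable {X I : Type} (S : ContractingSystem X I)

/-- The transfer operator divided by the eigenvalue `l`. -/
noncomputable def Ls (l : ℝ) (s : ℂ) (f : X → ℂ) (x : X) : ℂ := (l : ℂ)⁻¹ * S.Tc s f x

/-- The projective action of the transfer operator on functions normalized at the base point. -/
noncomputable def proj (l : ℝ) (s : ℂ) (f : X → ℂ) (x : X) : ℂ := S.Ls l s f x / S.Ls l s f S.base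

/-- The complex parameter `s` is so close to `s₀` that the normalized transfer operators differ by
at most `ε`, in terms of the oscillation relative to `h` and the value at the base point. -/
structure IsNear (s₀ l : ℝ) (h : X → ℝ) (s : ℂ) (ε : ℝ) : Prop where
  re : 1 < s.re
  osc : ∀ (f : X → ℂ) (τ : ℝ), S.COscLe (S.apt s₀) h f τ → f S.base = 0 →
    S.COscLe (S.apt s₀) h (fun x => S.Ls l s f x - S.Ls l s₀ f x) (ε * τ)
  base : ∀ (f : X → ℂ) (τ : ℝ), S.COscLe (S.apt s₀) h f τ → f S.base = 0 →
    ‖S.Ls l s f S.base - S.Ls l s₀ f S.base‖ ≤ ε * τ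
  osc_h : S.COscLe (S.apt s₀) h
    (fun x => S.Ls l s (fun x => (h x : ℂ)) x - S.Ls l s₀ (fun x => (h x : ℂ)) x) ε
  base_h : ‖S.Ls l s (fun x => (h x : ℂ)) S.base - S.Ls l s₀ (fun x => (h x : ℂ)) S.base‖ ≤ ε

variable {S}

theorem IsNear.mono {s₀ l : ℝ} {h : X → ℝ} (h1 : h S.base = 1) {s : ℂ} {ε ε' : ℝ}
    (hn : S.IsNear s₀ l h s ε) (hε : ε ≤ ε') : S.IsNear s₀ l h s ε' where
  re := hn.re
  osc f τ hf hf0 := (hn.osc f τ hf hf0).mono (mul_le_mul_of_nonneg_right hε (hf.nonneg h1))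
  base f τ hf hf0 := (hn.base f τ hf hf0).trans
    (mul_le_mul_of_nonneg_right hε (hf.nonneg h1))
  osc_h := hn.osc_h.mono hε
  base_h := hn.base_h.trans hε

theorem IsPerron.exists_isNear {s₀ l : ℝ} (hs₀ : 1 < s₀) {h : X → ℝ} (hh : S.IsPerron s₀ l h) :
    ∃ C, 0 ≤ C ∧ ∀ s : ℂ, ‖s - s₀‖ ≤ (s₀ - 1) / 4 → S.IsNear s₀ l h s (C * ‖s - s₀‖) := by
  obtain ⟨C, hC0, hC⟩ := S.exists_perturbation_bound hs₀
  have ha := S.one_le_apt (zero_le_one.trans hs₀.le)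
  have ha0 : 0 ≤ S.apt s₀ := zero_le_one.trans ha
  have hcone : S.Cone (S.apt s₀) h := hh.cone.mono (by linarith)
  set H := Real.exp (S.apt s₀ * S.diam) with hH
  have hhH : ∀ x, h x ≤ H := fun x => by
    have := hcone.le_diam ha0 x S.base
    rwa [hh.base, mul_one] at this
  have hH0 : 0 < H := Real.exp_pos _
  set L := S.apt s₀ * H * H with hL
  have hL0 : 0 ≤ L := by positivity
  set c := Real.exp (-((S.apt s₀ - 1) * S.diam)) with hc
  have hc0 : 0 < c := Real.exp_pos _
  set D := 2 * (S.apt s₀ * H + 1) / c with hD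
  have hD0 : 0 ≤ D := by positivity
  have hl := hh.pos
  have gen : ∀ s : ℂ, ‖s - s₀‖ ≤ (s₀ - 1) / 4 → ∀ (f : X → ℂ) (τ : ℝ), 0 ≤ τ →
      (∀ x, ‖f x‖ ≤ H * τ) → (∀ x y, ‖f x - f y‖ ≤ 2 * L * τ * S.d x y) →
      S.COscLe (S.apt s₀) h (fun x => S.Ls l s f x - S.Ls l s₀ f x)
        ((D + 1) * (l⁻¹ * C * (H + 2 * L)) * ‖s - s₀‖ * τ) ∧
      ‖S.Ls l s f S.base - S.Ls l s₀ f S.base‖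
        ≤ (D + 1) * (l⁻¹ * C * (H + 2 * L)) * ‖s - s₀‖ * τ := by
    intro s hs f τ hτ h1 h2
    obtain ⟨k1, k2⟩ := hC s hs f ((H + 2 * L) * τ) (by positivity)
      (fun x => (h1 x).trans (by gcongr; linarith)) fun x y => by
        refine (h2 x y).trans (mul_le_mul_of_nonneg_right ?_ (S.d_nonneg x y))
        gcongr
        linarith
    set e := l⁻¹ * C * (H + 2 * L) * ‖s - s₀‖ * τ with he
    have he0 : 0 ≤ e := by positivity
    have n1 : ∀ x, ‖S.Ls l s f x - S.Ls l s₀ f x‖ ≤ e := fun x => by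
      rw [Ls, Ls, ← mul_sub, norm_mul, norm_inv, Complex.norm_real, Real.norm_of_nonneg hl.le]
      refine (mul_le_mul_of_nonneg_left (k1 x) (inv_nonneg.mpr hl.le)).trans (le_of_eq ?_)
      rw [he]; ring
    have n2 : ∀ x y, ‖(S.Ls l s f x - S.Ls l s₀ f x) - (S.Ls l s f y - S.Ls l s₀ f y)‖
        ≤ e * S.d x y := fun x y => by
      rw [Ls, Ls, Ls, Ls, ← mul_sub, ← mul_sub, ← mul_sub, norm_mul, norm_inv, Complex.norm_real,
        Real.norm_of_nonneg hl.le]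
      refine (mul_le_mul_of_nonneg_left (k2 x y) (inv_nonneg.mpr hl.le)).trans (le_of_eq ?_)
      rw [he]; ring
    constructor
    · refine (COscLe.of_lipschitz ha hh.cone hc0 (hh.exp_le_apply hs₀) he0 n1 n2).mono ?_
      rw [← hH, ← hD]
      have : (D + 1) * (l⁻¹ * C * (H + 2 * L)) * ‖s - s₀‖ * τ = (D + 1) * e := by rw [he]; ring
      rw [this]
      linarith
    · refine (n1 _).trans ?_
      have : (D + 1) * (l⁻¹ * C * (H + 2 * L)) * ‖s - s₀‖ * τ = (D + 1) * e := by rw [he]; ring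
      rw [this]
      nlinarith
  have genf : ∀ s : ℂ, ‖s - s₀‖ ≤ (s₀ - 1) / 4 → ∀ (f : X → ℂ) (τ : ℝ),
      S.COscLe (S.apt s₀) h f τ → f S.base = 0 → _ := fun s hs f τ hf hf0 =>
    gen s hs f τ (hf.nonneg hh.base)
      (fun x => (hf.norm_le hh.base hh.cone.1 hf0 x).trans (by
        rw [mul_comm]
        exact mul_le_mul_of_nonneg_right (hhH x) (hf.nonneg hh.base)))
      (fun x y => (hf.norm_sub_le ha0 hh.base hcone hhH hf0 x y).trans
        (le_of_eq (by rw [hL, hH])))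
  have genh : ∀ s : ℂ, ‖s - s₀‖ ≤ (s₀ - 1) / 4 → _ := fun s hs =>
    gen s hs (fun x => (h x : ℂ)) 1 zero_le_one
      (fun x => by
        rw [Complex.norm_real, Real.norm_of_nonneg (hh.cone.1 x), mul_one]; exact hhH x)
      (fun x y => by
        rw [← Complex.ofReal_sub, Complex.norm_real, Real.norm_eq_abs, abs_le]
        have h1 := hcone.sub_le ha0 hhH x y
        have h2 := hcone.sub_le ha0 hhH y x
        rw [S.d_comm y x] at h2
        rw [← hH, ← hL] at h1 h2
        have h3 : 0 ≤ L * S.d x y := mul_nonneg hL0 (S.d_nonneg x y)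
        constructor <;> linarith)
  refine ⟨(D + 1) * (l⁻¹ * C * (H + 2 * L)), by positivity, fun s hs => ⟨?_,
    fun f τ hf hf0 => (genf s hs f τ hf hf0).1, fun f τ hf hf0 => (genf s hs f τ hf hf0).2,
    by simpa using (genh s hs).1, by simpa using (genh s hs).2⟩⟩
  have h1 := neg_le_of_abs_le ((Complex.abs_re_le_norm (s - s₀)).trans hs)
  simp only [Complex.sub_re, Complex.ofReal_re] at h1
  linarith

theorem Ls_add {l : ℝ} {s : ℂ} (hs : 1 < s.re) {f g : X → ℂ} (hf : Bdd f) (hg : Bdd g) (x : X) :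
    S.Ls l s (fun x => f x + g x) x = S.Ls l s f x + S.Ls l s g x := by
  unfold Ls Tc
  rw [← mul_add, ← (S.summable_Tc hs hf x).tsum_add (S.summable_Tc hs hg x)]
  simp only [mul_add]

theorem IsPerron.Ls_self {s₀ l : ℝ} {h : X → ℝ} (hh : S.IsPerron s₀ l h) (x : X) :
    S.Ls l s₀ (fun x => (h x : ℂ)) x = h x := by
  rw [Ls, S.Tc_ofReal, hh.eigen, Complex.ofReal_mul, inv_mul_cancel_left₀]
  exact_mod_cast hh.pos.ne'

theorem IsPerron.bdd_of_norm_le {s₀ l A : ℝ} (hs₀ : 1 < s₀) {h : X → ℝ} (hh : S.IsPerron s₀ l h)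
    {f : X → ℂ} (hf : ∀ x, ‖f x‖ ≤ A * h x) : Bdd f := by
  obtain ⟨B, hB⟩ := (hh.bdd hs₀).const_mul A
  exact ⟨B, fun x => (hf x).trans ((le_abs_self _).trans (hB x))⟩

/-- The effect of a nearby transfer operator on a function vanishing at the base point. -/
theorem IsNear.osc_Ls {s₀ l ε τ : ℝ} (hs₀ : 1 < s₀) {h : X → ℝ} (hh : S.IsPerron s₀ l h)
    {s : ℂ} (hn : S.IsNear s₀ l h s ε) {f : X → ℂ} (hf : S.COscLe (S.apt s₀) h f τ)
    (hf0 : f S.base = 0) :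
    S.COscLe (S.apt s₀) h (S.Ls l s f) ((1 - S.gap s₀ + ε) * τ) ∧
      ‖S.Ls l s f S.base‖ ≤ (1 + ε) * τ := by
  have hnorm := hf.norm_le hh.base hh.cone.1 hf0
  have hfb := hh.bdd_of_norm_le hs₀ hnorm
  constructor
  · have := (hh.cOscLe_Tc hs₀ hfb hf).add (hn.osc f τ hf hf0)
    convert this using 1
    · funext x; simp only [Ls]; ring
    · ring
  · have h1 := hh.norm_Tc_le hs₀ hfb hnorm S.base
    rw [hh.base, mul_one] at h1
    have h2 := hn.base f τ hf hf0
    calc ‖S.Ls l s f S.base‖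
        = ‖(l : ℂ)⁻¹ * S.Tc s₀ f S.base + (S.Ls l s f S.base - S.Ls l s₀ f S.base)‖ := by
          simp only [Ls]; congr 1; ring
      _ ≤ τ + ε * τ := (norm_add_le _ _).trans (add_le_add h1 h2)
      _ = _ := by ring

/-- Functions with value `1` at the base point which are close to the eigenfunction `h`. -/
structure IsClose (S : ContractingSystem X I) (s₀ : ℝ) (h : X → ℝ) (k : X → ℂ) : Prop where
  base : k S.base = 1
  osc : S.COscLe (S.apt s₀) h k (S.gap s₀ / 8)

theorem IsClose.norm_sub_le {s₀ l : ℝ} {h : X → ℝ} (hh : S.IsPerron s₀ l h) {k : X → ℂ}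
    (hk : S.IsClose s₀ h k) (x : X) : ‖k x - h x‖ ≤ S.gap s₀ / 8 * h x := by
  have h1 := hk.osc.sub (COscLe.self (S.apt s₀) h)
  rw [add_zero] at h1
  exact h1.norm_le hh.base hh.cone.1 (by simp [hk.base, hh.base]) x

theorem IsClose.bdd {s₀ l : ℝ} (hs₀ : 1 < s₀) {h : X → ℝ} (hh : S.IsPerron s₀ l h) {k : X → ℂ}
    (hk : S.IsClose s₀ h k) : Bdd k := by
  refine hh.bdd_of_norm_le hs₀ (A := S.gap s₀ / 8 + 1) fun x => ?_
  calc ‖k x‖ = ‖(k x - h x) + h x‖ := by ring_nf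
    _ ≤ S.gap s₀ / 8 * h x + h x := (norm_add_le _ _).trans (add_le_add (hk.norm_sub_le hh x) (by
        rw [Complex.norm_real, Real.norm_of_nonneg (hh.cone.1 x)]))
    _ = _ := by ring

theorem IsClose.osc_Ls {s₀ l ε : ℝ} (hs₀ : 1 < s₀) {h : X → ℝ} (hh : S.IsPerron s₀ l h)
    {s : ℂ} (hn : S.IsNear s₀ l h s ε) {k : X → ℂ} (hk : S.IsClose s₀ h k) :
    S.COscLe (S.apt s₀) h (S.Ls l s k) ((1 - S.gap s₀ + ε) * (S.gap s₀ / 8) + ε) ∧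
      ‖S.Ls l s k S.base - 1‖ ≤ (1 + ε) * (S.gap s₀ / 8) + ε := by
  have h1 : S.COscLe (S.apt s₀) h (fun x => k x - h x) (S.gap s₀ / 8) := by
    simpa using hk.osc.sub (COscLe.self (S.apt s₀) h)
  have h0 : k S.base - h S.base = 0 := by simp [hk.base, hh.base]
  obtain ⟨k1, k2⟩ := hn.osc_Ls hs₀ hh h1 h0
  have hfb := hh.bdd_of_norm_le hs₀ (hk.norm_sub_le hh)
  have hhb : Bdd fun x => (h x : ℂ) := by
    obtain ⟨B, hB⟩ := hh.bdd hs₀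
    exact ⟨B, fun x => by rw [Complex.norm_real]; exact hB x⟩
  have e : ∀ x, S.Ls l s k x = S.Ls l s (fun x => k x - h x) x
      + ((S.Ls l s (fun x => (h x : ℂ)) x - S.Ls l s₀ (fun x => (h x : ℂ)) x) + h x) := fun x => by
    rw [hh.Ls_self, sub_add_cancel, ← Ls_add hn.re hfb hhb]
    simp
  constructor
  · have := k1.add (hn.osc_h.add (COscLe.self (S.apt s₀) h))
    convert this using 1
    · funext x; exact e x
    · ring
  · calc ‖S.Ls l s k S.base - 1‖ = ‖S.Ls l s (fun x => k x - h x) S.base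
          + (S.Ls l s (fun x => (h x : ℂ)) S.base - S.Ls l s₀ (fun x => (h x : ℂ)) S.base)‖ := by
          rw [e, hh.base]; congr 1; push_cast; ring
      _ ≤ _ := (norm_add_le _ _).trans (add_le_add k2 hn.base_h)

variable (S) in
/-- The size of perturbation under which the projective action still contracts. -/
noncomputable def tol (s₀ : ℝ) : ℝ := S.gap s₀ ^ 2 / 64

theorem one_sub_le_norm_base {s₀ l : ℝ} (hs₀ : 1 < s₀) {h : X → ℝ} (hh : S.IsPerron s₀ l h)
    {s : ℂ} (hn : S.IsNear s₀ l h s (S.tol s₀)) {k : X → ℂ} (hk : S.IsClose s₀ h k) :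
    1 - S.gap s₀ / 4 ≤ ‖S.Ls l s k S.base‖ ∧ ‖S.Ls l s k S.base - 1‖ ≤ S.gap s₀ / 4 := by
  have h1 := (hk.osc_Ls hs₀ hh hn).2
  have g0 := S.gap_pos (zero_le_one.trans hs₀.le)
  have g1 := S.gap_lt_one (zero_le_one.trans hs₀.le)
  set δ := S.gap s₀
  have h3 : ‖S.Ls l s k S.base - 1‖ ≤ δ / 4 := by
    refine h1.trans ?_
    rw [tol]
    nlinarith [mul_pos g0 g0, mul_pos (mul_pos g0 g0) g0]
  refine ⟨?_, h3⟩
  have h4 : ‖(1 : ℂ)‖ - ‖1 - S.Ls l s k S.base‖ ≤ ‖S.Ls l s k S.base‖ := by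
    have := norm_sub_norm_le (1 : ℂ) (1 - S.Ls l s k S.base)
    simpa using this
  rw [norm_one, norm_sub_rev] at h4
  linarith

theorem IsClose.proj {s₀ l : ℝ} (hs₀ : 1 < s₀) {h : X → ℝ} (hh : S.IsPerron s₀ l h)
    {s : ℂ} (hn : S.IsNear s₀ l h s (S.tol s₀)) {k : X → ℂ} (hk : S.IsClose s₀ h k) :
    S.IsClose s₀ h (S.proj l s k) := by
  obtain ⟨q1, -⟩ := one_sub_le_norm_base hs₀ hh hn hk
  have g0 := S.gap_pos (zero_le_one.trans hs₀.le)
  have g1 := S.gap_lt_one (zero_le_one.trans hs₀.le)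
  have hq0 : 0 < ‖S.Ls l s k S.base‖ := by linarith
  refine ⟨div_self (norm_pos_iff.mp hq0), ?_⟩
  have h1 := (hk.osc_Ls hs₀ hh hn).1.const_mul (S.Ls l s k S.base)⁻¹
  have h2 : (fun x => (S.Ls l s k S.base)⁻¹ * S.Ls l s k x) = S.proj l s k := by
    funext x; rw [ContractingSystem.proj, div_eq_inv_mul]
  rw [h2] at h1
  refine h1.mono ?_
  rw [norm_inv, inv_mul_le_iff₀ hq0]
  set δ := S.gap s₀
  calc (1 - δ + S.tol s₀) * (δ / 8) + S.tol s₀ ≤ (1 - δ / 4) * (δ / 8) := by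
        rw [tol]
        nlinarith [mul_pos g0 g0, mul_pos (mul_pos g0 g0) g0]
    _ ≤ _ := mul_le_mul_of_nonneg_right q1 (by positivity)

/-- The projective action of a nearby transfer operator is a contraction. -/
theorem proj_contract {s₀ l τ : ℝ} (hs₀ : 1 < s₀) {h : X → ℝ} (hh : S.IsPerron s₀ l h)
    {s : ℂ} (hn : S.IsNear s₀ l h s (S.tol s₀)) {k k' : X → ℂ} (hk : S.IsClose s₀ h k)
    (hk' : S.IsClose s₀ h k') (hτ : S.COscLe (S.apt s₀) h (fun x => k x - k' x) τ) :
    S.COscLe (S.apt s₀) h (fun x => S.proj l s k x - S.proj l s k' x) ((1 - S.gap s₀ / 2) * τ) ∧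
      ‖S.Ls l s k S.base - S.Ls l s k' S.base‖ ≤ 2 * τ := by
  obtain ⟨q1, -⟩ := one_sub_le_norm_base hs₀ hh hn hk
  obtain ⟨q1', -⟩ := one_sub_le_norm_base hs₀ hh hn hk'
  have g0 := S.gap_pos (zero_le_one.trans hs₀.le)
  have g1 := S.gap_lt_one (zero_le_one.trans hs₀.le)
  have hq0 : 0 < ‖S.Ls l s k S.base‖ := by linarith
  have hq0' : 0 < ‖S.Ls l s k' S.base‖ := by linarith
  have hτ0 := hτ.nonneg hh.base
  have hb0 : k S.base - k' S.base = 0 := by rw [hk.base, hk'.base, sub_self]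
  obtain ⟨k1, k2⟩ := hn.osc_Ls hs₀ hh hτ hb0
  have hsub : ∀ x, S.Ls l s (fun x => k x - k' x) x = S.Ls l s k x - S.Ls l s k' x := fun x => by
    rw [eq_sub_iff_add_eq, ← Ls_add hn.re
      (hh.bdd_of_norm_le hs₀ (hτ.norm_le hh.base hh.cone.1 hb0)) (hk'.bdd hs₀ hh)]
    simp
  have hqq : ‖S.Ls l s k S.base - S.Ls l s k' S.base‖ ≤ (1 + S.tol s₀) * τ := by
    rw [← hsub]; exact k2
  have ht : S.tol s₀ ≤ S.gap s₀ / 64 := by rw [tol]; nlinarith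
  constructor
  · have h1 := (k1.sub ((hk'.proj hs₀ hh hn).osc.const_mul
      (S.Ls l s k S.base - S.Ls l s k' S.base))).const_mul (S.Ls l s k S.base)⁻¹
    have e : (fun x => (S.Ls l s k S.base)⁻¹ * (S.Ls l s (fun x => k x - k' x) x
        - (S.Ls l s k S.base - S.Ls l s k' S.base) * S.proj l s k' x))
        = fun x => S.proj l s k x - S.proj l s k' x := by
      funext x
      have a1 := norm_pos_iff.mp hq0
      have a2 := norm_pos_iff.mp hq0'
      rw [hsub, ContractingSystem.proj, ContractingSystem.proj]
      field_simp
      ring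
    rw [e] at h1
    refine h1.mono ?_
    rw [norm_inv, inv_mul_le_iff₀ hq0]
    set δ := S.gap s₀
    calc (1 - δ + S.tol s₀) * τ + ‖S.Ls l s k S.base - S.Ls l s k' S.base‖ * (δ / 8)
        ≤ (1 - δ + S.tol s₀) * τ + (1 + S.tol s₀) * τ * (δ / 8) := by gcongr
      _ = (1 - δ + S.tol s₀ + (1 + S.tol s₀) * (δ / 8)) * τ := by ring
      _ ≤ ((1 - δ / 4) * (1 - δ / 2)) * τ := by
          refine mul_le_mul_of_nonneg_right ?_ hτ0
          nlinarith [mul_pos g0 g0]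
      _ = (1 - δ / 4) * ((1 - δ / 2) * τ) := by ring
      _ ≤ _ := mul_le_mul_of_nonneg_right q1 (mul_nonneg (by linarith) hτ0)
  · refine hqq.trans (mul_le_mul_of_nonneg_right ?_ hτ0)
    linarith

variable (S) in
/-- The iterates of the projective action, starting from `h`. -/
noncomputable def orbit (l : ℝ) (h : X → ℝ) (s : ℂ) (N : ℕ) : X → ℂ :=
  (S.proj l s)^[N] fun x => (h x : ℂ)

theorem orbit_succ (l : ℝ) (h : X → ℝ) (s : ℂ) (N : ℕ) :
    S.orbit l h s (N + 1) = S.proj l s (S.orbit l h s N) := Function.iterate_succ_apply' _ _ _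

theorem isClose_orbit {s₀ l : ℝ} (hs₀ : 1 < s₀) {h : X → ℝ} (hh : S.IsPerron s₀ l h)
    {s : ℂ} (hn : S.IsNear s₀ l h s (S.tol s₀)) (N : ℕ) : S.IsClose s₀ h (S.orbit l h s N) := by
  induction N with
  | zero =>
    refine ⟨by simp [orbit, hh.base], (COscLe.self _ h).mono ?_⟩
    have := S.gap_pos (zero_le_one.trans hs₀.le)
    positivity
  | succ N ih => rw [orbit_succ]; exact ih.proj hs₀ hh hn

theorem osc_orbit_sub {s₀ l : ℝ} (hs₀ : 1 < s₀) {h : X → ℝ} (hh : S.IsPerron s₀ l h)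
    {s : ℂ} (hn : S.IsNear s₀ l h s (S.tol s₀)) (N : ℕ) :
    S.COscLe (S.apt s₀) h (fun x => S.orbit l h s (N + 1) x - S.orbit l h s N x)
      ((1 - S.gap s₀ / 2) ^ N * (S.gap s₀ / 8)) := by
  induction N with
  | zero =>
    have := (isClose_orbit hs₀ hh hn 1).osc.sub (COscLe.self (S.apt s₀) h)
    rw [add_zero] at this
    rw [pow_zero, one_mul]
    exact this
  | succ N ih =>
    have := (proj_contract hs₀ hh hn (isClose_orbit hs₀ hh hn (N + 1))
      (isClose_orbit hs₀ hh hn N) ih).1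
    rw [← orbit_succ, ← orbit_succ] at this
    rwa [pow_succ', mul_assoc]

open Filter Topology

theorem exists_tendsto_orbit {s₀ l : ℝ} (hs₀ : 1 < s₀) {h : X → ℝ} (hh : S.IsPerron s₀ l h)
    {s : ℂ} (hn : S.IsNear s₀ l h s (S.tol s₀)) (x : X) :
    ∃ z, Tendsto (fun N => S.orbit l h s N x) atTop (𝓝 z) := by
  have g0 := S.gap_pos (zero_le_one.trans hs₀.le)
  apply cauchySeq_tendsto_of_complete
  refine cauchySeq_of_le_geometric (1 - S.gap s₀ / 2) (S.gap s₀ / 8 * h x) (by linarith)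
    fun N => ?_
  rw [dist_comm, dist_eq_norm]
  refine ((osc_orbit_sub hs₀ hh hn N).norm_le hh.base hh.cone.1 ?_ x).trans (le_of_eq (by ring))
  rw [(isClose_orbit hs₀ hh hn N).base, (isClose_orbit hs₀ hh hn (N + 1)).base, sub_self]

variable (S) in
/-- The multipliers of the projective iteration; they approximate the perturbed eigenvalue. -/
noncomputable def multiplier (l : ℝ) (h : X → ℝ) (N : ℕ) (s : ℂ) : ℂ :=
  S.Ls l s (S.orbit l h s N) S.base

theorem norm_multiplier_sub_le {s₀ l : ℝ} (hs₀ : 1 < s₀) {h : X → ℝ} (hh : S.IsPerron s₀ l h)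
    {s : ℂ} (hn : S.IsNear s₀ l h s (S.tol s₀)) (N : ℕ) :
    ‖S.multiplier l h (N + 1) s - S.multiplier l h N s‖
      ≤ S.gap s₀ / 4 * (1 - S.gap s₀ / 2) ^ N :=
  (proj_contract hs₀ hh hn (isClose_orbit hs₀ hh hn (N + 1))
    (isClose_orbit hs₀ hh hn N) (osc_orbit_sub hs₀ hh hn N)).2.trans (le_of_eq (by ring))

theorem differentiableOn_Ls {l s₁ B : ℝ} (hs₁ : 1 < s₁) {U : Set ℂ} (hU : IsOpen U)
    (hre : ∀ s ∈ U, s₁ ≤ s.re) {f : ℂ → X → ℂ} (hB : ∀ s ∈ U, ∀ x, ‖f s x‖ ≤ B)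
    (hf : ∀ x, DifferentiableOn ℂ (fun s => f s x) U) (x : X) :
    DifferentiableOn ℂ (fun s => S.Ls l s (f s) x) U := by
  refine DifferentiableOn.const_mul ?_ _
  refine Complex.differentiableOn_tsum_of_summable_norm
    (u := fun i => Real.exp (-s₁ * S.len i x) * B) ((S.summable_exp hs₁ x).mul_right B)
    (fun i => ?_) hU fun i s hs => ?_
  · refine DifferentiableOn.mul ?_ (hf _)
    exact ((differentiable_id.neg.mul_const _).cexp).differentiableOn
  · rw [norm_mul, S.norm_cexp]
    exact mul_le_mul (S.exp_le_exp_of_le (hre s hs) i x) (hB s hs _) (norm_nonneg _)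
      (Real.exp_pos _).le

theorem norm_orbit_le {s₀ l : ℝ} (hs₀ : 1 < s₀) {h : X → ℝ} (hh : S.IsPerron s₀ l h)
    {s : ℂ} (hn : S.IsNear s₀ l h s (S.tol s₀)) (N : ℕ) (x : X) :
    ‖S.orbit l h s N x‖ ≤ 2 * Real.exp ((S.apt s₀ - 1) * S.diam) := by
  have g1 := S.gap_lt_one (zero_le_one.trans hs₀.le)
  have ha := S.one_le_apt (zero_le_one.trans hs₀.le)
  have h1 := (isClose_orbit hs₀ hh hn N).norm_sub_le hh x
  have h2 := hh.cone.le_diam (sub_nonneg.mpr ha) x S.base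
  rw [hh.base, mul_one] at h2
  have h0 := hh.cone.1 x
  calc ‖S.orbit l h s N x‖ = ‖(S.orbit l h s N x - h x) + h x‖ := by ring_nf
    _ ≤ S.gap s₀ / 8 * h x + h x := (norm_add_le _ _).trans (add_le_add h1 (by
        rw [Complex.norm_real, Real.norm_of_nonneg h0]))
    _ ≤ _ := by nlinarith

theorem differentiableOn_orbit {s₀ l s₁ : ℝ} (hs₀ : 1 < s₀) {h : X → ℝ}
    (hh : S.IsPerron s₀ l h) (hs₁ : 1 < s₁) {U : Set ℂ} (hU : IsOpen U)
    (hre : ∀ s ∈ U, s₁ ≤ s.re) (hn : ∀ s ∈ U, S.IsNear s₀ l h s (S.tol s₀)) (N : ℕ) (x : X) :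
    DifferentiableOn ℂ (fun s => S.orbit l h s N x) U := by
  induction N generalizing x with
  | zero => exact differentiableOn_const _
  | succ N ih =>
    simp only [orbit_succ]
    have hd := differentiableOn_Ls (S := S) (l := l) hs₁ hU hre
      (fun s hs x => norm_orbit_le hs₀ hh (hn s hs) N x) ih
    refine (hd x).div (hd S.base) fun s hs => ?_
    obtain ⟨q1, -⟩ := one_sub_le_norm_base hs₀ hh (hn s hs) (isClose_orbit hs₀ hh (hn s hs) N)
    have g1 := S.gap_lt_one (zero_le_one.trans hs₀.le)
    exact norm_pos_iff.mp (by linarith)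

theorem orbit_ofReal (l : ℝ) (h : X → ℝ) (s : ℝ) (N : ℕ) :
    ∃ k : X → ℝ, S.orbit l h s N = fun x => (k x : ℂ) := by
  induction N with
  | zero => exact ⟨h, rfl⟩
  | succ N ih =>
    obtain ⟨k, hk⟩ := ih
    refine ⟨fun x => (l⁻¹ * S.T s k x) / (l⁻¹ * S.T s k S.base), ?_⟩
    rw [orbit_succ, hk]
    funext x
    rw [proj, Ls, Ls, S.Tc_ofReal, S.Tc_ofReal]
    push_cast
    rfl

/-- Near a real parameter there is a holomorphic function whose values at real parameters belong
to positive eigenfunctions. -/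
theorem IsPerron.exists_holomorphic {s₀ l : ℝ} (hs₀ : 1 < s₀) {h : X → ℝ}
    (hh : S.IsPerron s₀ l h) :
    ∃ r > 0, ∃ Q : ℂ → ℂ, DifferentiableOn ℂ Q (Metric.ball (s₀ : ℂ) r) ∧
      ∀ s : ℝ, (s : ℂ) ∈ Metric.ball (s₀ : ℂ) r → 1 < s ∧
        ∃ (f : X → ℝ) (c B : ℝ), 0 < c ∧ (∀ x, c ≤ f x) ∧ (∀ x, f x ≤ B) ∧
          ∀ x, S.T s f x = (Q s).re * f x := by
  obtain ⟨C, hC0, hC⟩ := hh.exists_isNear hs₀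
  have g0 := S.gap_pos (zero_le_one.trans hs₀.le)
  have g1 := S.gap_lt_one (zero_le_one.trans hs₀.le)
  have hl : (l : ℂ) ≠ 0 := by exact_mod_cast hh.pos.ne'
  have ht0 : 0 < S.tol s₀ := by rw [tol]; positivity
  -- radius on which the perturbation bounds hold with error at most `S.tol s₀`
  set r := min ((s₀ - 1) / 4) (S.tol s₀ / (C + 1)) with hr
  have hr0 : 0 < r := lt_min (by linarith) (by positivity)
  have hnear : ∀ s ∈ Metric.ball (s₀ : ℂ) r, S.IsNear s₀ l h s (S.tol s₀) := by
    intro s hs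
    rw [mem_ball_iff_norm] at hs
    refine (hC s (hs.le.trans (min_le_left _ _))).mono hh.base ?_
    have h1 : ‖s - s₀‖ ≤ S.tol s₀ / (C + 1) := hs.le.trans (min_le_right _ _)
    rw [le_div_iff₀ (by linarith)] at h1
    nlinarith [norm_nonneg (s - s₀)]
  have hre : ∀ s ∈ Metric.ball (s₀ : ℂ) r, (s₀ + 1) / 2 ≤ s.re := by
    intro s hs
    rw [mem_ball_iff_norm] at hs
    have h1 := neg_le_of_abs_le ((Complex.abs_re_le_norm (s - s₀)).trans
      (hs.le.trans (min_le_left _ _)))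
    simp only [Complex.sub_re, Complex.ofReal_re] at h1
    linarith
  have hs₁ : 1 < (s₀ + 1) / 2 := by linarith
  have hmd : ∀ N, DifferentiableOn ℂ (S.multiplier l h N) (Metric.ball (s₀ : ℂ) r) := fun N =>
    differentiableOn_Ls hs₁ Metric.isOpen_ball hre
      (fun s hs x => norm_orbit_le hs₀ hh (hnear s hs) N x)
      (fun x => differentiableOn_orbit hs₀ hh hs₁ Metric.isOpen_ball hre hnear N x) S.base
  set u : ℕ → ℝ := fun N => S.gap s₀ / 4 * (1 - S.gap s₀ / 2) ^ N with hu
  have husum : Summable u :=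
    (summable_geometric_of_lt_one (by linarith) (by linarith)).mul_left _
  set q : ℂ → ℂ := fun s => S.multiplier l h 0 s
    + ∑' N, (S.multiplier l h (N + 1) s - S.multiplier l h N s) with hq
  have hqd : DifferentiableOn ℂ q (Metric.ball (s₀ : ℂ) r) := by
    refine (hmd 0).add (Complex.differentiableOn_tsum_of_summable_norm husum
      (fun N => (hmd (N + 1)).sub (hmd N)) Metric.isOpen_ball fun N s hs => ?_)
    exact norm_multiplier_sub_le hs₀ hh (hnear s hs) N
  have hqlim : ∀ s ∈ Metric.ball (s₀ : ℂ) r,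
      Tendsto (fun N => S.multiplier l h N s) atTop (𝓝 (q s)) := by
    intro s hs
    have h1 := (Summable.of_norm_bounded husum fun N =>
      norm_multiplier_sub_le hs₀ hh (hnear s hs) N).hasSum.tendsto_sum_nat.const_add
      (S.multiplier l h 0 s)
    refine h1.congr fun N => ?_
    rw [Finset.sum_range_sub (fun N => S.multiplier l h N s)]
    ring
  refine ⟨r, hr0, fun s => l * q s, hqd.const_mul _, fun s hs => ?_⟩
  have hn := hnear s hs
  have hs1 : 1 < s := by simpa using hn.re
  refine ⟨hs1, ?_⟩
  choose k hk using fun x => exists_tendsto_orbit hs₀ hh hn x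
  -- for real `s` the projective iteration stays real, and close to `h`, hence positive
  choose κ hκ using fun N => orbit_ofReal (S := S) l h s N
  have hlim : ∀ x, Tendsto (fun N => κ N x) atTop (𝓝 (k x).re) := fun x => by
    have := (Complex.continuous_re.tendsto _).comp (hk x)
    refine this.congr fun N => ?_
    simp only [Function.comp, hκ, Complex.ofReal_re]
  have hκh : ∀ N x, |κ N x - h x| ≤ S.gap s₀ / 8 * h x := fun N x => by
    have h1 := (isClose_orbit hs₀ hh hn N).norm_sub_le hh x
    rw [hκ] at h1
    simpa only [← Complex.ofReal_sub, Complex.norm_real, Real.norm_eq_abs] using h1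
  have hlow : ∀ N x, h x / 2 ≤ κ N x := fun N x => by
    have h1 := neg_le_of_abs_le (hκh N x)
    have h2 := hh.cone.1 x
    nlinarith
  have hupp : ∀ N x, κ N x ≤ 2 * h x := fun N x => by
    have h1 := le_of_abs_le (hκh N x)
    have h2 := hh.cone.1 x
    nlinarith
  obtain ⟨B, hB⟩ := hh.bdd hs₀
  have hB' : ∀ x, h x ≤ B := fun x => (le_abs_self _).trans (hB x)
  refine ⟨fun x => (k x).re, Real.exp (-((S.apt s₀ - 1) * S.diam)) / 2, 2 * B,
    by positivity, fun x => ?_, fun x => ?_, fun x => ?_⟩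
  · refine ge_of_tendsto' (hlim x) fun N => (?_ : _ ≤ h x / 2).trans (hlow N x)
    have := hh.exp_le_apply hs₀ x
    linarith
  · refine le_of_tendsto' (hlim x) fun N => (hupp N x).trans ?_
    have := hB' x
    linarith
  · have h1 : Tendsto (fun N => S.T s (κ N) x) atTop (𝓝 (S.T s (fun x => (k x).re) x)) := by
      refine tendsto_T hs1 (B := 2 * B) (fun N y => ?_) hlim x
      have a1 := hlow N y
      have a2 := hupp N y
      have a3 := hh.cone.1 y
      have a4 := hB' y
      rw [abs_le]
      constructor <;> linarith
    refine tendsto_nhds_unique h1 ?_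
    have h2 : Tendsto (fun N => (l * S.multiplier l h N s).re * κ (N + 1) x) atTop
        (𝓝 ((l * q s).re * (k x).re)) :=
      ((Complex.continuous_re.tendsto _).comp ((hqlim s hs).const_mul _)).mul
        ((tendsto_add_atTop_iff_nat 1).mpr (hlim x))
    refine h2.congr fun N => ?_
    have hq0 : S.multiplier l h N s ≠ 0 := by
      obtain ⟨q1, -⟩ := one_sub_le_norm_base hs₀ hh hn (isClose_orbit hs₀ hh hn N)
      exact norm_pos_iff.mp (by rw [multiplier]; linarith)
    have e : (S.T s (κ N) x : ℂ) = l * S.multiplier l h N s * (κ (N + 1) x : ℝ) := by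
      have e1 : (κ (N + 1) x : ℂ) = S.orbit l h s (N + 1) x := by rw [hκ]
      have e2 : S.orbit l h s (N + 1) x = S.Ls l s (S.orbit l h s N) x / S.multiplier l h N s := by
        rw [orbit_succ]; rfl
      rw [e1, e2, mul_assoc, mul_div_cancel₀ _ hq0, Ls, mul_inv_cancel_left₀ hl, hκ, S.Tc_ofReal]
    have e3 := congr_arg Complex.re e
    rw [Complex.ofReal_re, Complex.re_mul_ofReal] at e3
    exact e3.symm

/-- The eigenvalue of a positive eigenfunction depends analytically on the parameter. -/
theorem analyticOnNhd_of_isPerron {lam : ℝ → ℝ} {h : ℝ → X → ℝ}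
    (hh : ∀ s, 1 < s → S.IsPerron s (lam s) (h s)) : AnalyticOnNhd ℝ lam (Set.Ioi 1) := by
  intro s₀ hs₀
  obtain ⟨r, hr0, Q, hQ, hQs⟩ := (hh s₀ hs₀).exists_holomorphic hs₀
  have hQa : AnalyticAt ℂ Q s₀ :=
    hQ.analyticAt (Metric.isOpen_ball.mem_nhds (Metric.mem_ball_self hr0))
  have h1 : AnalyticAt ℝ (fun s : ℝ => (Q s).re) s₀ := hQa.re_ofReal
  refine h1.congr ?_
  have hnhd : ∀ᶠ s : ℝ in 𝓝 s₀, (s : ℂ) ∈ Metric.ball (s₀ : ℂ) r :=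
    Complex.continuous_ofReal.continuousAt.eventually
      (Metric.isOpen_ball.mem_nhds (Metric.mem_ball_self hr0))
  filter_upwards [hnhd] with s hs
  obtain ⟨hs1, f, c, B, hc, hcf, hfB, ef⟩ := hQs s hs
  have hP := hh s hs1
  obtain ⟨B', hB'⟩ := hP.bdd hs1
  have hfpos : ∀ x, 0 < f x := fun x => hc.trans_le (hcf x)
  have hfb : Bdd f := ⟨B, fun x => by rw [Real.norm_of_nonneg (hfpos x).le]; exact hfB x⟩
  have hQpos : 0 < (Q s).re := by
    have := S.T_pos hs1 hfb hfpos S.base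
    rw [ef] at this
    exact pos_of_mul_pos_left this (hfpos _).le
  refine le_antisymm ?_ ?_
  · exact eigenvalue_le hs1 hP.pos (Real.exp_pos _) hfpos hfB (hP.exp_le_apply hs1) (hP.bdd hs1)
      (fun x => (ef x).ge) fun x => (hP.eigen x).le
  · exact eigenvalue_le hs1 hQpos hc (hP.apply_pos hs1)
      (fun x => (le_abs_self _).trans (hB' x)) hcf hfb (fun x => (hP.eigen x).ge)
      fun x => (ef x).le

/-- If all expansion rates are at least `r`, the eigenvalues decay at least exponentially. -/
theorem IsPerron.le_exp_mul {s t r l l' : ℝ} (hs : 1 < s) (hst : s ≤ t)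
    (hr : ∀ i x, r ≤ S.len i x) {h h' : X → ℝ} (hh : S.IsPerron s l h)
    (hh' : S.IsPerron t l' h') : l' ≤ Real.exp (-((t - s) * r)) * l := by
  have ht := hs.trans_le hst
  obtain ⟨B', hB'⟩ := hh'.bdd ht
  refine eigenvalue_le ht (mul_pos (Real.exp_pos _) hh.pos) (Real.exp_pos _) (hh'.apply_pos ht)
    (fun x => (le_abs_self _).trans (hB' x)) (hh.exp_le_apply hs) (hh.bdd hs)
    (fun x => (hh'.eigen x).ge) fun x => ?_
  rw [mul_assoc, ← hh.eigen, T, T, ← tsum_mul_left]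
  refine (S.summable_T ht (hh.bdd hs) x).tsum_le_tsum (fun i => ?_)
    ((S.summable_T hs (hh.bdd hs) x).mul_left _)
  rw [← mul_assoc, ← Real.exp_add]
  refine mul_le_mul_of_nonneg_right (Real.exp_le_exp.mpr ?_) (hh.cone.1 _)
  have := mul_le_mul_of_nonneg_left (hr i x) (sub_nonneg.mpr hst)
  linarith

end ContractingSystem

/-! ### The Markoff-Hurwitz branches as a contracting system -/

namespace MarkoffHurwitz

variable {m : ℕ}

theorem gamma_castSucc (j : Fin (m + 3)) (y : Fin (m + 3) → ℝ) (i : Fin (m + 2)) :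
    gamma j y i.castSucc = y (j.succAbove i) := by
  simp [gamma]

theorem gamma_last {j : Fin (m + 3)} {y : Fin (m + 3) → ℝ}
    (hy : ∑ i : Fin (m + 2), y i.castSucc = y (Fin.last (m + 2))) :
    gamma j y (Fin.last (m + 2)) = 2 * y (Fin.last (m + 2)) - y j := by
  have h1 := Fin.sum_univ_succAbove y j
  have h2 := Fin.sum_univ_castSucc y
  have h3 : gamma j y (Fin.last (m + 2)) = ∑ i : Fin (m + 2), y (j.succAbove i) := by
    simp [gamma]
  rw [h3]
  linarith

theorem sum_gamma (j : Fin (m + 3)) (y : Fin (m + 3) → ℝ) :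
    ∑ i : Fin (m + 2), gamma j y i.castSucc = gamma j y (Fin.last (m + 2)) := by
  simp [gamma]

theorem succAbove_last_of_castSucc (j : Fin (m + 2)) :
    j.castSucc.succAbove (Fin.last (m + 1)) = Fin.last (m + 2) := by
  rw [Fin.succAbove_of_le_castSucc _ _ (by
    rw [Fin.castSucc_le_castSucc_iff]; exact Fin.le_last j)]
  simp

/-- The coordinates of `γ_{n-1}^A γ_j y`, for `y` in the hyperplane. -/
theorem branch_apply (j : Fin (m + 1)) (A : ℕ) {y : Fin (m + 3) → ℝ}
    (hy : ∑ i : Fin (m + 2), y i.castSucc = y (Fin.last (m + 2))) :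
    (∀ i : Fin (m + 1), branch (j, A) y i.castSucc.castSucc
        = y (j.castSucc.succAbove i).castSucc) ∧
      branch (j, A) y (Fin.last (m + 1)).castSucc
        = y (Fin.last (m + 2)) + A * (y (Fin.last (m + 2)) - y j.castSucc.castSucc) ∧
      branch (j, A) y (Fin.last (m + 2))
        = y (Fin.last (m + 2)) + (A + 1) * (y (Fin.last (m + 2)) - y j.castSucc.castSucc) ∧
      ∑ i : Fin (m + 2), branch (j, A) y i.castSucc = branch (j, A) y (Fin.last (m + 2)) := by
  induction A with
  | zero =>
    have h0 : branch (j, 0) y = gamma j.castSucc.castSucc y := rfl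
    rw [h0]
    refine ⟨fun i => ?_, ?_, ?_, sum_gamma _ _⟩
    · rw [gamma_castSucc, Fin.castSucc_succAbove_castSucc]
    · rw [gamma_castSucc, succAbove_last_of_castSucc]; simp
    · rw [gamma_last hy]; push_cast; ring
  | succ A ih =>
    obtain ⟨h1, h2, h3, h4⟩ := ih
    have h0 : branch (j, A + 1) y = gamma (Fin.last (m + 1)).castSucc (branch (j, A) y) := by
      simp only [branch, Function.iterate_succ_apply']
    rw [h0]
    refine ⟨fun i => ?_, ?_, ?_, sum_gamma _ _⟩
    · rw [gamma_castSucc, Fin.castSucc_succAbove_castSucc, Fin.succAbove_last, h1]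
    · rw [gamma_castSucc, succAbove_last_of_castSucc, h3]; push_cast; ring
    · rw [gamma_last h4, h3, h2]; push_cast; ring

/-- The `i`-th coordinate of a point of the simplex, for `1 ≤ i ≤ n - 1`. -/
def coord (w : Delta m) (i : Fin (m + 2)) : ℝ := w.1 i.castSucc

theorem coord_nonneg (w : Delta m) (i : Fin (m + 2)) : 0 ≤ coord w i := w.2.1.1 _

theorem last_eq_one (w : Delta m) : w.1 (Fin.last (m + 2)) = 1 := w.2.2

theorem sum_coord (w : Delta m) : ∑ i, coord w i = 1 := by
  have := w.2.1.2.2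
  rw [last_eq_one] at this
  exact this

theorem coord_mono (w : Delta m) {i j : Fin (m + 2)} (h : i ≤ j) : coord w i ≤ coord w j :=
  w.2.1.2.1 (Fin.castSucc_le_castSucc_iff.mpr h)

theorem coord_le_half (w : Delta m) (j : Fin (m + 1)) : coord w j.castSucc ≤ 1 / 2 := by
  have h1 := coord_mono w (Fin.le_last j.castSucc)
  have h2 := sum_coord w
  rw [Fin.sum_univ_castSucc] at h2
  have h3 := Finset.single_le_sum (f := fun i : Fin (m + 1) => coord w i.castSucc)
    (fun i _ => coord_nonneg w _) (Finset.mem_univ j)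
  linarith

/-- The last coordinate of `γ_{n-1}^A γ_j w`. -/
def height (p : Fin (m + 1) × ℕ) (w : Delta m) : ℝ := 1 + (p.2 + 1) * (1 - coord w p.1.castSucc)

theorem branch_last (p : Fin (m + 1) × ℕ) (w : Delta m) :
    branch p w.1 (Fin.last (m + 2)) = height p w := by
  obtain ⟨j, A⟩ := p
  rw [(branch_apply j A w.2.1.2.2).2.2.1, last_eq_one]
  rfl

theorem le_height (p : Fin (m + 1) × ℕ) (w : Delta m) : 1 + (p.2 + 1 : ℝ) / 2 ≤ height p w := by
  have h1 := coord_le_half w p.1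
  have h2 : (0 : ℝ) ≤ p.2 := Nat.cast_nonneg _
  unfold height
  nlinarith

theorem height_pos (p : Fin (m + 1) × ℕ) (w : Delta m) : 0 < height p w := by
  have h2 : (0 : ℝ) ≤ p.2 := Nat.cast_nonneg _
  linarith [le_height p w]

theorem coord_act_castSucc (p : Fin (m + 1) × ℕ) (w : Delta m) (i : Fin (m + 1)) :
    coord (act p w) i.castSucc = coord w (p.1.castSucc.succAbove i) / height p w := by
  obtain ⟨j, A⟩ := p
  have h : coord (act (j, A) w) i.castSucc = (branch (j, A) w.1 (Fin.last (m + 2)))⁻¹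
    * branch (j, A) w.1 i.castSucc.castSucc := rfl
  rw [h, branch_last, (branch_apply j A w.2.1.2.2).1, inv_mul_eq_div]
  rfl

theorem coord_act_last (p : Fin (m + 1) × ℕ) (w : Delta m) :
    coord (act p w) (Fin.last (m + 1)) = (1 + p.2 * (1 - coord w p.1.castSucc)) / height p w := by
  obtain ⟨j, A⟩ := p
  have h : coord (act (j, A) w) (Fin.last (m + 1)) = (branch (j, A) w.1 (Fin.last (m + 2)))⁻¹
    * branch (j, A) w.1 (Fin.last (m + 1)).castSucc := rfl
  rw [h, branch_last, (branch_apply j A w.2.1.2.2).2.1, inv_mul_eq_div, last_eq_one]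
  rfl

/-- The `ℓ¹`-distance of the first `n - 1` coordinates. -/
def dist1 (w w' : Delta m) : ℝ := ∑ i, |coord w i - coord w' i|

theorem dist1_nonneg (w w' : Delta m) : 0 ≤ dist1 w w' := Finset.sum_nonneg fun _ _ => abs_nonneg _

theorem dist1_comm (w w' : Delta m) : dist1 w w' = dist1 w' w :=
  Finset.sum_congr rfl fun _ _ => abs_sub_comm _ _

theorem abs_coord_sub_le (w w' : Delta m) (i : Fin (m + 2)) :
    |coord w i - coord w' i| ≤ dist1 w w' :=
  Finset.single_le_sum (f := fun i => |coord w i - coord w' i|) (fun _ _ => abs_nonneg _)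
    (Finset.mem_univ i)

theorem dist1_le_two (w w' : Delta m) : dist1 w w' ≤ 2 := by
  calc dist1 w w' ≤ ∑ i, (coord w i + coord w' i) := Finset.sum_le_sum fun i _ => by
        have h1 := coord_nonneg w i
        have h2 := coord_nonneg w' i
        rw [abs_le]
        constructor <;> linarith
    _ = 2 := by rw [Finset.sum_add_distrib, sum_coord, sum_coord]; norm_num

/-- In the `ℓ¹`-distance every branch contracts by at least its height. The difference `v` in the
omitted coordinate changes the normalization of all coordinates of the image; before the division
by the height, these changes add up to `v` exactly. -/
theorem dist1_act_le (p : Fin (m + 1) × ℕ) (w w' : Delta m) :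
    dist1 (act p w) (act p w') ≤ dist1 w w' / height p w := by
  obtain ⟨j, A⟩ := p
  set D := height (j, A) w with hD
  set D' := height (j, A) w' with hD'
  have hD0 : 0 < D := height_pos _ _
  have hD0' : 0 < D' := height_pos _ _
  have eD : D = 1 + (A + 1) * (1 - coord w j.castSucc) := rfl
  have eD' : D' = 1 + (A + 1) * (1 - coord w' j.castSucc) := rfl
  set v := |coord w j.castSucc - coord w' j.castSucc| with hv
  have hsum := Fin.sum_univ_succAbove (fun i => |coord w i - coord w' i|) j.castSucc
  have hsum' := Fin.sum_univ_succAbove (coord w') j.castSucc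
  rw [sum_coord] at hsum'
  have hd : dist1 w w' = ∑ i, |coord w i - coord w' i| := rfl
  rw [hsum, ← hv] at hd
  have hA0 : (0 : ℝ) ≤ A + 1 := by positivity
  have hterm : ∀ i : Fin (m + 1), |coord (act (j, A) w) i.castSucc - coord (act (j, A) w') i.castSucc|
      ≤ (|coord w (j.castSucc.succAbove i) - coord w' (j.castSucc.succAbove i)|
        + coord w' (j.castSucc.succAbove i) * ((A + 1) * v / D')) / D := by
    intro i
    rw [coord_act_castSucc, coord_act_castSucc]
    change |coord w (j.castSucc.succAbove i) / D - coord w' (j.castSucc.succAbove i) / D'| ≤ _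
    set a := coord w (j.castSucc.succAbove i)
    have hb : 0 ≤ coord w' (j.castSucc.succAbove i) := coord_nonneg _ _
    set b := coord w' (j.castSucc.succAbove i)
    have e : a / D - b / D'
        = ((a - b) + b * ((A + 1) * (coord w j.castSucc - coord w' j.castSucc) / D')) / D := by
      have : (A + 1 : ℝ) * (coord w j.castSucc - coord w' j.castSucc) = D' - D := by
        rw [eD, eD']; ring
      rw [this]
      field_simp
      ring
    rw [e, abs_div, abs_of_pos hD0]
    refine div_le_div_of_nonneg_right ((abs_add_le _ _).trans ?_) hD0.le
    rw [abs_mul b, abs_of_nonneg hb, abs_div, abs_mul, abs_of_nonneg hA0, abs_of_pos hD0']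
  have hlast : |coord (act (j, A) w) (Fin.last (m + 1)) - coord (act (j, A) w') (Fin.last (m + 1))|
      = v / D' / D := by
    rw [coord_act_last, coord_act_last]
    change |(1 + A * (1 - coord w j.castSucc)) / D - (1 + A * (1 - coord w' j.castSucc)) / D'| = _
    have e : (1 + A * (1 - coord w j.castSucc)) / D - (1 + A * (1 - coord w' j.castSucc)) / D'
        = (coord w j.castSucc - coord w' j.castSucc) / D' / D := by
      rw [div_sub_div _ _ hD0.ne' hD0'.ne', div_div, mul_comm D' D]
      congr 1
      rw [eD, eD']
      ring
    rw [e, abs_div, abs_div, abs_of_pos hD0, abs_of_pos hD0']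
  rw [dist1, Fin.sum_univ_castSucc, hlast]
  refine (add_le_add_left (Finset.sum_le_sum fun i _ => hterm i) _).trans ?_
  rw [← Finset.sum_div, ← add_div]
  refine div_le_div_of_nonneg_right ?_ hD0.le
  rw [Finset.sum_add_distrib, ← Finset.sum_mul, hd]
  have e1 : ∑ i : Fin (m + 1), coord w' (j.castSucc.succAbove i) = 1 - coord w' j.castSucc := by
    linarith
  rw [e1]
  have e2 : (1 - coord w' j.castSucc) * ((A + 1) * v / D') + v / D' = v := by
    have : (1 - coord w' j.castSucc) * ((A + 1) * v / D') + v / D'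
        = v * (1 + (A + 1) * (1 - coord w' j.castSucc)) / D' := by ring
    rw [this, ← eD', mul_div_assoc, div_self hD0'.ne', mul_one]
  linarith

theorem height_sub_le (p : Fin (m + 1) × ℕ) (w w' : Delta m) :
    height p w - height p w' ≤ 2 * dist1 w w' * height p w' := by
  have h1 := le_height p w'
  have h2 : (0 : ℝ) ≤ p.2 := Nat.cast_nonneg _
  have h3 := neg_le_of_abs_le (abs_coord_sub_le w w' p.1.castSucc)
  have h4 := dist1_nonneg w w'
  have h5 : height p w - height p w' = (p.2 + 1) * (coord w' p.1.castSucc - coord w p.1.castSucc) := by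
    unfold height; ring
  rw [h5]
  nlinarith

theorem log_height_sub_le (p : Fin (m + 1) × ℕ) (w w' : Delta m) :
    Real.log (height p w) - Real.log (height p w') ≤ 2 * dist1 w w' := by
  have h0 := height_pos p w
  have h0' := height_pos p w'
  rw [← Real.log_div h0.ne' h0'.ne']
  refine (Real.log_le_sub_one_of_pos (div_pos h0 h0')).trans ?_
  have := height_sub_le p w w'
  rw [div_sub_one h0'.ne', div_le_iff₀ h0']
  exact this

theorem log_height_ge (p : Fin (m + 1) × ℕ) (w : Delta m) :
    Real.log (3 / 2) ≤ Real.log (height p w) := by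
  refine Real.log_le_log (by norm_num) ?_
  have h2 : (0 : ℝ) ≤ p.2 := Nat.cast_nonneg _
  linarith [le_height p w]

theorem exp_log_height (s : ℝ) (p : Fin (m + 1) × ℕ) (w : Delta m) :
    Real.exp (-s * Real.log (height p w)) = height p w ^ (-s) := by
  rw [Real.rpow_def_of_pos (height_pos p w), mul_comm]

theorem summable_height {s : ℝ} (hs : 1 < s) (w : Delta m) :
    Summable fun p : Fin (m + 1) × ℕ => Real.exp (-s * Real.log (height p w)) := by
  have h1 : Summable fun A : ℕ => (2 : ℝ) ^ s * ((A : ℝ) + 1) ^ (-s) := by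
    refine Summable.mul_left _ ?_
    have := (summable_nat_add_iff 1).mpr (Real.summable_nat_rpow.mpr (show -s < -1 by linarith))
    simpa using this
  have h2 : Summable fun p : Fin (m + 1) × ℕ => (1 : ℝ) * ((2 : ℝ) ^ s * ((p.2 : ℝ) + 1) ^ (-s)) :=
    Summable.mul_of_nonneg (f := fun _ : Fin (m + 1) => (1 : ℝ)) Summable.of_finite h1
      (fun _ => zero_le_one) fun A => by positivity
  refine Summable.of_nonneg_of_le (fun _ => (Real.exp_pos _).le) (fun p => ?_) h2
  have hA : (0 : ℝ) < (p.2 : ℝ) + 1 := by positivity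
  rw [exp_log_height, one_mul]
  calc height p w ^ (-s) ≤ (((p.2 : ℝ) + 1) / 2) ^ (-s) :=
        Real.rpow_le_rpow_of_nonpos (by positivity) (by linarith [le_height p w]) (by linarith)
    _ = 2 ^ s * ((p.2 : ℝ) + 1) ^ (-s) := by
        rw [Real.div_rpow hA.le (by norm_num), Real.rpow_neg (by norm_num : (0 : ℝ) ≤ 2),
          div_inv_eq_mul, mul_comm]

/-- A vertex of the simplex: the point `(0, …, 0, 1, 1)`. -/
def vertex (m : ℕ) : Delta m :=
  ⟨fun i => if m + 1 ≤ (i : ℕ) then 1 else 0, ⟨fun i => by positivity, fun i j hij => by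
    simp only
    split_ifs with h1 h2
    · exact le_rfl
    · exact absurd (h1.trans hij) h2
    · exact zero_le_one
    · exact le_rfl, by
    rw [Fin.sum_univ_castSucc]
    simp
    intro x
    omega⟩, by simp⟩

/-- The branches `γ_{n-1}^A γ_j` as a contracting system on the simplex. -/
noncomputable def system (m : ℕ) : ContractingSystem (Delta m) (Fin (m + 1) × ℕ) where
  d := dist1
  diam := 2
  ratio := 2 / 3
  distortion := 2
  map := act
  len := fun p w => Real.log (height p w)
  base := vertex m
  index := (0, 0)
  d_nonneg := dist1_nonneg
  d_comm := dist1_comm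
  d_le := dist1_le_two
  ratio_nonneg := by norm_num
  ratio_lt_one := by norm_num
  distortion_nonneg := by norm_num
  d_map_le := fun p w w' => by
    refine (dist1_act_le p w w').trans ?_
    have h1 := dist1_nonneg w w'
    have h2 : (3 : ℝ) / 2 ≤ height p w := by
      have h2 : (0 : ℝ) ≤ p.2 := Nat.cast_nonneg _
      linarith [le_height p w]
    rw [div_le_iff₀ (by linarith)]
    nlinarith
  len_sub_le := log_height_sub_le
  len_nonneg := fun p w => (Real.log_nonneg (by norm_num)).trans (log_height_ge p w)
  summable_base := fun _ hs => summable_height hs _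

theorem dist_le_dist1 (w w' : Delta m) : dist w w' ≤ dist1 w w' := by
  rw [Subtype.dist_eq, dist_pi_le_iff (dist1_nonneg w w')]
  intro i
  rw [Real.dist_eq]
  refine Fin.lastCases ?_ (fun i => ?_) i
  · rw [last_eq_one, last_eq_one, sub_self, abs_zero]; exact dist1_nonneg w w'
  · exact abs_coord_sub_le w w' i

theorem continuous_coord (i : Fin (m + 2)) : Continuous fun w : Delta m => coord w i :=
  (continuous_apply _).comp continuous_subtype_val

open Filter Topology in
theorem tendsto_dist1 (w : Delta m) : Tendsto (dist1 w) (𝓝 w) (𝓝 0) := by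
  have h : Continuous (dist1 w) :=
    continuous_finsetSum _ fun i _ => (continuous_const.sub (continuous_coord i)).abs
  have := h.tendsto w
  simpa [dist1] using this

instance : CompactSpace (Delta m) := by
  rw [← isCompact_iff_compactSpace]
  have hclosed : IsClosed (Delta m) := by
    have : Delta m = {w | (∀ i, 0 ≤ w i) ∧ (∀ i j, i ≤ j → w i ≤ w j) ∧
        ∑ i : Fin (m + 2), w i.castSucc = w (Fin.last (m + 2)) ∧ w (Fin.last (m + 2)) = 1} := by
      ext w
      simp only [Delta, hyperplane, Set.mem_ofPred_eq, Monotone, and_assoc]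
    rw [this]
    simp only [Set.ofPred_and, Set.ofPred_forall]
    refine (isClosed_iInter fun i => isClosed_le continuous_const (continuous_apply i)).inter
      ((isClosed_iInter fun i => isClosed_iInter fun j => isClosed_iInter fun _ =>
        isClosed_le (continuous_apply i) (continuous_apply j)).inter
      ((isClosed_eq ?_ (continuous_apply _)).inter
        (isClosed_eq (continuous_apply _) continuous_const)))
    exact continuous_finsetSum _ fun i _ => continuous_apply _
  refine (isCompact_Icc (a := (0 : Fin (m + 3) → ℝ)) (b := 1)).of_isClosed_subset hclosed ?_
  intro w hw
  exact ⟨fun i => hw.1.1 i, fun i => (hw.1.2.1 (Fin.le_last i)).trans hw.2.le⟩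

theorem weight_eq (s : ℝ) (p : Fin (m + 1) × ℕ) (w : Delta m) :
    (w.1 (Fin.last (m + 2)) / branch p w.1 (Fin.last (m + 2))) ^ s
      = Real.exp (-s * (system m).len p w) := by
  change _ = Real.exp (-s * Real.log (height p w))
  rw [exp_log_height, last_eq_one, branch_last, one_div,
    Real.inv_rpow (height_pos p w).le, Real.rpow_neg (height_pos p w).le]

theorem transfer_real (s : ℝ) (f : Delta m → ℝ) : transfer s f = (system m).T s f := by
  funext w
  simp only [transfer, ContractingSystem.T, weight_eq, smul_eq_mul]
  rfl

theorem transfer_complex (s : ℝ) (f : Delta m → ℂ) : transfer s f = (system m).Tc s f := by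
  funext w
  simp only [transfer, ContractingSystem.Tc, weight_eq, Complex.real_smul]
  refine tsum_congr fun p => ?_
  push_cast
  rfl

end MarkoffHurwitz

/-! ### Differentiability of the eigenfunctions -/

namespace MarkoffHurwitz

variable {m : ℕ}

/-- The linear form with coefficients `b` on the first `n - 1` coordinates. -/
noncomputable def form (b : Fin (m + 2) → ℝ) : (Fin (m + 3) → ℝ) →L[ℝ] ℝ :=
  ∑ i, b i • ContinuousLinearMap.proj i.castSucc

theorem form_apply (b : Fin (m + 2) → ℝ) (v : Fin (m + 3) → ℝ) :
    form b v = ∑ i, b i * v i.castSucc := by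
  simp [form]

theorem form_coe (b : Fin (m + 2) → ℝ) (w : Delta m) : form b w.1 = ∑ i, b i * coord w i :=
  form_apply b w.1

/-- Coefficient vectors for which all values of the linear form on the simplex are comparable
with the last coefficient. The condition is chosen to be stable under all branches. -/
structure Balanced (b : Fin (m + 2) → ℝ) : Prop where
  nonneg : ∀ i, 0 ≤ b i
  pos : 0 < b (Fin.last (m + 1))
  le_add : ∀ i k, b i ≤ b (Fin.last (m + 1)) + b k

/-- The coefficients of the linear form `form b` composed with a branch. -/
def pull (p : Fin (m + 1) × ℕ) (b : Fin (m + 2) → ℝ) : Fin (m + 2) → ℝ :=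
  Fin.insertNth (α := fun _ => ℝ) p.1.castSucc (b (Fin.last (m + 1)))
    (fun i : Fin (m + 1) => b i.castSucc + (p.2 + 1) * b (Fin.last (m + 1)))

theorem pull_same (p : Fin (m + 1) × ℕ) (b : Fin (m + 2) → ℝ) :
    pull p b p.1.castSucc = b (Fin.last (m + 1)) := by
  simp [pull]

theorem pull_succAbove (p : Fin (m + 1) × ℕ) (b : Fin (m + 2) → ℝ) (i : Fin (m + 1)) :
    pull p b (p.1.castSucc.succAbove i) = b i.castSucc + (p.2 + 1) * b (Fin.last (m + 1)) := by
  simp [pull]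

/-- Since `height p w` is the last coordinate of the value of the branch, it is the factor by which
the branch and its normalization `act p` differ. -/
theorem form_pull (p : Fin (m + 1) × ℕ) (b : Fin (m + 2) → ℝ) (w : Delta m) :
    form (pull p b) w.1 = height p w * form b (act p w).1 := by
  have hD := (height_pos p w).ne'
  have hs := Fin.sum_univ_succAbove (coord w) p.1.castSucc
  rw [sum_coord] at hs
  rw [form_coe, form_coe, Fin.sum_univ_succAbove _ p.1.castSucc,
    Fin.sum_univ_castSucc fun i => b i * coord (act p w) i, coord_act_last, pull_same]
  have e0 : ∀ i : Fin (m + 1), (b i.castSucc + (p.2 + 1) * b (Fin.last (m + 1))) *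
      coord w (p.1.castSucc.succAbove i) = b i.castSucc * coord w (p.1.castSucc.succAbove i)
        + ((p.2 + 1) * b (Fin.last (m + 1))) * coord w (p.1.castSucc.succAbove i) :=
    fun i => add_mul _ _ _
  simp only [pull_succAbove, coord_act_castSucc, e0]
  rw [Finset.sum_add_distrib, ← Finset.mul_sum Finset.univ _ ((p.2 + 1) * b (Fin.last (m + 1))),
    mul_add, Finset.mul_sum Finset.univ _ (height p w)]
  have e1 : ∀ i : Fin (m + 1), height p w * (b i.castSucc *
      (coord w (p.1.castSucc.succAbove i) / height p w))
      = b i.castSucc * coord w (p.1.castSucc.succAbove i) := fun i => by field_simp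
  have e2 : height p w * (b (Fin.last (m + 1)) * ((1 + p.2 * (1 - coord w p.1.castSucc)) /
      height p w)) = b (Fin.last (m + 1)) * (1 + p.2 * (1 - coord w p.1.castSucc)) := by field_simp
  simp only [e1, e2]
  have e3 : ∑ i, coord w (p.1.castSucc.succAbove i) = 1 - coord w p.1.castSucc := by linarith
  rw [e3]
  ring

theorem Balanced.pull {b : Fin (m + 2) → ℝ} (hb : Balanced b) (p : Fin (m + 1) × ℕ) :
    Balanced (pull p b) := by
  have hlast : p.1.castSucc.succAbove (Fin.last m) = Fin.last (m + 1) := by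
    rw [Fin.succAbove_of_le_castSucc _ _ (by
      rw [Fin.castSucc_le_castSucc_iff]; exact Fin.le_last _)]
    simp
  have hl : MarkoffHurwitz.pull p b (Fin.last (m + 1))
      = b (Fin.last m).castSucc + (p.2 + 1) * b (Fin.last (m + 1)) := by
    have := pull_succAbove p b (Fin.last m)
    rwa [hlast] at this
  have hA : (0 : ℝ) ≤ p.2 := Nat.cast_nonneg _
  have hp := hb.pos
  have hAp : 0 ≤ p.2 * b (Fin.last (m + 1)) := mul_nonneg hA hp.le
  refine ⟨fun i => ?_, ?_, fun i k => ?_⟩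
  · rcases Fin.eq_self_or_eq_succAbove p.1.castSucc i with rfl | ⟨i, rfl⟩
    · rw [pull_same]; exact hp.le
    · rw [pull_succAbove]
      have := hb.nonneg i.castSucc
      positivity
  · rw [hl]
    have := hb.nonneg (Fin.last m).castSucc
    positivity
  · rw [hl]
    have h0 := hb.nonneg (Fin.last m).castSucc
    rcases Fin.eq_self_or_eq_succAbove p.1.castSucc i with rfl | ⟨i, rfl⟩ <;>
    rcases Fin.eq_self_or_eq_succAbove p.1.castSucc k with rfl | ⟨k, rfl⟩ <;>
    simp only [pull_same, pull_succAbove]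
    · nlinarith
    · have := hb.nonneg k.castSucc
      nlinarith
    · have := hb.le_add i.castSucc (Fin.last m).castSucc
      nlinarith
    · have := hb.le_add i.castSucc (Fin.last m).castSucc
      have := hb.nonneg k.castSucc
      nlinarith

theorem last_le_coord (w : Delta m) : 1 / ((m : ℝ) + 2) ≤ coord w (Fin.last (m + 1)) := by
  have h1 : ∑ i, coord w i ≤ ∑ _i : Fin (m + 2), coord w (Fin.last (m + 1)) :=
    Finset.sum_le_sum fun i _ => coord_mono w (Fin.le_last i)
  rw [sum_coord, Finset.sum_const, Finset.card_univ, Fintype.card_fin, nsmul_eq_mul] at h1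
  push_cast at h1
  rw [div_le_iff₀' (by positivity)]
  exact h1

theorem Balanced.last_le_form {b : Fin (m + 2) → ℝ} (hb : Balanced b) (w : Delta m) :
    b (Fin.last (m + 1)) ≤ (m + 2) * form b w.1 := by
  have h1 : b (Fin.last (m + 1)) * coord w (Fin.last (m + 1)) ≤ form b w.1 := by
    rw [form_coe]
    exact Finset.single_le_sum (f := fun i => b i * coord w i)
      (fun i _ => mul_nonneg (hb.nonneg i) (coord_nonneg w i)) (Finset.mem_univ _)
  have h2 := mul_le_mul_of_nonneg_left (last_le_coord w) hb.pos.le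
  have hm : (0 : ℝ) < m + 2 := by positivity
  calc b (Fin.last (m + 1)) = (m + 2) * (b (Fin.last (m + 1)) * (1 / (m + 2))) := by field_simp
    _ ≤ _ := mul_le_mul_of_nonneg_left (h2.trans h1) hm.le

theorem Balanced.form_pos {b : Fin (m + 2) → ℝ} (hb : Balanced b) (w : Delta m) :
    0 < form b w.1 := by
  have h1 := hb.pos.trans_le (hb.last_le_form w)
  exact pos_of_mul_pos_right h1 (by positivity)

theorem Balanced.norm_form_le {b : Fin (m + 2) → ℝ} (hb : Balanced b) (w : Delta m) :
    ‖form b‖ ≤ 2 * (m + 2) ^ 2 * form b w.1 := by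
  have hf := (hb.form_pos w).le
  refine ContinuousLinearMap.opNorm_le_bound _ (by positivity) fun v => ?_
  rw [form_apply]
  have hle : ∀ i, b i ≤ 2 * ((m + 2) * form b w.1) := fun i => by
    have h1 := hb.le_add i (Fin.last (m + 1))
    have h2 := hb.last_le_form w
    linarith
  calc ‖∑ i, b i * v i.castSucc‖ ≤ ∑ _i : Fin (m + 2), 2 * ((m + 2) * form b w.1) * ‖v‖ := by
        refine norm_sum_le_of_le _ fun i _ => ?_
        rw [norm_mul, Real.norm_of_nonneg (hb.nonneg i)]
        exact mul_le_mul (hle i) (norm_le_pi_norm v _) (norm_nonneg _) (by positivity)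
    _ = _ := by
        rw [Finset.sum_const, Finset.card_univ, Fintype.card_fin, nsmul_eq_mul]
        push_cast
        ring

/-- Convexity of `x ↦ x ^ (-r)`: the graph lies above its tangent lines. -/
theorem one_sub_mul_le_rpow_neg {x y r : ℝ} (hx : 0 < x) (hy : 0 < y) (hr : 0 ≤ r) :
    x ^ (-r) - r * (x ^ (-r) * ((y - x) / x)) ≤ y ^ (-r) := by
  have hxr := Real.rpow_pos_of_pos hx (-r)
  have h1 : y ^ (-r) = x ^ (-r) * Real.exp (-r * Real.log (y / x)) := by
    rw [Real.rpow_def_of_pos hx, Real.rpow_def_of_pos hy, ← Real.exp_add,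
      Real.log_div hy.ne' hx.ne']
    ring_nf
  have h2 := Real.add_one_le_exp (-r * Real.log (y / x))
  have h3 := Real.log_le_sub_one_of_pos (div_pos hy hx)
  have h4 : (y - x) / x = y / x - 1 := by field_simp
  have h5 := mul_le_mul_of_nonneg_left h3 hr
  rw [h1, h4]
  have h6 : 1 - r * (y / x - 1) ≤ Real.exp (-r * Real.log (y / x)) := by linarith
  have := mul_le_mul_of_nonneg_left h6 hxr.le
  linarith

theorem abs_rpow_neg_sub_le {x y r t H : ℝ} (hx : 0 < x) (hy : 0 < y) (hr : 0 ≤ r)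
    (hH : 1 ≤ H) (ht : 0 ≤ t) (hxy : |y - x| ≤ t * x) (hyx : |y - x| ≤ t * y) (hyH : x ≤ H * y) :
    |y ^ (-r) - x ^ (-r)| ≤ r * t * H ^ r * x ^ (-r) := by
  have hxr := Real.rpow_pos_of_pos hx (-r)
  have hyr := Real.rpow_pos_of_pos hy (-r)
  have hH0 : 0 < H := by linarith
  have hHr : 1 ≤ H ^ r := Real.one_le_rpow hH hr
  have h1 := one_sub_mul_le_rpow_neg hx hy hr
  have h2 := one_sub_mul_le_rpow_neg hy hx hr
  have k1 : (y - x) / x ≤ t := by rw [div_le_iff₀ hx]; exact (le_abs_self _).trans hxy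
  have k2 : (x - y) / y ≤ t := by
    rw [div_le_iff₀ hy]; exact (le_abs_self _).trans (by rw [abs_sub_comm]; exact hyx)
  have k3 : y ^ (-r) ≤ H ^ r * x ^ (-r) := by
    rw [Real.rpow_neg hy.le, Real.rpow_neg hx.le, ← div_eq_mul_inv, ← one_div,
      div_le_div_iff₀ (Real.rpow_pos_of_pos hy r) (Real.rpow_pos_of_pos hx r), one_mul,
      ← Real.mul_rpow hH0.le hy.le]
    exact Real.rpow_le_rpow hx.le hyH hr
  have a1 : r * (x ^ (-r) * ((y - x) / x)) ≤ r * (x ^ (-r) * t) := by gcongr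
  have a2 : r * (y ^ (-r) * ((x - y) / y)) ≤ r * (H ^ r * x ^ (-r) * t) := by
    refine mul_le_mul_of_nonneg_left ?_ hr
    exact (mul_le_mul_of_nonneg_left k2 hyr.le).trans (mul_le_mul_of_nonneg_right k3 ht)
  have a3 : r * (x ^ (-r) * t) ≤ r * t * H ^ r * x ^ (-r) := by
    have : 0 ≤ r * t * x ^ (-r) := by positivity
    nlinarith
  rw [abs_le]
  constructor <;> linarith

/-- Second order Taylor estimate for `x ↦ x ^ (-s)` at comparable points. -/
theorem abs_rpow_neg_taylor_le {x y s t H : ℝ} (hx : 0 < x) (hy : 0 < y) (hs : 0 ≤ s)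
    (hH : 1 ≤ H) (ht : 0 ≤ t) (hxy : |y - x| ≤ t * x) (hyx : |y - x| ≤ t * y) (hyH : x ≤ H * y) :
    |y ^ (-s) - x ^ (-s) + s * x ^ (-(s + 1)) * (y - x)|
      ≤ s * (s + 1) * H ^ (s + 1) * t ^ 2 * x ^ (-s) := by
  have e : ∀ z : ℝ, 0 < z → z ^ (-(s + 1)) = z ^ (-s) / z := fun z hz => by
    rw [neg_add, ← sub_eq_add_neg, Real.rpow_sub_one hz.ne']
  have h1 := one_sub_mul_le_rpow_neg hx hy hs
  have h2 := one_sub_mul_le_rpow_neg hy hx hs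
  have h3 := abs_rpow_neg_sub_le hx hy (by linarith : 0 ≤ s + 1) hH ht hxy hyx hyH
  have b1 : s * x ^ (-(s + 1)) * (y - x) = s * (x ^ (-s) * ((y - x) / x)) := by
    rw [e x hx]; ring
  have b2 : s * (y ^ (-s) * ((x - y) / y)) = - (s * y ^ (-(s + 1)) * (y - x)) := by
    rw [e y hy]; ring
  have hH0 : 0 < H := by linarith
  rw [abs_of_nonneg (by rw [b1]; linarith)]
  calc y ^ (-s) - x ^ (-s) + s * x ^ (-(s + 1)) * (y - x)
      ≤ s * ((x ^ (-(s + 1)) - y ^ (-(s + 1))) * (y - x)) := by linarith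
    _ ≤ s * (((s + 1) * t * H ^ (s + 1) * x ^ (-(s + 1))) * (t * x)) := by
        refine mul_le_mul_of_nonneg_left ((le_abs_self _).trans ?_) hs
        rw [abs_mul, abs_sub_comm]
        refine mul_le_mul h3 hxy (abs_nonneg _) ?_
        have := Real.rpow_pos_of_pos hx (-(s + 1))
        positivity
    _ = _ := by rw [e x hx]; field_simp

/-- A function on the simplex with a first order expansion, with error and modulus of continuity of
the differential controlled by `K`. -/
structure HasExpansion (f : Delta m → ℝ) (ω : Delta m → (Fin (m + 3) → ℝ) →L[ℝ] ℝ) (K : ℝ) :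
    Prop where
  norm_le : ∀ w, ‖ω w‖ ≤ K
  lipschitz : ∀ w w', ‖ω w' - ω w‖ ≤ K * dist1 w w'
  taylor : ∀ w w', |f w' - f w - ω w (w'.1 - w.1)| ≤ K * dist1 w w' ^ 2

/-- Constant in the expansion of sums of powers of balanced forms. -/
noncomputable def expConst (m : ℕ) (s : ℝ) : ℝ :=
  s * (s + 1) * (1 + 2 * (2 * ((m : ℝ) + 2) ^ 2)) ^ (s + 1) * (2 * ((m : ℝ) + 2) ^ 2) ^ 2

/-- First order expansion of `form b ^ (-s)` on the simplex. All constants are proportional to the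
value of the function, which makes the expansions summable over families of forms. -/
theorem Balanced.expansion {s : ℝ} (hs : 1 < s) {b : Fin (m + 2) → ℝ} (hb : Balanced b)
    (w w' : Delta m) :
    ‖(-s * form b w.1 ^ (-(s + 1))) • form b‖ ≤ expConst m s * form b w.1 ^ (-s) ∧
    ‖(-s * form b w'.1 ^ (-(s + 1))) • form b - (-s * form b w.1 ^ (-(s + 1))) • form b‖
      ≤ expConst m s * dist1 w w' * form b w.1 ^ (-s) ∧
    |form b w'.1 ^ (-s) - form b w.1 ^ (-s)
        - ((-s * form b w.1 ^ (-(s + 1))) • form b) (w'.1 - w.1)|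
      ≤ expConst m s * dist1 w w' ^ 2 * form b w.1 ^ (-s) := by
  have hs0 : 0 ≤ s := by linarith
  set K : ℝ := 2 * ((m : ℝ) + 2) ^ 2 with hK
  have hK1 : 1 ≤ K := by
    have : (0 : ℝ) ≤ m := Nat.cast_nonneg _
    rw [hK]; nlinarith
  set H : ℝ := 1 + 2 * K with hH
  have hH1 : 1 ≤ H := by linarith
  have hC : expConst m s = s * (s + 1) * H ^ (s + 1) * K ^ 2 := rfl
  have hx := hb.form_pos w
  have hy := hb.form_pos w'
  have hd := dist1_nonneg w w'
  have hd2 := dist1_le_two w w'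
  have hdn : ‖w'.1 - w.1‖ ≤ dist1 w w' := by
    rw [← dist_eq_norm, dist_comm]; exact dist_le_dist1 w w'
  have hnx := hb.norm_form_le w
  have hny := hb.norm_form_le w'
  have hdiff : |form b w'.1 - form b w.1| ≤ ‖form b‖ * dist1 w w' := by
    rw [← map_sub, ← Real.norm_eq_abs]
    exact ((form b).le_opNorm _).trans (mul_le_mul_of_nonneg_left hdn (norm_nonneg _))
  rw [← hK] at hnx hny
  set x := form b w.1
  set y := form b w'.1
  set t := K * dist1 w w' with ht
  have ht0 : 0 ≤ t := by positivity
  have hxy : |y - x| ≤ t * x := hdiff.trans (by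
    rw [ht, mul_right_comm]; exact mul_le_mul_of_nonneg_right hnx hd)
  have hyx : |y - x| ≤ t * y := hdiff.trans (by
    rw [ht, mul_right_comm]; exact mul_le_mul_of_nonneg_right hny hd)
  have hyH : x ≤ H * y := by
    have h1 := neg_le_of_abs_le hyx
    have h2 : t * y ≤ 2 * K * y := by
      refine mul_le_mul_of_nonneg_right ?_ hy.le
      rw [ht]; nlinarith
    rw [hH]; linarith
  have e : x ^ (-(s + 1)) * x = x ^ (-s) := by
    rw [neg_add, ← sub_eq_add_neg, Real.rpow_sub_one hx.ne', div_mul_cancel₀ _ hx.ne']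
  have hxs := Real.rpow_pos_of_pos hx (-s)
  have hxs1 := Real.rpow_pos_of_pos hx (-(s + 1))
  have hHs : 1 ≤ H ^ (s + 1) := Real.one_le_rpow hH1 (by linarith)
  refine ⟨?_, ?_, ?_⟩
  · rw [norm_smul, norm_mul, norm_neg, Real.norm_of_nonneg hs0, Real.norm_of_nonneg hxs1.le]
    calc s * x ^ (-(s + 1)) * ‖form b‖ ≤ s * x ^ (-(s + 1)) * (K * x) := by gcongr
      _ = s * 1 * 1 * K * (x ^ (-(s + 1)) * x) := by ring
      _ ≤ s * (s + 1) * H ^ (s + 1) * K ^ 2 * x ^ (-s) := by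
          rw [e]
          gcongr
          · linarith
          · nlinarith
  · have e3 : (-s * y ^ (-(s + 1))) • form b - (-s * x ^ (-(s + 1))) • form b
        = (-s * y ^ (-(s + 1)) - -s * x ^ (-(s + 1))) • form b := (sub_smul _ _ _).symm
    rw [e3, ← mul_sub, norm_smul, norm_mul, norm_neg, Real.norm_of_nonneg hs0,
      Real.norm_eq_abs]
    have h3 := abs_rpow_neg_sub_le hx hy (by linarith : 0 ≤ s + 1) hH1 ht0 hxy hyx hyH
    calc s * |y ^ (-(s + 1)) - x ^ (-(s + 1))| * ‖form b‖
        ≤ s * ((s + 1) * t * H ^ (s + 1) * x ^ (-(s + 1))) * (K * x) := by gcongr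
      _ = s * (s + 1) * H ^ (s + 1) * K * t * (x ^ (-(s + 1)) * x) := by ring
      _ = _ := by rw [e, ht, hC]; ring
  · have h3 := abs_rpow_neg_taylor_le hx hy hs0 hH1 ht0 hxy hyx hyH
    have e2 : ((-s * x ^ (-(s + 1))) • form b) (w'.1 - w.1) = -(s * x ^ (-(s + 1)) * (y - x)) := by
      simp only [smul_apply, map_sub, smul_eq_mul]
      ring
    rw [e2, sub_neg_eq_add]
    refine h3.trans (le_of_eq ?_)
    rw [ht, hC]; ring

/-- Sums of the powers `-s` of balanced forms. -/
def IsFormSum (s : ℝ) (f : Delta m → ℝ) : Prop :=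
  ∃ (ι : Type) (b : ι → Fin (m + 2) → ℝ), (∀ i, Balanced (b i)) ∧
    ∀ w : Delta m, HasSum (fun i => form (b i) w.1 ^ (-s)) (f w)

theorem isFormSum_one (s : ℝ) : IsFormSum s fun _ : Delta m => 1 := by
  refine ⟨Unit, fun _ _ => 1, fun _ => ⟨fun _ => zero_le_one, one_pos, fun _ _ => by norm_num⟩,
    fun w => ?_⟩
  have : form (fun _ => 1) w.1 = 1 := by
    rw [form_coe]; simpa using sum_coord w
  simp only [this, Real.one_rpow]
  exact hasSum_unique _

/-- The transfer operator acts on sums of powers of linear forms by composing the forms with the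
branches. -/
theorem IsFormSum.transfer {s : ℝ} (hs : 1 < s) {f : Delta m → ℝ} (hfb : ContractingSystem.Bdd f)
    (hf : IsFormSum s f) : IsFormSum s ((system m).T s f) := by
  obtain ⟨ι, b, hb, hsum⟩ := hf
  refine ⟨(Fin (m + 1) × ℕ) × ι, fun q => pull q.1 (b q.2), fun q => (hb q.2).pull q.1,
    fun w => ?_⟩
  have hterm : ∀ q : (Fin (m + 1) × ℕ) × ι, form (pull q.1 (b q.2)) w.1 ^ (-s)
      = Real.exp (-s * (system m).len q.1 w) * form (b q.2) (act q.1 w).1 ^ (-s) := fun q => by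
    rw [form_pull, Real.mul_rpow (height_pos _ _).le ((hb q.2).form_pos _).le, ← exp_log_height]
    rfl
  have hfib : ∀ p, HasSum (fun i => form (pull p (b i)) w.1 ^ (-s))
      (Real.exp (-s * (system m).len p w) * f ((system m).map p w)) := fun p => by
    have := (hsum (act p w)).mul_left (Real.exp (-s * (system m).len p w))
    refine this.congr_fun fun i => ?_
    exact hterm (p, i)
  have hT := (system m).summable_T hs hfb w
  have hsm : Summable fun q : (Fin (m + 1) × ℕ) × ι => form (pull q.1 (b q.2)) w.1 ^ (-s) := by
    refine (summable_prod_of_nonneg fun q =>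
      (Real.rpow_pos_of_pos (((hb q.2).pull q.1).form_pos w) _).le).mpr
      ⟨fun p => (hfib p).summable, ?_⟩
    exact hT.congr fun p => (hfib p).tsum_eq.symm
  have h1 := hsm.hasSum.prod_fiberwise hfib
  rw [ContractingSystem.T, h1.tsum_eq]
  exact hsm.hasSum

theorem IsFormSum.exists_expansion {s c G : ℝ} (hs : 1 < s) (hc : 0 ≤ c) {f : Delta m → ℝ}
    (hf : IsFormSum s f) (hG : ∀ w, c * f w ≤ G) :
    ∃ ω, HasExpansion (fun w => c * f w) ω (expConst m s * G) := by
  obtain ⟨ι, b, hb, hsum⟩ := hf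
  have hs0 : 0 ≤ s := by linarith
  have hK0 : 0 ≤ expConst m s := by unfold expConst; positivity
  set η : ι → Delta m → (Fin (m + 3) → ℝ) →L[ℝ] ℝ := fun i w =>
    (-s * form (b i) w.1 ^ (-(s + 1))) • form (b i) with hη
  have hη1 : ∀ i w, ‖η i w‖ ≤ expConst m s * form (b i) w.1 ^ (-s) := fun i w =>
    ((hb i).expansion hs w w).1
  have hηs : ∀ w, Summable fun i => η i w := fun w =>
    Summable.of_norm_bounded ((hsum w).summable.mul_left _) fun i => hη1 i w
  have hscale : ∀ (w : Delta m) (a v : ℝ), 0 ≤ a → v ≤ expConst m s * a * f w →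
      c * v ≤ expConst m s * G * a := fun w a v ha hv => by
    calc c * v ≤ c * (expConst m s * a * f w) := mul_le_mul_of_nonneg_left hv hc
      _ = expConst m s * a * (c * f w) := by ring
      _ ≤ expConst m s * a * G := mul_le_mul_of_nonneg_left (hG w) (by positivity)
      _ = _ := by ring
  refine ⟨fun w => c • ∑' i, η i w, fun w => ?_, fun w w' => ?_, fun w w' => ?_⟩
  · rw [norm_smul, Real.norm_of_nonneg hc]
    have := hscale w 1 ‖∑' i, η i w‖ zero_le_one (by
      rw [mul_one]
      exact tsum_of_norm_bounded ((hsum w).mul_left _) fun i => hη1 i w)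
    linarith
  · have e3 : c • ∑' i, η i w' - c • ∑' i, η i w = c • (∑' i, η i w' - ∑' i, η i w) :=
      (smul_sub _ _ _).symm
    rw [e3, norm_smul, Real.norm_of_nonneg hc, ← (hηs w').tsum_sub (hηs w)]
    refine hscale w _ _ (dist1_nonneg w w') ?_
    exact tsum_of_norm_bounded ((hsum w).mul_left _) fun i => ((hb i).expansion hs w w').2.1
  · have e : c * f w' - c * f w - (c • ∑' i, η i w) (w'.1 - w.1)
        = c * ∑' i, (form (b i) w'.1 ^ (-s) - form (b i) w.1 ^ (-s) - η i w (w'.1 - w.1)) := by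
      have h1 : HasSum (fun i => η i w (w'.1 - w.1)) ((∑' i, η i w) (w'.1 - w.1)) :=
        (hηs w).hasSum.mapL (ContinuousLinearMap.apply ℝ ℝ (w'.1 - w.1))
      rw [(((hsum w').sub (hsum w)).sub h1).tsum_eq]
      simp only [smul_apply, smul_eq_mul]
      ring
    rw [e, abs_mul, abs_of_nonneg hc]
    refine hscale w _ _ (by positivity) ?_
    rw [← Real.norm_eq_abs]
    exact tsum_of_norm_bounded ((hsum w).mul_left _) fun i => ((hb i).expansion hs w w').2.2

theorem isFormSum_iterate {s : ℝ} (hs : 1 < s) (N : ℕ) :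
    IsFormSum s (((system m).T s)^[N] fun _ => 1) := by
  induction N with
  | zero => exact isFormSum_one s
  | succ N ih =>
    rw [Function.iterate_succ_apply']
    exact ih.transfer hs ((ContractingSystem.Bdd.const 1).iterate hs N)

open Filter Topology

/-- Expansions with a common bound survive a pointwise limit of the functions, as the
differentials accumulate. -/
theorem HasExpansion.of_tendsto {K : ℝ} {f : ℕ → Delta m → ℝ} {g : Delta m → ℝ}
    (hf : ∀ N, ∃ ω, HasExpansion (f N) ω K) (hg : ∀ w, Tendsto (fun N => f N w) atTop (𝓝 (g w))) :
    ∃ ω, HasExpansion g ω K := by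
  choose ω hω using hf
  let U : Ultrafilter ℕ := Filter.hyperfilter ℕ
  have hU : (U : Filter ℕ) ≤ atTop := Nat.hyperfilter_le_atTop
  have hconv : ∀ w, ∃ L, Tendsto (fun N => ω N w) U (𝓝 L) := by
    intro w
    have : ProperSpace ((Fin (m + 3) → ℝ) →L[ℝ] ℝ) := FiniteDimensional.proper_real _
    obtain ⟨L, -, hL⟩ := (isCompact_closedBall (0 : (Fin (m + 3) → ℝ) →L[ℝ] ℝ) K).ultrafilter_le_nhds
      (U.map fun N => ω N w) (by
        rw [le_principal_iff, Ultrafilter.mem_coe, Ultrafilter.mem_map]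
        refine Filter.univ_mem' fun N => ?_
        simpa using (hω N).norm_le w)
    exact ⟨L, hL⟩
  choose Ω hΩ using hconv
  refine ⟨Ω, fun w => ?_, fun w w' => ?_, fun w w' => ?_⟩
  · exact le_of_tendsto' (hΩ w).norm fun N => (hω N).norm_le w
  · exact le_of_tendsto' ((hΩ w').sub (hΩ w)).norm fun N => (hω N).lipschitz w w'
  · refine le_of_tendsto' (Tendsto.abs ((((hg w').mono_left hU).sub ((hg w).mono_left hU)).sub ?_))
      fun N => (hω N).taylor w w'
    exact ((ContinuousLinearMap.apply ℝ ℝ (w'.1 - w.1)).continuous.tendsto _).comp (hΩ w)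

theorem dist1_le_dist (w w' : Delta m) : dist1 w w' ≤ (m + 2) * dist w w' := by
  calc dist1 w w' ≤ ∑ _i : Fin (m + 2), dist w w' := Finset.sum_le_sum fun i _ => by
        rw [Subtype.dist_eq, ← Real.dist_eq]
        exact dist_le_pi_dist w.1 w'.1 i.castSucc
    _ = _ := by simp

/-- The extension by zero of a function with an expansion is continuously differentiable on the
simplex. -/
theorem HasExpansion.isC1 {K : ℝ} {f : Delta m → ℝ} {ω : Delta m → (Fin (m + 3) → ℝ) →L[ℝ] ℝ}
    (hf : HasExpansion f ω K) : IsC1 fun w => (f w : ℂ) := by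
  classical
  have hK0 : 0 ≤ K := (norm_nonneg _).trans (hf.norm_le (vertex m))
  let g : (Fin (m + 3) → ℝ) → ℝ := fun x => if hx : x ∈ Delta m then f ⟨x, hx⟩ else 0
  let g' : (Fin (m + 3) → ℝ) → (Fin (m + 3) → ℝ) →L[ℝ] ℝ := fun x =>
    if hx : x ∈ Delta m then ω ⟨x, hx⟩ else 0
  have hg : ∀ w : Delta m, g w.1 = f w := fun w => dif_pos w.2
  have hg' : ∀ w : Delta m, g' w.1 = ω w := fun w => dif_pos w.2
  have hderiv : ∀ x ∈ Delta m, HasFDerivWithinAt g (g' x) (Delta m) x := by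
    intro x hx
    rw [hasFDerivWithinAt_iff_isLittleO, Asymptotics.isLittleO_iff]
    intro c hc
    set L := K * (m + 2) ^ 2 + 1 with hL
    have hL0 : 0 < L := by positivity
    have hball : ∀ᶠ y in 𝓝[Delta m] x, dist y x < c / L :=
      mem_nhdsWithin_of_mem_nhds (Metric.ball_mem_nhds x (by positivity))
    filter_upwards [hball, self_mem_nhdsWithin] with y hy hyD
    have h1 := hf.taylor ⟨x, hx⟩ ⟨y, hyD⟩
    have h2 := dist1_le_dist ⟨x, hx⟩ ⟨y, hyD⟩
    have h3 : dist (⟨x, hx⟩ : Delta m) ⟨y, hyD⟩ = ‖y - x‖ := by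
      rw [Subtype.dist_eq, dist_comm, dist_eq_norm]
    rw [h3] at h2
    rw [← hg, ← hg, ← hg'] at h1
    refine h1.trans ?_
    rw [dist_eq_norm, lt_div_iff₀ hL0] at hy
    have hn := norm_nonneg (y - x)
    calc K * dist1 ⟨x, hx⟩ ⟨y, hyD⟩ ^ 2 ≤ K * ((m + 2) * ‖y - x‖) ^ 2 := by
          have := dist1_nonneg (⟨x, hx⟩ : Delta m) ⟨y, hyD⟩
          gcongr
      _ = (‖y - x‖ * (K * (m + 2) ^ 2)) * ‖y - x‖ := by ring
      _ ≤ c * ‖y - x‖ := by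
          refine mul_le_mul_of_nonneg_right ?_ hn
          rw [hL] at hy
          linarith
  have hcont : ContinuousOn g' (Delta m) := by
    rw [continuousOn_iff_continuous_domRestrict]
    have : (Delta m).domRestrict g' = ω := funext hg'
    rw [this]
    refine LipschitzWith.continuous (K := (K * (m + 2)).toNNReal)
      (LipschitzWith.of_dist_le_mul fun w w' => ?_)
    rw [Real.coe_toNNReal _ (by positivity), dist_comm, dist_eq_norm]
    refine (hf.lipschitz w w').trans ?_
    rw [mul_assoc]
    exact mul_le_mul_of_nonneg_left (dist1_le_dist w w') hK0
  have hC : ContDiffOn ℝ 1 g (Delta m) := by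
    have h01 : (1 : WithTop ℕ∞) = 0 + 1 := by norm_num
    rw [h01, contDiffOn_succ_iff_hasFDerivWithinAt (by simp)]
    intro x hx
    refine ⟨Delta m, ?_, by simp, g', hderiv, contDiffOn_zero.mpr hcont⟩
    rw [Set.insert_eq_of_mem hx]
    exact self_mem_nhdsWithin
  refine ⟨fun x => (g x : ℂ), Complex.ofRealCLM.contDiff.comp_contDiffOn hC, fun w => ?_⟩
  exact congrArg Complex.ofReal (hg w)

end MarkoffHurwitz

/-! ### The leading eigenvalue of the transfer operators -/

namespace MarkoffHurwitz

variable {m : ℕ}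

open Filter Topology

/-- The normalized iterates of the constant function have a continuously differentiable limit. -/
theorem isC1_of_tendsto_normIter {s : ℝ} (hs : 1 < s) {h : Delta m → ℝ}
    (hh : ∀ w, Tendsto (fun N => (system m).normIter s N w) atTop (𝓝 (h w))) :
    IsC1 fun w => (h w : ℂ) := by
  have ha := (system m).one_le_apt (zero_le_one.trans hs.le)
  have ha0 := zero_le_one.trans ha
  have hcone : ∀ N, (system m).Cone ((system m).apt s) (((system m).T s)^[N] fun _ => 1) := fun N =>
    (ContractingSystem.Cone.const ha0 zero_le_one).iterate hs N
  set G := Real.exp ((system m).apt s * (system m).diam) with hG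
  obtain ⟨ω, hω⟩ := HasExpansion.of_tendsto (K := expConst m s * G) (f := fun N w =>
      (system m).normIter s N w) (fun N => by
    have h0 := (hcone N).1 (system m).base
    have e : (fun w => (system m).normIter s N w) = fun w =>
        (((system m).T s)^[N] (fun _ => 1) (system m).base)⁻¹ *
          ((system m).T s)^[N] (fun _ => 1) w := by
      funext w; rw [ContractingSystem.normIter, div_eq_inv_mul]
    simp only [e]
    refine (isFormSum_iterate hs N).exists_expansion hs (inv_nonneg.mpr h0) fun w => ?_
    have h1 := (hcone N).le_diam ha0 w (system m).base
    rw [← hG] at h1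
    rw [inv_mul_eq_div]
    exact div_le_of_le_mul₀ h0 (Real.exp_pos _).le h1) hh
  exact hω.isC1

theorem IsC1.continuous {f : Delta m → ℂ} (hf : IsC1 f) : Continuous f := by
  obtain ⟨g, hg, hgf⟩ := hf
  have h := continuousOn_iff_continuous_domRestrict.mp hg.continuousOn
  have e : (Delta m).domRestrict g = f := funext hgf
  rwa [e] at h

theorem isLeadingEigenvalue {s l : ℝ} (hs : 1 < s) {h : Delta m → ℝ}
    (hP : (system m).IsPerron s l h) (hC : IsC1 fun w => (h w : ℂ)) :
    IsLeadingEigenvalue m s l := by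
  refine ⟨⟨fun w => (h w : ℂ), hC, fun h0 => ?_, fun w => ?_⟩, fun μ hμ hne => ?_⟩
  · have h1 := congr_fun h0 (system m).base
    simp [hP.base] at h1
  · rw [transfer_complex, (system m).Tc_ofReal, hP.eigen, Complex.ofReal_mul]
  · obtain ⟨f, hf, hf0, hfe⟩ := hμ
    refine hP.norm_lt dist_le_dist1 tendsto_dist1 hs hf.continuous hf0 (fun w => ?_) hne
    rw [← transfer_complex, hfe]

theorem hasEigenmeasure_iff {s l r : ℝ} (hs : 1 < s) {h : Delta m → ℝ}
    (hP : (system m).IsPerron s l h) : HasEigenmeasure m s r ↔ r = l := by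
  constructor
  · rintro ⟨ν, hν, hνf⟩
    refine hP.eq_of_eigenmeasure tendsto_dist1 hs (ν := ν) fun f => ?_
    rw [← hνf f, transfer_real]
  · rintro rfl
    obtain ⟨ν, hν, hνf⟩ := (system m).exists_eigenmeasure dist_le_dist1 tendsto_dist1 hs hP
    refine ⟨ν, hν, fun f => ?_⟩
    rw [← hνf f, transfer_real]

end MarkoffHurwitz

open MarkoffHurwitz in
theorem proposition3p11 (m : ℕ) :
    ∃ lam : ℝ → ℝ,
      -- `lam s` is the eigenvalue `λ_s`, which is well defined for `s > 1`
      (∀ s : ℝ, 1 < s →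
        0 < lam s ∧
        (∀ l : ℝ, MarkoffHurwitz.HasEigenmeasure m s l ↔ l = lam s) ∧
        MarkoffHurwitz.IsLeadingEigenvalue m s (lam s)) ∧
      AnalyticOnNhd ℝ lam (Set.Ioi 1) ∧
      StrictAntiOn lam (Set.Ioi 1) ∧
      (∃ S : ℝ, ∀ s : ℝ, S < s → lam s < 1) ∧
      (∀ β₁ β₂ : ℝ, 1 < β₁ → 1 < β₂ → lam β₁ = 1 → lam β₂ = 1 → β₁ = β₂) ∧
      ((¬ ∃ β₀ : ℝ, 1 < β₀ ∧ lam β₀ = 1) → ∀ s : ℝ, 1 < s → lam s < 1) := by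
  have hex : ∀ s : ℝ, 1 < s → ∃ l h, (system m).IsPerron s l h ∧
      ∀ w, Filter.Tendsto (fun N => (system m).normIter s N w) Filter.atTop (nhds (h w)) :=
    fun s hs => (system m).exists_isPerron hs
  choose! lam h hP hlim using hex
  have hlog : 0 < Real.log (3 / 2) := Real.log_pos (by norm_num)
  have hdecay : ∀ s t, 1 < s → s ≤ t →
      lam t ≤ Real.exp (-((t - s) * Real.log (3 / 2))) * lam s := fun s t hs hst =>
    (hP s hs).le_exp_mul hs hst log_height_ge (hP t (hs.trans_le hst))
  have hanti : StrictAntiOn lam (Set.Ioi 1) := by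
    intro s hs t _ hst
    refine (hdecay s t hs hst.le).trans_lt (mul_lt_of_lt_one_left (hP s hs).pos ?_)
    rw [Real.exp_lt_one_iff, neg_lt_zero]
    exact mul_pos (sub_pos.mpr hst) hlog
  have han : AnalyticOnNhd ℝ lam (Set.Ioi 1) :=
    ContractingSystem.analyticOnNhd_of_isPerron hP
  have hlarge : ∃ S : ℝ, ∀ s : ℝ, S < s → lam s < 1 := by
    refine ⟨2 + lam 2 / Real.log (3 / 2), fun s hs => ?_⟩
    have h2 := (hP 2 one_lt_two).pos
    have hs2 : 2 ≤ s := by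
      have : 0 < lam 2 / Real.log (3 / 2) := by positivity
      linarith
    refine (hdecay 2 s one_lt_two hs2).trans_lt ?_
    have h3 : lam 2 < (s - 2) * Real.log (3 / 2) := by
      rw [← div_lt_iff₀ hlog]; linarith
    rw [Real.exp_neg, inv_mul_lt_iff₀ (Real.exp_pos _), mul_one]
    exact h3.trans ((lt_add_one _).trans_le (Real.add_one_le_exp _))
  refine ⟨lam, fun s hs => ⟨(hP s hs).pos, fun l => hasEigenmeasure_iff hs (hP s hs),
    isLeadingEigenvalue hs (hP s hs) (isC1_of_tendsto_normIter hs (hlim s hs))⟩, han, hanti,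
    hlarge, fun β₁ β₂ h1 h2 e1 e2 => hanti.injOn h1 h2 (e1.trans e2.symm), fun hno s hs => ?_⟩
  -- a value `≥ 1` would force the value `1`, by the intermediate value theorem
  by_contra! hge
  obtain ⟨S, hS⟩ := hlarge
  set t := max s (S + 1) with ht
  have hst : s ≤ t := le_max_left _ _
  have hlt : lam t < 1 := hS t ((lt_add_one S).trans_le (le_max_right _ _))
  have hcont : ContinuousOn lam (Set.Icc s t) :=
    han.continuousOn.mono fun x hx => hs.trans_le hx.1
  obtain ⟨β, hβ, hβ1⟩ := intermediate_value_Icc' hst hcont ⟨hlt.le, hge⟩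
  exact hno ⟨β, hs.trans_le hβ.1, hβ1⟩
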